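/- Let $k$ be a field of characteristic $2$, let $G=\mathrm{SL}_2$ over $k$ with coordinate ring $k[G]=k[a,b,c,d]/(ad-bc-1)$, let $T$ be the diagonal torus and let $N$ be the normalizer of $T$ in $G$ (as group schemes). For $H=T,N$ let $k[G/H]\subseteq k[G]$ be the algebra of regular functions invariant under right translation by $H$, with $G$ acting by left translation, $(x\cdot f)(g)=f(x^{-1}g)$. For an affine group scheme $\Gamma$ over $k$ and a $\Gamma$-module (i.e. $k[\Gamma]$-comodule) $M$ let $H^i(\Gamma,M)=\mathrm{Ext}^i_\Gamma(k,M)$; if $M$ is a commutative $\Gamma$-algebra, $H^*(\Gamma,M)=\bigoplus_i H^i(\Gamma,M)$ carries the cup product. For $r\ge 1$ let $F^r:G\to G$ be the $r$-th Frobenius endomorphism, which raises matrix entries to the power $2^r$, and let $G_r=\ker F^r$. The $r$-th Frobenius twist $V^{(r)}$ of a $G$-module $V$ is its pull-back along $F^r$, and $V\cong M^{(-r)}$ means $V^{(r)}\cong M$. (1) There is a short exact sequence of $G$-modules $$\mathcal E:\quad 0\to k[G/N]\to k[G/T]\xrightarrow{\;p\;} k[G/N]\to 0$$ in which the first map is the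 inclusion and $p$ is $k[G/N]$-linear with $p(ad)=1$. (2) For every $i\ge 0$, $H^i(G,k[G/N])$ is one-dimensional over $k$; it is spanned by the Yoneda product of the inclusion $f:k\to k[G/N]$ with $i$ copies of $\mathcal E$ (for $i=0$, by $f$ itself). (3) $H^*(G,k[G/N])$ is a polynomial ring over $k$ in one generator of degree $1$: there is a $k$-algebra isomorphism $k[X]\to H^*(G,k[G/N])$ that takes $X^i$ to the Yoneda product of $f$ with $i$ copies of $\mathcal E$, for every $i\ge 0$. (4) For all $r\ge 1$ and $i>0$, $H^i(G_r,k[G/N])=0$. (5) For all $r\ge 1$, $H^0(G_r,k[G/N])^{(-r)}\cong k[G/N]$ as $G$-modules: a $G$-module $V$ satisfies $V^{(r)}\cong H^0(G_r,k[G/N])=k[G/N]^{G_r}$ if and only if $V\cong k[G/N]$. Moreover the isomorphism $k[G/N]^{(r)}\cong k[G/N]^{G_r}$ can be chosen to be multiplicative. -/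

import Mathlib

open CategoryTheory CategoryTheory.Limits
open scoped TensorProduct

universe u

/-- Right comodules over a coalgebra `C` over the field `k`.  When `C = k[G]` is the coordinate ring
of an affine group scheme `G`, these are the rational `G`-modules: a point `g : k[G] → R` acts by
`v ↦ ∑ vᵢ ⊗ g cᵢ`, where `ρ v = ∑ vᵢ ⊗ cᵢ`. -/
structure Comod (k C : Type u) [Field k] [AddCommGroup C] [Module k C] [Coalgebra k C] where
  V : Type u
  [addCommGroup : AddCommGroup V]
  [module : Module k V]
  ρ : V →ₗ[k] V ⊗[k] C
  coassoc : (TensorProduct.assoc k V C C).toLinearMap ∘ₗ LinearMap.rTensor C ρ ∘ₗ ρ =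
    LinearMap.lTensor V (Coalgebra.comul (R := k) (A := C)) ∘ₗ ρ
  counit : (TensorProduct.rid k V).toLinearMap ∘ₗ
    LinearMap.lTensor V (Coalgebra.counit (R := k) (A := C)) ∘ₗ ρ = LinearMap.id

namespace Comod

attribute [instance] Comod.addCommGroup Comod.module

section Category

variable {k C : Type u} [Field k] [AddCommGroup C] [Module k C] [Coalgebra k C]

/-- Morphisms of comodules. -/
@[ext]
structure Hom (X Y : Comod k C) where
  lin : X.V →ₗ[k] Y.V
  comm : Y.ρ ∘ₗ lin = LinearMap.rTensor C lin ∘ₗ X.ρ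

instance : Category (Comod k C) where
  Hom X Y := Hom X Y
  id X := ⟨LinearMap.id, by simp⟩
  comp f g := ⟨g.lin ∘ₗ f.lin, by
    rw [← LinearMap.comp_assoc, g.comm, LinearMap.comp_assoc, f.comm, LinearMap.rTensor_comp,
      LinearMap.comp_assoc]⟩

/-- The linear map underlying a morphism of comodules. -/
abbrev lin {X Y : Comod k C} (f : X ⟶ Y) : X.V →ₗ[k] Y.V := Hom.lin f

/-- Construct a morphism of comodules from a linear map that commutes with the coactions. -/
abbrev mkHom {X Y : Comod k C} (f : X.V →ₗ[k] Y.V)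
    (h : Y.ρ ∘ₗ f = LinearMap.rTensor C f ∘ₗ X.ρ) : X ⟶ Y := Hom.mk f h

theorem comm {X Y : Comod k C} (f : X ⟶ Y) : Y.ρ ∘ₗ lin f = LinearMap.rTensor C (lin f) ∘ₗ X.ρ :=
  Hom.comm f

theorem comm_apply {X Y : Comod k C} (f : X ⟶ Y) (x : X.V) :
    Y.ρ (lin f x) = LinearMap.rTensor C (lin f) (X.ρ x) :=
  LinearMap.congr_fun (comm f) x

theorem hom_ext {X Y : Comod k C} {f g : X ⟶ Y} (h : lin f = lin g) : f = g := Hom.ext h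

@[simp] theorem lin_id (X : Comod k C) : lin (𝟙 X) = LinearMap.id := rfl

@[simp] theorem lin_comp {X Y Z : Comod k C} (f : X ⟶ Y) (g : Y ⟶ Z) :
    lin (f ≫ g) = lin g ∘ₗ lin f := rfl


instance (X Y : Comod k C) : Zero (X ⟶ Y) := ⟨mkHom 0 (by simp)⟩

instance (X Y : Comod k C) : Add (X ⟶ Y) :=
  ⟨fun f g => mkHom (lin f + lin g) (by
    rw [LinearMap.comp_add, comm, comm, LinearMap.rTensor_add, LinearMap.add_comp])⟩

instance (X Y : Comod k C) : Neg (X ⟶ Y) :=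
  ⟨fun f => mkHom (-lin f) (by
    rw [LinearMap.comp_neg, comm, LinearMap.rTensor_neg, LinearMap.neg_comp])⟩

instance (X Y : Comod k C) : AddCommGroup (X ⟶ Y) where
  add_assoc f g h := hom_ext (add_assoc (lin f) (lin g) (lin h))
  zero_add f := hom_ext (zero_add (lin f))
  add_zero f := hom_ext (add_zero (lin f))
  neg_add_cancel f := hom_ext (neg_add_cancel (lin f))
  add_comm f g := hom_ext (add_comm (lin f) (lin g))
  nsmul := nsmulRec
  zsmul := zsmulRec

@[simp] theorem lin_add {X Y : Comod k C} (f g : X ⟶ Y) : lin (f + g) = lin f + lin g := rfl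
@[simp] theorem lin_zero {X Y : Comod k C} : lin (0 : X ⟶ Y) = 0 := rfl

instance : Preadditive (Comod k C) where
  add_comp _ _ _ f f' g := hom_ext (LinearMap.comp_add (lin f) (lin f') (lin g))
  comp_add _ _ _ f g g' := hom_ext (LinearMap.add_comp (lin f) (lin g') (lin g))

instance (X Y : Comod k C) : Module k (X ⟶ Y) where
  smul c f := mkHom (c • lin f) (by
    rw [LinearMap.comp_smul, comm, LinearMap.rTensor_smul, LinearMap.smul_comp])
  one_smul f := hom_ext (one_smul k (lin f))
  mul_smul a b f := hom_ext (mul_smul a b (lin f))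
  smul_zero a := hom_ext (smul_zero a)
  smul_add a f g := hom_ext (smul_add a (lin f) (lin g))
  add_smul a b f := hom_ext (add_smul a b (lin f))
  zero_smul f := hom_ext (zero_smul k (lin f))

@[simp] theorem lin_smul {X Y : Comod k C} (a : k) (f : X ⟶ Y) : lin (a • f) = a • lin f := rfl

instance : Linear k (Comod k C) where
  smul_comp _ _ _ a f g := hom_ext (LinearMap.comp_smul (lin g) a (lin f))
  comp_smul _ _ _ f a g := hom_ext (LinearMap.smul_comp a (lin g) (lin f))

theorem rTensor_injective {V W : Type u} [AddCommGroup V] [Module k V] [AddCommGroup W] [Module k W]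
    (D : Type u) [AddCommGroup D] [Module k D]
    {f : V →ₗ[k] W} (hf : Function.Injective f) : Function.Injective (LinearMap.rTensor D f) :=
  Module.Flat.rTensor_preserves_injective_linearMap f hf

/-- The coaction on a subspace `W` with `ρ(W) ⊆ W ⊗ C`. -/
noncomputable def subCoaction (X : Comod k C) (W : Submodule k X.V)
    (h : ∀ w ∈ W, X.ρ w ∈ LinearMap.range (LinearMap.rTensor C W.subtype)) : W →ₗ[k] W ⊗[k] C :=
  (LinearEquiv.ofInjective (LinearMap.rTensor C W.subtype)
    (rTensor_injective C W.injective_subtype)).symm.toLinearMap ∘ₗ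
    (X.ρ ∘ₗ W.subtype).codRestrict _ (fun w => h w w.2)

theorem rTensor_subCoaction (X : Comod k C) (W : Submodule k X.V)
    (h : ∀ w ∈ W, X.ρ w ∈ LinearMap.range (LinearMap.rTensor C W.subtype)) :
    LinearMap.rTensor C W.subtype ∘ₗ subCoaction X W h = X.ρ ∘ₗ W.subtype := by
  ext w
  have := LinearEquiv.ofInjective_symm_apply (h := rTensor_injective C W.injective_subtype)
    (f := LinearMap.rTensor C W.subtype)
    ((X.ρ ∘ₗ W.subtype).codRestrict _ (fun w => h w w.2) w)
  simp only [subCoaction, LinearMap.comp_apply, LinearEquiv.coe_coe]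
  rw [this]
  rfl

/-- The subcomodule on a subspace `W` with `ρ(W) ⊆ W ⊗ C`. -/
noncomputable abbrev sub (X : Comod k C) (W : Submodule k X.V)
    (h : ∀ w ∈ W, X.ρ w ∈ LinearMap.range (LinearMap.rTensor C W.subtype)) : Comod k C where
  V := W
  ρ := subCoaction X W h
  coassoc := by
    have key := rTensor_subCoaction X W h
    have hinj : Function.Injective (LinearMap.rTensor (C ⊗[k] C) W.subtype) :=
      rTensor_injective _ W.injective_subtype
    apply LinearMap.ext
    intro w
    apply hinj
    have h1 := LinearMap.congr_fun X.coassoc w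
    have h2 : ∀ t : W ⊗[k] C, LinearMap.rTensor (C ⊗[k] C) W.subtype
        (TensorProduct.assoc k W C C (LinearMap.rTensor C (subCoaction X W h) t)) =
        TensorProduct.assoc k X.V C C
          (LinearMap.rTensor C X.ρ (LinearMap.rTensor C W.subtype t)) := by
      intro t
      rw [← LinearMap.rTensor_comp_apply, ← key, LinearMap.rTensor_comp_apply]
      generalize LinearMap.rTensor C (subCoaction X W h) t = z
      induction z with
      | zero => simp
      | add a b ha hb => simp only [map_add, ha, hb]
      | tmul a c =>
        induction a with
        | zero => simp
        | add a b ha hb => simp only [map_add, TensorProduct.add_tmul, ha, hb]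
        | tmul a b => simp
    have h3 : ∀ t : W ⊗[k] C, LinearMap.rTensor (C ⊗[k] C) W.subtype
        (LinearMap.lTensor W (Coalgebra.comul (R := k)) t) =
        LinearMap.lTensor X.V (Coalgebra.comul (R := k)) (LinearMap.rTensor C W.subtype t) := by
      intro t
      rw [← LinearMap.comp_apply, ← LinearMap.comp_apply, LinearMap.rTensor_comp_lTensor,
        LinearMap.lTensor_comp_rTensor]
    have h4 := LinearMap.congr_fun key w
    simp only [LinearMap.comp_apply, LinearEquiv.coe_coe] at h1 h4 ⊢
    rw [h2, h3, h4]
    exact h1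
  counit := by
    have key := rTensor_subCoaction X W h
    apply LinearMap.ext
    intro w
    apply W.injective_subtype
    have h1 := LinearMap.congr_fun X.counit w
    have h2 : ∀ t : W ⊗[k] C, W.subtype (TensorProduct.rid k W
        (LinearMap.lTensor W (Coalgebra.counit (R := k)) t)) =
        TensorProduct.rid k X.V (LinearMap.lTensor X.V (Coalgebra.counit (R := k))
          (LinearMap.rTensor C W.subtype t)) := by
      intro t
      induction t with
      | zero => simp
      | add a b ha hb => simp only [map_add, ha, hb]
      | tmul a c => simp
    have h4 := LinearMap.congr_fun key w
    simp only [LinearMap.comp_apply, LinearEquiv.coe_coe] at h1 h4 ⊢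
    rw [h2, h4]
    exact h1

/-- The inclusion of a subcomodule. -/
noncomputable def subι (X : Comod k C) (W : Submodule k X.V)
    (h : ∀ w ∈ W, X.ρ w ∈ LinearMap.range (LinearMap.rTensor C W.subtype)) : sub X W h ⟶ X :=
  mkHom (X := sub X W h) W.subtype (rTensor_subCoaction X W h).symm

/-- The coaction on the quotient by a subcomodule. -/
noncomputable def quotCoaction (X : Comod k C) (W : Submodule k X.V)
    (h : W ≤ LinearMap.ker (LinearMap.rTensor C W.mkQ ∘ₗ X.ρ)) : (X.V ⧸ W) →ₗ[k] (X.V ⧸ W) ⊗[k] C :=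
  W.liftQ (LinearMap.rTensor C W.mkQ ∘ₗ X.ρ) h

/-- The quotient comodule by a subspace `W` such that `ρ(W)` dies in `(X / W) ⊗ C`. -/
noncomputable abbrev quot (X : Comod k C) (W : Submodule k X.V)
    (h : W ≤ LinearMap.ker (LinearMap.rTensor C W.mkQ ∘ₗ X.ρ)) : Comod k C where
  V := X.V ⧸ W
  ρ := quotCoaction X W h
  coassoc := by
    have key : quotCoaction X W h ∘ₗ W.mkQ = LinearMap.rTensor C W.mkQ ∘ₗ X.ρ := W.liftQ_mkQ _ _
    apply LinearMap.ext
    intro w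
    obtain ⟨w, rfl⟩ := W.mkQ_surjective w
    have h1 := LinearMap.congr_fun X.coassoc w
    have h2 : ∀ t : X.V ⊗[k] C, TensorProduct.assoc k (X.V ⧸ W) C C
        (LinearMap.rTensor C (quotCoaction X W h) (LinearMap.rTensor C W.mkQ t)) =
        LinearMap.rTensor (C ⊗[k] C) W.mkQ (TensorProduct.assoc k X.V C C
          (LinearMap.rTensor C X.ρ t)) := by
      intro t
      rw [← LinearMap.rTensor_comp_apply, key, LinearMap.rTensor_comp_apply]
      generalize LinearMap.rTensor C X.ρ t = z
      induction z with
      | zero => simp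
      | add a b ha hb => simp only [map_add, ha, hb]
      | tmul a c =>
        induction a with
        | zero => simp
        | add a b ha hb => simp only [map_add, TensorProduct.add_tmul, ha, hb]
        | tmul a b => simp
    have h3 : ∀ t : X.V ⊗[k] C,
        LinearMap.lTensor (X.V ⧸ W) (Coalgebra.comul (R := k)) (LinearMap.rTensor C W.mkQ t) =
        LinearMap.rTensor (C ⊗[k] C) W.mkQ (LinearMap.lTensor X.V (Coalgebra.comul (R := k)) t) := by
      intro t
      rw [← LinearMap.comp_apply, ← LinearMap.comp_apply, LinearMap.rTensor_comp_lTensor,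
        LinearMap.lTensor_comp_rTensor]
    have h4 := LinearMap.congr_fun key w
    simp only [LinearMap.comp_apply, LinearEquiv.coe_coe] at h1 h4 ⊢
    rw [h4, h2, h3, h1]
  counit := by
    have key : quotCoaction X W h ∘ₗ W.mkQ = LinearMap.rTensor C W.mkQ ∘ₗ X.ρ := W.liftQ_mkQ _ _
    apply LinearMap.ext
    intro w
    obtain ⟨w, rfl⟩ := W.mkQ_surjective w
    have h1 := LinearMap.congr_fun X.counit w
    have h2 : ∀ t : X.V ⊗[k] C, TensorProduct.rid k (X.V ⧸ W)
        (LinearMap.lTensor (X.V ⧸ W) (Coalgebra.counit (R := k)) (LinearMap.rTensor C W.mkQ t)) =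
        W.mkQ (TensorProduct.rid k X.V (LinearMap.lTensor X.V (Coalgebra.counit (R := k)) t)) := by
      intro t
      induction t with
      | zero => simp
      | add a b ha hb => simp only [map_add, ha, hb]
      | tmul a c => simp
    have h4 := LinearMap.congr_fun key w
    simp only [LinearMap.comp_apply, LinearEquiv.coe_coe] at h1 h4 ⊢
    rw [h4, h2, h1]
    rfl

/-- The projection onto a quotient comodule. -/
noncomputable def quotπ (X : Comod k C) (W : Submodule k X.V)
    (h : W ≤ LinearMap.ker (LinearMap.rTensor C W.mkQ ∘ₗ X.ρ)) : X ⟶ quot X W h :=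
  mkHom (Y := quot X W h) W.mkQ (W.liftQ_mkQ _ _)

/-- Factor a morphism through an injective one with a larger range. -/
theorem exists_lift {X Y Z : Comod k C} (f : X ⟶ Y) (hf : Function.Injective (lin f)) (g : Z ⟶ Y)
    (h : LinearMap.range (lin g) ≤ LinearMap.range (lin f)) : ∃ l : Z ⟶ X, l ≫ f = g := by
  let l : Z.V →ₗ[k] X.V := (LinearEquiv.ofInjective (lin f) hf).symm.toLinearMap ∘ₗ
    (lin g).codRestrict _ (fun z => h ⟨z, rfl⟩)
  have hl : lin f ∘ₗ l = lin g := by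
    ext z
    have := LinearEquiv.ofInjective_symm_apply (h := hf)
      (f := lin f) ((lin g).codRestrict _ (fun z => h ⟨z, rfl⟩) z)
    simp only [l, LinearMap.comp_apply, LinearEquiv.coe_coe]
    rw [this]
    rfl
  refine ⟨mkHom l ?_, hom_ext hl⟩
  apply LinearMap.ext
  intro z
  apply rTensor_injective C hf
  have h1 := comm_apply f (l z)
  have h2 := comm_apply g z
  have h3 := LinearMap.congr_fun hl z
  simp only [LinearMap.comp_apply] at h3 ⊢
  rw [← h1, ← LinearMap.rTensor_comp_apply, hl, ← h2, h3]

/-- Factor a morphism through a surjective one with a smaller kernel. -/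
theorem exists_desc {X Y Z : Comod k C} (f : X ⟶ Y) (hf : Function.Surjective (lin f)) (g : X ⟶ Z)
    (h : LinearMap.ker (lin f) ≤ LinearMap.ker (lin g)) : ∃ l : Y ⟶ Z, f ≫ l = g := by
  let l : Y.V →ₗ[k] Z.V := (LinearMap.ker (lin f)).liftQ (lin g) h ∘ₗ
    ((lin f).quotKerEquivOfSurjective hf).symm.toLinearMap
  have hl : l ∘ₗ lin f = lin g := by
    ext x
    have : ((lin f).quotKerEquivOfSurjective hf).symm (lin f x) = Submodule.Quotient.mk x := by
      rw [LinearEquiv.symm_apply_eq]; rfl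
    simp [l, this]
  refine ⟨mkHom l ?_, hom_ext hl⟩
  apply LinearMap.ext
  intro y
  obtain ⟨x, rfl⟩ := hf y
  have h1 := comm_apply f x
  have h2 := comm_apply g x
  have h3 := LinearMap.congr_fun hl x
  simp only [LinearMap.comp_apply] at h3 ⊢
  rw [h1, ← LinearMap.rTensor_comp_apply, hl, ← h2, h3]

theorem mono_of_injective {X Y : Comod k C} (f : X ⟶ Y) (hf : Function.Injective (lin f)) :
    Mono f := ⟨fun _ _ e => hom_ext (LinearMap.ext fun z =>
      hf (LinearMap.congr_fun (congrArg lin e) z))⟩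

theorem epi_of_surjective {X Y : Comod k C} (f : X ⟶ Y) (hf : Function.Surjective (lin f)) :
    Epi f := ⟨fun _ _ e => hom_ext (LinearMap.ext fun z => by
      obtain ⟨x, rfl⟩ := hf z
      exact LinearMap.congr_fun (congrArg lin e) x)⟩

theorem ker_stable {X Y : Comod k C} (f : X ⟶ Y) :
    ∀ w ∈ LinearMap.ker (lin f),
      X.ρ w ∈ LinearMap.range (LinearMap.rTensor C (LinearMap.ker (lin f)).subtype) := by
  intro w hw
  have hex : Function.Exact (LinearMap.ker (lin f)).subtype (lin f) := LinearMap.exact_subtype_ker_map _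
  have := Module.Flat.rTensor_exact C hex
  apply (this _).1
  rw [← comm_apply, LinearMap.mem_ker.1 hw, map_zero]

theorem range_stable {X Y : Comod k C} (f : X ⟶ Y) :
    LinearMap.range (lin f) ≤
      LinearMap.ker (LinearMap.rTensor C (LinearMap.range (lin f)).mkQ ∘ₗ Y.ρ) := by
  rintro _ ⟨x, rfl⟩
  rw [LinearMap.mem_ker, LinearMap.comp_apply, comm_apply, ← LinearMap.rTensor_comp_apply,
    LinearMap.range_mkQ_comp]
  simp

/-- The kernel of a morphism. -/
noncomputable abbrev ker {X Y : Comod k C} (f : X ⟶ Y) : Comod k C :=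
  sub X (LinearMap.ker (lin f)) (ker_stable f)

/-- The inclusion of the kernel of a morphism. -/
noncomputable abbrev kerι {X Y : Comod k C} (f : X ⟶ Y) : ker f ⟶ X :=
  subι X (LinearMap.ker (lin f)) (ker_stable f)

/-- The cokernel of a morphism. -/
noncomputable abbrev coker {X Y : Comod k C} (f : X ⟶ Y) : Comod k C :=
  quot Y (LinearMap.range (lin f)) (range_stable f)

/-- The projection onto the cokernel of a morphism. -/
noncomputable abbrev cokerπ {X Y : Comod k C} (f : X ⟶ Y) : Y ⟶ coker f :=
  quotπ Y (LinearMap.range (lin f)) (range_stable f)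

theorem kerι_comp {X Y : Comod k C} (f : X ⟶ Y) : kerι f ≫ f = 0 :=
  hom_ext (LinearMap.ext fun x => x.2)

theorem comp_cokerπ {X Y : Comod k C} (f : X ⟶ Y) : f ≫ cokerπ f = 0 :=
  hom_ext (LinearMap.range_mkQ_comp _)

theorem injective_of_mono {X Y : Comod k C} (f : X ⟶ Y) [Mono f] :
    Function.Injective (lin f) := by
  have h : kerι f = 0 := by
    rw [← cancel_mono f, kerι_comp, zero_comp]
  rw [← LinearMap.ker_eq_bot, Submodule.eq_bot_iff]
  intro x hx
  exact LinearMap.congr_fun (congrArg lin h) ⟨x, hx⟩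

theorem surjective_of_epi {X Y : Comod k C} (f : X ⟶ Y) [Epi f] :
    Function.Surjective (lin f) := by
  have h : cokerπ f = 0 := by
    rw [← cancel_epi f, comp_cokerπ, comp_zero]
  rw [← LinearMap.range_eq_top, eq_top_iff]
  intro y _
  have := LinearMap.congr_fun (congrArg lin h) y
  exact (Submodule.Quotient.mk_eq_zero _).1 this

/-- An injective morphism whose range is the kernel of `g` is a kernel of `g`. -/
noncomputable def isKernel {X Y Z : Comod k C} (f : X ⟶ Y) (g : Y ⟶ Z) (w : f ≫ g = 0)
    (hf : Function.Injective (lin f)) (h : LinearMap.ker (lin g) ≤ LinearMap.range (lin f)) :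
    IsLimit (KernelFork.ofι f w) :=
  haveI := mono_of_injective f hf
  KernelFork.IsLimit.ofι' f w fun l hl =>
    ⟨_, (exists_lift f hf l (le_trans (by
      rintro _ ⟨x, rfl⟩
      exact LinearMap.congr_fun (congrArg lin hl) x) h)).choose_spec⟩

/-- A surjective morphism whose kernel is the range of `f` is a cokernel of `f`. -/
noncomputable def isCokernel {X Y Z : Comod k C} (f : X ⟶ Y) (g : Y ⟶ Z) (w : f ≫ g = 0)
    (hg : Function.Surjective (lin g)) (h : LinearMap.ker (lin g) ≤ LinearMap.range (lin f)) :
    IsColimit (CokernelCofork.ofπ g w) :=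
  haveI := epi_of_surjective g hg
  CokernelCofork.IsColimit.ofπ' g w fun l hl =>
    ⟨_, (exists_desc g hg l (le_trans h (by
      rintro _ ⟨x, rfl⟩
      exact LinearMap.congr_fun (congrArg lin hl) x))).choose_spec⟩

instance : HasKernels (Comod k C) where
  has_limit f := ⟨⟨_, isKernel (kerι f) f (kerι_comp f) (Submodule.injective_subtype _)
    (fun _ hx => ⟨⟨_, hx⟩, rfl⟩)⟩⟩

instance : HasCokernels (Comod k C) where
  has_colimit f := ⟨⟨_, isCokernel f (cokerπ f) (comp_cokerπ f) (Submodule.mkQ_surjective _)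
    (fun _ hx => (Submodule.Quotient.mk_eq_zero _).1 hx)⟩⟩

instance : IsNormalMonoCategory (Comod k C) where
  normalMonoOfMono f _ := ⟨⟨_, cokerπ f, comp_cokerπ f, isKernel _ _ _ (injective_of_mono f)
    (fun _ hx => (Submodule.Quotient.mk_eq_zero _).1 hx)⟩⟩

instance : IsNormalEpiCategory (Comod k C) where
  normalEpiOfEpi f _ := ⟨⟨_, kerι f, kerι_comp f, isCokernel _ _ _ (surjective_of_epi f)
    (fun _ hx => ⟨⟨_, hx⟩, rfl⟩)⟩⟩

/-- The direct sum of two comodules. -/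
noncomputable abbrev prod (X Y : Comod k C) : Comod k C where
  V := X.V × Y.V
  ρ := (LinearMap.rTensor C (LinearMap.inl k X.V Y.V) ∘ₗ X.ρ).coprod
    (LinearMap.rTensor C (LinearMap.inr k X.V Y.V) ∘ₗ Y.ρ)
  coassoc := by
    have key : ∀ (Z : Comod k C) (i : Z.V →ₗ[k] X.V × Y.V)
        (R : X.V × Y.V →ₗ[k] (X.V × Y.V) ⊗[k] C), R ∘ₗ i = LinearMap.rTensor C i ∘ₗ Z.ρ →
        ∀ z, TensorProduct.assoc k (X.V × Y.V) C C (LinearMap.rTensor C R (R (i z))) =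
          LinearMap.lTensor (X.V × Y.V) (Coalgebra.comul (R := k)) (R (i z)) := by
      intro Z i R h z
      have h1 := LinearMap.congr_fun Z.coassoc z
      have h4 := LinearMap.congr_fun h z
      have h2 : ∀ t : Z.V ⊗[k] C, TensorProduct.assoc k (X.V × Y.V) C C
          (LinearMap.rTensor C R (LinearMap.rTensor C i t)) =
          LinearMap.rTensor (C ⊗[k] C) i (TensorProduct.assoc k Z.V C C
            (LinearMap.rTensor C Z.ρ t)) := by
        intro t
        rw [← LinearMap.rTensor_comp_apply, h, LinearMap.rTensor_comp_apply]
        generalize LinearMap.rTensor C Z.ρ t = z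
        induction z with
        | zero => simp
        | add a b ha hb => simp only [map_add, ha, hb]
        | tmul a c =>
          induction a with
          | zero => simp
          | add a b ha hb => simp only [map_add, TensorProduct.add_tmul, ha, hb]
          | tmul a b => simp
      have h3 : ∀ t : Z.V ⊗[k] C,
          LinearMap.lTensor (X.V × Y.V) (Coalgebra.comul (R := k)) (LinearMap.rTensor C i t) =
          LinearMap.rTensor (C ⊗[k] C) i (LinearMap.lTensor Z.V (Coalgebra.comul (R := k)) t) := by
        intro t
        rw [← LinearMap.comp_apply, ← LinearMap.comp_apply, LinearMap.rTensor_comp_lTensor,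
          LinearMap.lTensor_comp_rTensor]
      simp only [LinearMap.comp_apply, LinearEquiv.coe_coe] at h1 h4
      rw [h4, h2, h3, h1]
    apply LinearMap.prod_ext <;> apply LinearMap.ext <;> intro z
    · exact key X (LinearMap.inl k X.V Y.V) _ (LinearMap.coprod_inl _ _) z
    · exact key Y (LinearMap.inr k X.V Y.V) _ (LinearMap.coprod_inr _ _) z
  counit := by
    have key : ∀ (Z : Comod k C) (i : Z.V →ₗ[k] X.V × Y.V)
        (R : X.V × Y.V →ₗ[k] (X.V × Y.V) ⊗[k] C), R ∘ₗ i = LinearMap.rTensor C i ∘ₗ Z.ρ →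
        ∀ z, TensorProduct.rid k (X.V × Y.V)
          (LinearMap.lTensor (X.V × Y.V) (Coalgebra.counit (R := k)) (R (i z))) = i z := by
      intro Z i R h z
      have h1 := LinearMap.congr_fun Z.counit z
      have h4 := LinearMap.congr_fun h z
      have h2 : ∀ t : Z.V ⊗[k] C, TensorProduct.rid k (X.V × Y.V)
          (LinearMap.lTensor (X.V × Y.V) (Coalgebra.counit (R := k)) (LinearMap.rTensor C i t)) =
          i (TensorProduct.rid k Z.V (LinearMap.lTensor Z.V (Coalgebra.counit (R := k)) t)) := by
        intro t
        induction t with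
        | zero => simp
        | add a b ha hb => simp only [map_add, ha, hb]
        | tmul a c => simp only [LinearMap.rTensor_tmul, LinearMap.lTensor_tmul,
            TensorProduct.rid_tmul, map_smul]
      simp only [LinearMap.comp_apply, LinearEquiv.coe_coe] at h1 h4
      rw [h4, h2, h1]
      rfl
    apply LinearMap.prod_ext <;> apply LinearMap.ext <;> intro z
    · exact key X (LinearMap.inl k X.V Y.V) _ (LinearMap.coprod_inl _ _) z
    · exact key Y (LinearMap.inr k X.V Y.V) _ (LinearMap.coprod_inr _ _) z

theorem prod_ρ_inl (X Y : Comod k C) : (prod X Y).ρ ∘ₗ LinearMap.inl k X.V Y.V =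
    LinearMap.rTensor C (LinearMap.inl k X.V Y.V) ∘ₗ X.ρ := LinearMap.coprod_inl _ _

theorem prod_ρ_inr (X Y : Comod k C) : (prod X Y).ρ ∘ₗ LinearMap.inr k X.V Y.V =
    LinearMap.rTensor C (LinearMap.inr k X.V Y.V) ∘ₗ Y.ρ := LinearMap.coprod_inr _ _

/-- The direct sum as a binary bicone. -/
noncomputable def prodBicone (X Y : Comod k C) : BinaryBicone X Y where
  pt := prod X Y
  inl := mkHom (Y := prod X Y) (LinearMap.inl k X.V Y.V) (LinearMap.coprod_inl _ _)
  inr := mkHom (Y := prod X Y) (LinearMap.inr k X.V Y.V) (LinearMap.coprod_inr _ _)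
  fst := mkHom (X := prod X Y) (LinearMap.fst k X.V Y.V) (by
    apply LinearMap.prod_ext
    · rw [LinearMap.comp_assoc, LinearMap.comp_assoc, prod_ρ_inl, ← LinearMap.comp_assoc X.ρ,
        ← LinearMap.rTensor_comp, LinearMap.fst_comp_inl]
      simp
    · rw [LinearMap.comp_assoc, LinearMap.comp_assoc, prod_ρ_inr, ← LinearMap.comp_assoc Y.ρ,
        ← LinearMap.rTensor_comp, LinearMap.fst_comp_inr]
      simp)
  snd := mkHom (X := prod X Y) (LinearMap.snd k X.V Y.V) (by
    apply LinearMap.prod_ext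
    · rw [LinearMap.comp_assoc, LinearMap.comp_assoc, prod_ρ_inl, ← LinearMap.comp_assoc X.ρ,
        ← LinearMap.rTensor_comp, LinearMap.snd_comp_inl]
      simp
    · rw [LinearMap.comp_assoc, LinearMap.comp_assoc, prod_ρ_inr, ← LinearMap.comp_assoc Y.ρ,
        ← LinearMap.rTensor_comp, LinearMap.snd_comp_inr]
      simp)
  inl_fst := hom_ext (LinearMap.fst_comp_inl _ _ _)
  inl_snd := hom_ext (LinearMap.snd_comp_inl _ _ _)
  inr_fst := hom_ext (LinearMap.fst_comp_inr _ _ _)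
  inr_snd := hom_ext (LinearMap.snd_comp_inr _ _ _)

instance : HasBinaryBiproducts (Comod k C) where
  has_binary_biproduct X Y := hasBinaryBiproduct_of_total (prodBicone X Y) (hom_ext (by
    apply LinearMap.ext
    rintro ⟨x, y⟩
    change ((x, 0) : X.V × Y.V) + (0, y) = (x, y)
    simp))

/-- The zero comodule. -/
noncomputable abbrev zeroComod : Comod k C where
  V := PUnit
  ρ := 0
  coassoc := by simp
  counit := Subsingleton.elim _ _

instance : HasTerminal (Comod k C) :=
  IsTerminal.hasTerminal (X := zeroComod) (IsTerminal.ofUniqueHom (fun _ => 0) (fun _ _ => hom_ext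
    (LinearMap.ext fun _ => (Subsingleton.elim (α := PUnit) _ _))))

instance : HasFiniteProducts (Comod k C) := hasFiniteProducts_of_has_binary_and_terminal

noncomputable instance : Abelian (Comod k C) where

theorem shortExact_iff (S : ShortComplex (Comod k C)) : S.ShortExact ↔
    Function.Injective (lin S.f) ∧ Function.Surjective (lin S.g) ∧
      LinearMap.ker (lin S.g) ≤ LinearMap.range (lin S.f) := by
  constructor
  · intro hS
    have := hS.mono_f
    have := hS.epi_g
    refine ⟨injective_of_mono _, surjective_of_epi _, ?_⟩
    intro x hx
    have := hS.fIsKernel.fac (KernelFork.ofι (kerι S.g) (kerι_comp S.g)) WalkingParallelPair.zero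
    exact ⟨lin (hS.fIsKernel.lift (KernelFork.ofι (kerι S.g) (kerι_comp S.g))) ⟨x, hx⟩,
      LinearMap.congr_fun (congrArg lin this) ⟨x, hx⟩⟩
  · rintro ⟨h1, h2, h3⟩
    have := mono_of_injective S.f h1
    have := epi_of_surjective S.g h2
    exact .mk (S.exact_of_f_is_kernel (isKernel S.f S.g S.zero h1 h3))

end Category
end Comod

noncomputable section

namespace Comod

section Restriction

variable {k C D : Type u} [Field k] [AddCommGroup C] [Module k C] [Coalgebra k C]
  [AddCommGroup D] [Module k D] [Coalgebra k D]

/-- The comodule over `D` obtained from a comodule over `C` along a coalgebra map `φ : C → D`: the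
pull-back of a `G`-module along the homomorphism `H → G` with comorphism `φ : k[G] → k[H]`. -/
abbrev res (φ : C →ₗc[k] D) (X : Comod k C) : Comod k D where
  V := X.V
  ρ := LinearMap.lTensor X.V φ.toLinearMap ∘ₗ X.ρ
  coassoc := by
    apply LinearMap.ext
    intro x
    have h1 := LinearMap.congr_fun X.coassoc x
    simp only [LinearMap.comp_apply, LinearEquiv.coe_coe] at h1 ⊢
    have h2 : ∀ t : X.V ⊗[k] C, TensorProduct.assoc k X.V D D
        (LinearMap.rTensor D (LinearMap.lTensor X.V φ.toLinearMap ∘ₗ X.ρ)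
          (LinearMap.lTensor X.V φ.toLinearMap t)) =
        LinearMap.lTensor X.V (TensorProduct.map φ.toLinearMap φ.toLinearMap)
          (TensorProduct.assoc k X.V C C (LinearMap.rTensor C X.ρ t)) := by
      intro t
      induction t with
      | zero => simp
      | add a b ha hb => simp only [map_add, ha, hb]
      | tmul a c =>
        simp only [LinearMap.lTensor_tmul, LinearMap.rTensor_tmul, LinearMap.comp_apply]
        generalize X.ρ a = z
        induction z with
        | zero => simp
        | add a b ha hb => simp only [map_add, TensorProduct.add_tmul, ha, hb]
        | tmul a b => simp
    rw [h2, h1, ← LinearMap.lTensor_comp_apply, ← LinearMap.lTensor_comp_apply,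
      φ.map_comp_comul]
  counit := by
    have h : (Coalgebra.counit (R := k) (A := D)) ∘ₗ φ.toLinearMap = Coalgebra.counit (R := k) :=
      φ.counit_comp
    rw [← LinearMap.comp_assoc (X.ρ), ← LinearMap.lTensor_comp, h]
    exact X.counit

end Restriction

section Tensor

variable {k C : Type u} [Field k] [CommRing C] [Bialgebra k C]

/-- The trivial comodule `k`. -/
abbrev triv (k C : Type u) [Field k] [CommRing C] [Bialgebra k C] : Comod k C where
  V := k
  ρ := (TensorProduct.mk k k C).flip 1
  coassoc := by
    ext
    simp [Algebra.TensorProduct.one_def]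
  counit := by
    ext
    simp

/-- The multiplication `(x ⊗ c, y ⊗ d) ↦ (x ⊗ y) ⊗ cd`. -/
def tensorMul (V W D : Type u) [AddCommGroup V] [Module k V] [AddCommGroup W] [Module k W]
    [CommRing D] [Algebra k D] : (V ⊗[k] D) →ₗ[k] (W ⊗[k] D) →ₗ[k] (V ⊗[k] W) ⊗[k] D :=
  TensorProduct.curry (LinearMap.lTensor (V ⊗[k] W) (LinearMap.mul' k D) ∘ₗ
    (TensorProduct.tensorTensorTensorComm k V D W D).toLinearMap)

@[simp] theorem tensorMul_tmul (V W D : Type u) [AddCommGroup V] [Module k V] [AddCommGroup W]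
    [Module k W] [CommRing D] [Algebra k D] (v : V) (w : W) (c d : D) :
    tensorMul (k := k) V W D (v ⊗ₜ c) (w ⊗ₜ d) = (v ⊗ₜ w) ⊗ₜ (c * d) := by
  simp [tensorMul]

/-- The tensor product of two comodules, with the diagonal coaction. -/
abbrev tensor (X Y : Comod k C) : Comod k C where
  V := X.V ⊗[k] Y.V
  ρ := TensorProduct.lift ((tensorMul X.V Y.V C).compl₁₂ X.ρ Y.ρ)
  coassoc := by
    apply TensorProduct.ext'
    intro x y
    set R := TensorProduct.lift ((tensorMul X.V Y.V C).compl₁₂ X.ρ Y.ρ) with hR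
    have hRt : ∀ x y, R (x ⊗ₜ y) = tensorMul X.V Y.V C (X.ρ x) (Y.ρ y) := fun x y => by simp [hR]
    have h1 := LinearMap.congr_fun X.coassoc x
    have h2 := LinearMap.congr_fun Y.coassoc y
    simp only [LinearMap.comp_apply, LinearEquiv.coe_coe] at h1 h2 ⊢
    rw [hRt]
    have h3 : ∀ (s : X.V ⊗[k] C) (t : Y.V ⊗[k] C),
        TensorProduct.assoc k (X.V ⊗[k] Y.V) C C (LinearMap.rTensor C R
          (tensorMul X.V Y.V C s t)) = tensorMul X.V Y.V (C ⊗[k] C)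
          (TensorProduct.assoc k X.V C C (LinearMap.rTensor C X.ρ s))
          (TensorProduct.assoc k Y.V C C (LinearMap.rTensor C Y.ρ t)) := by
      intro s t
      induction s with
      | zero => simp
      | add a b ha hb => simp only [map_add, LinearMap.add_apply, ha, hb]
      | tmul x c =>
        induction t with
        | zero => simp
        | add a b ha hb => simp only [map_add, ha, hb]
        | tmul y d =>
          simp only [tensorMul_tmul, LinearMap.rTensor_tmul, hRt]
          generalize X.ρ x = p
          generalize Y.ρ y = q
          induction p with
          | zero => simp
          | add a b ha hb =>
            simp only [map_add, LinearMap.add_apply, TensorProduct.add_tmul, ha, hb]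
          | tmul x' c' =>
            induction q with
            | zero => simp
            | add a b ha hb => simp only [map_add, TensorProduct.add_tmul, ha, hb]
            | tmul y' d' => simp
    have h4 : ∀ (s : X.V ⊗[k] C) (t : Y.V ⊗[k] C),
        LinearMap.lTensor (X.V ⊗[k] Y.V) (Coalgebra.comul (R := k)) (tensorMul X.V Y.V C s t) =
        tensorMul X.V Y.V (C ⊗[k] C) (LinearMap.lTensor X.V (Coalgebra.comul (R := k)) s)
          (LinearMap.lTensor Y.V (Coalgebra.comul (R := k)) t) := by
      intro s t
      induction s with
      | zero => simp
      | add a b ha hb => simp only [map_add, LinearMap.add_apply, ha, hb]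
      | tmul x c =>
        induction t with
        | zero => simp
        | add a b ha hb => simp only [map_add, ha, hb]
        | tmul y d => simp
    rw [h3, h4, h1, h2]
  counit := by
    apply TensorProduct.ext'
    intro x y
    have h1 := LinearMap.congr_fun X.counit x
    have h2 := LinearMap.congr_fun Y.counit y
    simp only [LinearMap.comp_apply, LinearEquiv.coe_coe, TensorProduct.lift.tmul,
      LinearMap.compl₁₂_apply, LinearMap.id_apply] at h1 h2 ⊢
    have h3 : ∀ (s : X.V ⊗[k] C) (t : Y.V ⊗[k] C),
        TensorProduct.rid k (X.V ⊗[k] Y.V) (LinearMap.lTensor (X.V ⊗[k] Y.V)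
          (Coalgebra.counit (R := k)) (tensorMul X.V Y.V C s t)) =
        TensorProduct.rid k X.V (LinearMap.lTensor X.V (Coalgebra.counit (R := k)) s) ⊗ₜ
        TensorProduct.rid k Y.V (LinearMap.lTensor Y.V (Coalgebra.counit (R := k)) t) := by
      intro s t
      induction s with
      | zero => simp
      | add a b ha hb =>
        simp only [map_add, LinearMap.add_apply, TensorProduct.add_tmul, ha, hb]
      | tmul x c =>
        induction t with
        | zero => simp
        | add a b ha hb => simp only [map_add, TensorProduct.tmul_add, ha, hb]
        | tmul y d =>
          simp only [tensorMul_tmul, LinearMap.lTensor_tmul, TensorProduct.rid_tmul,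
            Bialgebra.counit_mul, TensorProduct.tmul_smul]
          rw [← TensorProduct.smul_tmul', smul_smul, mul_comm]
    rw [h3, h1, h2]

theorem tensor_ρ_tmul (X Y : Comod k C) (x : X.V) (y : Y.V) :
    (tensor X Y).ρ (x ⊗ₜ y) = tensorMul X.V Y.V C (X.ρ x) (Y.ρ y) := by
  simp [tensor]

/-- The functor `X ↦ X ⊗ Y`. -/
def tensorRight (Y : Comod k C) : Comod k C ⥤ Comod k C where
  obj X := tensor X Y
  map {X X'} f := mkHom (X := tensor X Y) (Y := tensor X' Y) (LinearMap.rTensor Y.V (lin f)) (by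
    apply TensorProduct.ext'
    intro x y
    simp only [LinearMap.comp_apply, LinearMap.rTensor_tmul]
    rw [tensor_ρ_tmul, tensor_ρ_tmul, comm_apply]
    generalize X.ρ x = s
    generalize Y.ρ y = t
    induction s with
    | zero => simp
    | add a b ha hb => simp only [map_add, LinearMap.add_apply, ha, hb]
    | tmul x c =>
      induction t with
      | zero => simp
      | add a b ha hb => simp only [map_add, ha, hb]
      | tmul y d => simp)
  map_id X := hom_ext (LinearMap.rTensor_id _ _)
  map_comp f g := hom_ext (LinearMap.rTensor_comp _ (lin g) (lin f))

instance (Y : Comod k C) : (tensorRight Y).Additive where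
  map_add {_ _ f g} := hom_ext (LinearMap.rTensor_add Y.V (lin f) (lin g))

instance (Y : Comod k C) : (tensorRight Y).Linear k where
  map_smul f r := hom_ext (LinearMap.rTensor_smul Y.V r (lin f))

theorem tensorRight_exact (Y : Comod k C) :
    PreservesFiniteLimits (tensorRight Y) ∧ PreservesFiniteColimits (tensorRight Y) := by
  refine ((Functor.exact_tfae (tensorRight Y)).out 0 3).1 ?_
  intro S hS
  rw [shortExact_iff] at hS ⊢
  obtain ⟨h1, h2, h3⟩ := hS
  refine ⟨rTensor_injective _ h1, LinearMap.rTensor_surjective _ h2, ?_⟩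
  have hex : Function.Exact (lin S.f) (lin S.g) := by
    intro x
    refine ⟨fun hx => h3 hx, ?_⟩
    rintro ⟨y, rfl⟩
    exact LinearMap.congr_fun (congrArg lin S.zero) y
  intro t ht
  exact ((rTensor_exact Y.V hex h2) t).1 ht

instance (Y : Comod k C) : PreservesFiniteLimits (tensorRight Y) := (tensorRight_exact Y).1

instance (Y : Comod k C) : PreservesFiniteColimits (tensorRight Y) := (tensorRight_exact Y).2

/-- The canonical morphism `Y → k ⊗ Y`. -/
def toTrivTensor (Y : Comod k C) : Y ⟶ tensor (triv k C) Y :=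
  mkHom (Y := tensor (triv k C) Y) (TensorProduct.lid k Y.V).symm.toLinearMap (by
    apply LinearMap.ext
    intro y
    simp only [LinearMap.comp_apply, LinearEquiv.coe_coe, TensorProduct.lid_symm_apply]
    refine (tensor_ρ_tmul (triv k C) Y (1 : k) y).trans ?_
    generalize Y.ρ y = t
    induction t with
    | zero => simp
    | add a b ha hb => simp only [map_add, ha, hb]
    | tmul y d =>
      refine (tensorMul_tmul k Y.V C (1 : k) y 1 d).trans ?_
      simp)

end Tensor

section Cohomology

instance (k C : Type u) [Field k] [AddCommGroup C] [Module k C] [Coalgebra k C] :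
    HasExt.{u + 1} (Comod k C) := HasExt.standard _

/-- The rational cohomology `Hⁱ(G, X) = Extⁱ_G(k, X)`, where `C = k[G]`: the `i`-th derived functor
of the functor of `G`-invariants `X ↦ Hom_G(k, X)`. -/
abbrev H {k C : Type u} [Field k] [CommRing C] [Bialgebra k C] (X : Comod k C) (i : ℕ) :
    Type (u + 1) := Abelian.Ext.{u + 1} (triv k C) X i

/-- The space of invariants `H⁰(G, X) = X^G`. -/
def invariants {k C : Type u} [Field k] [CommRing C] [Bialgebra k C] (X : Comod k C) :
    Submodule k X.V :=
  LinearMap.eqLocus X.ρ ((TensorProduct.mk k X.V C).flip 1)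

/-- `Ext⁰(k, X)` is the space of invariants. -/
def HZeroEquiv {k C : Type u} [Field k] [CommRing C] [Bialgebra k C] (X : Comod k C) :
    X.H 0 ≃ₗ[k] X.invariants :=
  Abelian.Ext.linearEquiv₀.trans
    { toFun f := ⟨lin f (1 : k), (comm_apply f (1 : k)).trans (by
        change LinearMap.rTensor C (lin f) ((1 : k) ⊗ₜ[k] (1 : C)) = _
        rw [LinearMap.rTensor_tmul]
        rfl)⟩
      map_add' _ _ := rfl
      map_smul' _ _ := rfl
      invFun v := mkHom (X := triv k C) (Y := X) (LinearMap.toSpanSingleton k X.V v.1) (by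
        apply LinearMap.ext_ring (R := k)
        change X.ρ ((1 : k) • v.1) =
          LinearMap.rTensor C (LinearMap.toSpanSingleton k X.V v.1) ((1 : k) ⊗ₜ[k] (1 : C))
        rw [LinearMap.rTensor_tmul, LinearMap.toSpanSingleton_apply, one_smul]
        exact v.2)
      left_inv f := hom_ext (LinearMap.ext_ring (R := k) (one_smul k (lin f (1 : k))))
      right_inv v := Subtype.ext (one_smul k v.1) }

/-- The Yoneda product in `Extⁱ(Z, X)` of a morphism `f : Z → X` with `i` copies of an extension
`0 → X → Y → X → 0`. -/
def yonedaPower {k C : Type u} [Field k] [AddCommGroup C] [Module k C] [Coalgebra k C]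
    {X Y Z : Comod k C} {j : X ⟶ Y} {p : Y ⟶ X} {w : j ≫ p = 0}
    (hE : (ShortComplex.mk j p w).ShortExact) (f : Z ⟶ X) : (i : ℕ) → Abelian.Ext.{u + 1} Z X i
  | 0 => Abelian.Ext.mk₀ f
  | i + 1 => (yonedaPower hE f i).comp hE.extClass rfl

end Cohomology

end Comod

/-- Comodule algebras: commutative `k`-algebras `A` with a coaction `A → A ⊗ C` that is a
homomorphism of algebras.  For `C = k[G]` these are the algebras with a rational action of `G` by
algebra automorphisms. -/
structure ComodAlg (k C : Type u) [Field k] [CommRing C] [Bialgebra k C] where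
  A : Type u
  [commRing : CommRing A]
  [algebra : Algebra k A]
  ρ : A →ₐ[k] A ⊗[k] C
  coassoc : (TensorProduct.assoc k A C C).toLinearMap ∘ₗ
    LinearMap.rTensor C ρ.toLinearMap ∘ₗ ρ.toLinearMap =
    LinearMap.lTensor A (Coalgebra.comul (R := k) (A := C)) ∘ₗ ρ.toLinearMap
  counit : (TensorProduct.rid k A).toLinearMap ∘ₗ
    LinearMap.lTensor A (Coalgebra.counit (R := k) (A := C)) ∘ₗ ρ.toLinearMap = LinearMap.id

namespace ComodAlg

attribute [instance] ComodAlg.commRing ComodAlg.algebra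

open Comod

variable {k C : Type u} [Field k] [CommRing C] [Bialgebra k C]

/-- The underlying comodule. -/
abbrev toComod (A : ComodAlg k C) : Comod k C where
  V := A.A
  ρ := A.ρ.toLinearMap
  coassoc := A.coassoc
  counit := A.counit

/-- The unit `k → A`. -/
def unit (A : ComodAlg k C) : triv k C ⟶ A.toComod :=
  mkHom (X := triv k C) (Y := A.toComod) (Algebra.linearMap k A.A) (by
    apply LinearMap.ext_ring (R := k)
    change A.ρ (algebraMap k A.A 1) = LinearMap.rTensor C (Algebra.linearMap k A.A) ((1 : k) ⊗ₜ 1)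
    simp [Algebra.TensorProduct.one_def])

/-- The multiplication `A ⊗ A → A`. -/
def mul (A : ComodAlg k C) : tensor A.toComod A.toComod ⟶ A.toComod :=
  mkHom (X := tensor A.toComod A.toComod) (Y := A.toComod) (LinearMap.mul' k A.A) (by
    apply TensorProduct.ext'
    intro x y
    refine Eq.trans ?_ (congrArg (LinearMap.rTensor C (LinearMap.mul' k A.A))
      (tensor_ρ_tmul A.toComod A.toComod x y).symm)
    change A.ρ (LinearMap.mul' k A.A (x ⊗ₜ y)) =
      LinearMap.rTensor C (LinearMap.mul' k A.A) (tensorMul A.A A.A C (A.ρ x) (A.ρ y))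
    rw [LinearMap.mul'_apply, map_mul]
    generalize A.ρ x = s
    generalize A.ρ y = t
    induction s with
    | zero => simp
    | add a b ha hb => simp only [map_add, add_mul, LinearMap.add_apply, ha, hb]
    | tmul x c =>
      induction t with
      | zero => simp
      | add a b ha hb => simp only [map_add, mul_add, ha, hb]
      | tmul y d => simp)

/-- The cohomology group `Hⁱ(G, A)` of an algebra. -/
def H (A : ComodAlg k C) (i : ℕ) : Type (u + 1) := A.toComod.H i

instance (A : ComodAlg k C) (i : ℕ) : AddCommGroup (A.H i) :=
  inferInstanceAs (AddCommGroup (A.toComod.H i))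

instance (A : ComodAlg k C) (i : ℕ) : Module k (A.H i) :=
  inferInstanceAs (Module k (A.toComod.H i))

/-- The cup product `Hⁱ(G, A) × Hʲ(G, A) → Hⁱ⁺ʲ(G, A)` as a bilinear map: for `α : k → A[i]` and
`β : k → A[j]` it is the composite `k → A[j] ≅ (k ⊗ A)[j] → (A ⊗ A)[i + j] → A[i + j]` of `β`,
`α ⊗ A` and the multiplication of `A`. -/
def cup (A : ComodAlg k C) (i j : ℕ) : A.H i →ₗ[k] A.H j →ₗ[k] A.H (i + j) :=
  (Abelian.Ext.bilinearCompOfLinear k (triv k C) (tensor (triv k C) A.toComod) A.toComod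
    j i (i + j) (add_comm j i)).flip.compl₁₂
    (Abelian.Ext.postcompOfLinear (Abelian.Ext.mk₀ A.mul) k _ (add_zero i) ∘ₗ
      (tensorRight A.toComod).mapExtLinearMap k (triv k C) A.toComod i)
    (Abelian.Ext.postcompOfLinear (Abelian.Ext.mk₀ (toTrivTensor A.toComod)) k (triv k C)
      (add_zero j))

theorem cup_apply (A : ComodAlg k C) (i j : ℕ) (α : A.H i) (β : A.H j) :
    A.cup i j α β =
      (Abelian.Ext.comp (X := triv k C) (Y := A.toComod) β
        (Abelian.Ext.mk₀ (toTrivTensor A.toComod)) (add_zero j)).comp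
        ((Abelian.Ext.mapExactFunctor (X := triv k C) (Y := A.toComod)
          (tensorRight A.toComod) α).comp (Abelian.Ext.mk₀ A.mul) (add_zero i)) (add_comm j i) :=
  rfl

/-- The cup product makes `H^*(G, A) = ⨁ᵢ Hⁱ(G, A)` a graded `k`-algebra; only the distributive laws
are recorded here. -/
instance (A : ComodAlg k C) : DirectSum.GNonUnitalNonAssocSemiring A.H where
  mul {i j} α β := A.cup i j α β
  mul_zero {i j} α := (A.cup i j α).map_zero
  zero_mul {i j} β := LinearMap.map_zero₂ (A.cup i j) β
  mul_add {i j} α β γ := (A.cup i j α).map_add β γ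
  add_mul {i j} α β γ := LinearMap.map_add₂ (A.cup i j) α β γ

theorem sub_aux (A : ComodAlg k C) (W : Subalgebra k A.A)
    (h : ∀ w ∈ Subalgebra.toSubmodule W, A.toComod.ρ w ∈ LinearMap.range
      (LinearMap.rTensor C (Subalgebra.toSubmodule W).subtype)) (w : W) :
    LinearMap.rTensor C (Subalgebra.toSubmodule W).subtype
      (subCoaction A.toComod (Subalgebra.toSubmodule W) h w) = A.ρ w :=
  LinearMap.congr_fun (rTensor_subCoaction A.toComod (Subalgebra.toSubmodule W) h) w

/-- The algebra structure on a subalgebra `W` of `A` with `ρ(W) ⊆ W ⊗ C`. -/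
abbrev sub (A : ComodAlg k C) (W : Subalgebra k A.A)
    (h : ∀ w ∈ Subalgebra.toSubmodule W, A.toComod.ρ w ∈ LinearMap.range
      (LinearMap.rTensor C (Subalgebra.toSubmodule W).subtype)) : ComodAlg k C where
  A := W
  ρ := AlgHom.ofLinearMap (subCoaction A.toComod (Subalgebra.toSubmodule W) h) (by
      have hj := sub_aux A W h
      apply rTensor_injective C (Submodule.injective_subtype (Subalgebra.toSubmodule W))
      refine (hj 1).trans ?_
      change A.ρ 1 = LinearMap.rTensor C (Subalgebra.toSubmodule W).subtype ((1 : W) ⊗ₜ 1)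
      rw [map_one]
      rfl) (by
      intro x y
      have hj := sub_aux A W h
      have hm : ∀ s t : W ⊗[k] C, LinearMap.rTensor C (Subalgebra.toSubmodule W).subtype (s * t) =
          LinearMap.rTensor C (Subalgebra.toSubmodule W).subtype s *
          LinearMap.rTensor C (Subalgebra.toSubmodule W).subtype t :=
        fun s t => map_mul (Algebra.TensorProduct.map W.val (AlgHom.id k C)) s t
      apply rTensor_injective C (Submodule.injective_subtype (Subalgebra.toSubmodule W))
      refine Eq.trans ?_ (hm _ _).symm
      refine (hj (x * y)).trans ?_
      refine Eq.trans ?_ (congrArg₂ (· * ·) (hj x) (hj y)).symm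
      exact map_mul A.ρ x.1 y.1)
  coassoc := (A.toComod.sub (Subalgebra.toSubmodule W) h).coassoc
  counit := (A.toComod.sub (Subalgebra.toSubmodule W) h).counit

end ComodAlg

namespace SL2

open Matrix

/-- The coordinate ring `k[SL₂] = k[a, b, c, d] / (ad - bc - 1)`. -/
def O (k : Type u) [Field k] : Type u :=
  MvPolynomial (Fin 2 × Fin 2) k ⧸
    Ideal.span {(Matrix.mvPolynomialX (Fin 2) (Fin 2) k).det - 1}

variable (k : Type u) [Field k]

instance : CommRing (O k) := inferInstanceAs (CommRing (_ ⧸ _))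
instance : Algebra k (O k) := inferInstanceAs (Algebra k (MvPolynomial (Fin 2 × Fin 2) k ⧸ _))

/-- The quotient map `k[a, b, c, d] → k[SL₂]`. -/
def O.mk : MvPolynomial (Fin 2 × Fin 2) k →ₐ[k] O k := Ideal.Quotient.mkₐ k _

/-- The generic matrix `(a b; c d)` over `k[SL₂]`. -/
def gen : SpecialLinearGroup (Fin 2) (O k) :=
  ⟨(Matrix.mvPolynomialX (Fin 2) (Fin 2) k).map (O.mk k), by
    have h : O.mk k (Matrix.mvPolynomialX (Fin 2) (Fin 2) k).det = 1 := by
      rw [← sub_eq_zero, ← map_one (O.mk k), ← map_sub]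
      exact Ideal.Quotient.eq_zero_iff_mem.2 (Ideal.subset_span rfl)
    rw [← h, AlgHom.map_det]
    rfl⟩

variable {k}

/-- Evaluation of regular functions at a point `g ∈ SL₂(R)`. -/
def ev {R : Type*} [CommRing R] [Algebra k R] (g : SpecialLinearGroup (Fin 2) R) : O k →ₐ[k] R :=
  Ideal.Quotient.liftₐ _ (MvPolynomial.aeval fun p : Fin 2 × Fin 2 => g p.1 p.2) (by
    intro x hx
    rw [← RingHom.mem_ker]
    revert x
    change Ideal.span _ ≤ _
    rw [Ideal.span_le, Set.singleton_subset_iff, SetLike.mem_coe, RingHom.mem_ker, map_sub,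
      map_one, AlgHom.map_det, sub_eq_zero]
    convert g.2
    ext i j
    simp)

/-- The image of a point `g ∈ SL₂(R)` in `SL₂(S)`. -/
abbrev mapPt {R S : Type*} [CommRing R] [Algebra k R] [CommRing S] [Algebra k S] (f : R →ₐ[k] S) :
    SpecialLinearGroup (Fin 2) R →* SpecialLinearGroup (Fin 2) S :=
  SpecialLinearGroup.map (f : R →+* S)

theorem ev_gen_apply {R : Type*} [CommRing R] [Algebra k R]
    (g : SpecialLinearGroup (Fin 2) R) (i j : Fin 2) : ev g (gen k i j) = g i j := by
  change (MvPolynomial.aeval fun p : Fin 2 × Fin 2 => g p.1 p.2) _ = _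
  simp [Matrix.mvPolynomialX]

theorem mapPt_ev_gen {R : Type*} [CommRing R] [Algebra k R]
    (g : SpecialLinearGroup (Fin 2) R) : mapPt (ev g) (gen k) = g := by
  ext i j
  exact ev_gen_apply g i j

theorem algHom_ext {R : Type*} [CommRing R] [Algebra k R] {f g : O k →ₐ[k] R}
    (h : mapPt f (gen k) = mapPt g (gen k)) : f = g := by
  apply Ideal.Quotient.algHom_ext
  apply MvPolynomial.algHom_ext
  rintro ⟨i, j⟩
  exact congrFun (congrFun (congrArg Subtype.val h) i) j

theorem mapPt_mapPt {R S T : Type*} [CommRing R] [Algebra k R] [CommRing S] [Algebra k S]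
    [CommRing T] [Algebra k T] (f : R →ₐ[k] S) (f' : S →ₐ[k] T)
    (g : SpecialLinearGroup (Fin 2) R) : mapPt f' (mapPt f g) = mapPt (f'.comp f) g := by
  ext i j
  simp

theorem comp_ev {R S : Type*} [CommRing R] [Algebra k R] [CommRing S] [Algebra k S]
    (f : R →ₐ[k] S) (g : SpecialLinearGroup (Fin 2) R) : f.comp (ev g) = ev (mapPt f g) := by
  apply algHom_ext
  rw [mapPt_ev_gen, ← mapPt_mapPt, mapPt_ev_gen]

variable (k) in
/-- The generic matrix in the left tensor factor. -/
def x₁ : SpecialLinearGroup (Fin 2) (O k ⊗[k] O k) :=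
  mapPt (Algebra.TensorProduct.includeLeft : O k →ₐ[k] O k ⊗[k] O k) (gen k)

variable (k) in
/-- The generic matrix in the right tensor factor. -/
def x₂ : SpecialLinearGroup (Fin 2) (O k ⊗[k] O k) :=
  mapPt (Algebra.TensorProduct.includeRight : O k →ₐ[k] O k ⊗[k] O k) (gen k)

theorem x₁_apply (i j : Fin 2) : x₁ k i j = gen k i j ⊗ₜ 1 := by simp [x₁]

theorem x₂_apply (i j : Fin 2) : x₂ k i j = 1 ⊗ₜ gen k i j := by simp [x₂]

theorem ev_mul_gen (i j : Fin 2) : ev (x₁ k * x₂ k) (gen k i j) =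
    gen k i 0 ⊗ₜ gen k 0 j + gen k i 1 ⊗ₜ gen k 1 j := by
  rw [ev_gen_apply]
  change ((x₁ k : Matrix (Fin 2) (Fin 2) (O k ⊗[k] O k)) * (x₂ k).1) i j = _
  rw [Matrix.mul_apply, Fin.sum_univ_two]
  rw [x₁_apply, x₁_apply, x₂_apply, x₂_apply]
  simp

/-- The bialgebra structure of `k[SL₂]`: comultiplication is dual to the product and the counit is
evaluation at the identity. -/
instance : Bialgebra k (O k) := Bialgebra.ofAlgHom (ev (x₁ k * x₂ k)) (ev 1)
  (by
    apply algHom_ext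
    ext i j
    simp [ev_mul_gen, TensorProduct.add_tmul, TensorProduct.tmul_add]
    abel)
  (by
    apply algHom_ext
    ext i j
    fin_cases i <;> simp [ev_mul_gen] <;> simp [ev_gen_apply])
  (by
    apply algHom_ext
    ext i j
    fin_cases j <;> simp [ev_mul_gen] <;> simp [ev_gen_apply])

theorem comulAlgHom_eq : Bialgebra.comulAlgHom k (O k) = ev (x₁ k * x₂ k) := rfl

theorem counitAlgHom_eq : Bialgebra.counitAlgHom k (O k) = ev 1 := rfl

variable (k) in
/-- The coaction of the left regular representation `(x · f)(g) = f(x⁻¹ g)` on `k[SL₂]`; here `g`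
lives in the left tensor factor and `x` in the right one. -/
def leftRegular : O k →ₐ[k] O k ⊗[k] O k := ev ((x₂ k)⁻¹ * x₁ k)

theorem leftRegular_coassoc :
    ((Algebra.TensorProduct.assoc k k k (O k) (O k) (O k)).toAlgHom.comp
      (Algebra.TensorProduct.map (leftRegular k) (AlgHom.id k (O k)))).comp (leftRegular k) =
    (Algebra.TensorProduct.map (AlgHom.id k (O k)) (Bialgebra.comulAlgHom k (O k))).comp
      (leftRegular k) := by
  rw [comulAlgHom_eq]
  have e : leftRegular k = ev ((x₂ k)⁻¹ * x₁ k) := rfl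
  set φ := (Algebra.TensorProduct.assoc k k k (O k) (O k) (O k)).toAlgHom.comp
      (Algebra.TensorProduct.map (leftRegular k) (AlgHom.id k (O k))) with hφ
  set ψ : O k ⊗[k] O k →ₐ[k] O k ⊗[k] (O k ⊗[k] O k) :=
    Algebra.TensorProduct.map (AlgHom.id k (O k)) (ev (x₁ k * x₂ k)) with hψ
  let l : O k ⊗[k] O k →ₐ[k] O k ⊗[k] (O k ⊗[k] O k) :=
    (Algebra.TensorProduct.assoc k k k (O k) (O k) (O k)).toAlgHom.comp
      (Algebra.TensorProduct.includeLeft : O k ⊗[k] O k →ₐ[k] (O k ⊗[k] O k) ⊗[k] O k)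
  let r : O k ⊗[k] O k →ₐ[k] O k ⊗[k] (O k ⊗[k] O k) := Algebra.TensorProduct.includeRight
  have h1 : mapPt φ (x₂ k) = mapPt r (x₂ k) := by
    ext i j
    simp [x₂_apply, hφ, r, Algebra.TensorProduct.one_def]
  have h2 : mapPt φ (x₁ k) = mapPt l ((x₂ k)⁻¹ * x₁ k) := by
    have : φ.comp (Algebra.TensorProduct.includeLeft : O k →ₐ[k] O k ⊗[k] O k) = l.comp (leftRegular k) := by
      apply AlgHom.ext
      intro x
      simp [hφ, l]
    rw [x₁, mapPt_mapPt, this, ← mapPt_mapPt, e, mapPt_ev_gen]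
    rfl
  have h3 : mapPt ψ (x₁ k) = mapPt l (x₁ k) := by
    ext i j
    simp [x₁_apply, hψ, l, Algebra.TensorProduct.one_def]
  have h4 : mapPt ψ (x₂ k) = mapPt r (x₁ k * x₂ k) := by
    have : ψ.comp (Algebra.TensorProduct.includeRight : O k →ₐ[k] O k ⊗[k] O k) = r.comp (ev (x₁ k * x₂ k)) := by
      apply AlgHom.ext
      intro x
      simp [hψ, r]
    rw [x₂, mapPt_mapPt, this, ← mapPt_mapPt, mapPt_ev_gen]
    rfl
  have h5 : mapPt l (x₂ k) = mapPt r (x₁ k) := by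
    ext i j
    simp [x₁_apply, x₂_apply, l, r]
  rw [e, comp_ev, comp_ev]
  congr 1
  simp only [map_mul, map_inv] at h1 h2 h3 h4 ⊢
  rw [h1, h2, h3, h4, h5, _root_.mul_inv_rev, mul_assoc]

theorem leftRegular_counit :
    ((Algebra.TensorProduct.rid k k (O k)).toAlgHom.comp
      (Algebra.TensorProduct.map (AlgHom.id k (O k)) (Bialgebra.counitAlgHom k (O k)))).comp
      (leftRegular k) = AlgHom.id k (O k) := by
  rw [counitAlgHom_eq]
  have e : leftRegular k = ev ((x₂ k)⁻¹ * x₁ k) := rfl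
  set φ := (Algebra.TensorProduct.rid k k (O k)).toAlgHom.comp
      (Algebra.TensorProduct.map (AlgHom.id k (O k)) (ev (1 : SpecialLinearGroup (Fin 2) k)))
    with hφ
  have h1 : mapPt φ (x₁ k) = gen k := by
    ext i j
    simp [x₁_apply, hφ]
  have h2 : mapPt φ (x₂ k) = 1 := by
    ext i j
    fin_cases i <;> fin_cases j <;> simp [x₂_apply, hφ, ev_gen_apply]
  rw [e, comp_ev, map_mul, map_inv, h1, h2, inv_one, one_mul]
  apply algHom_ext
  rw [mapPt_ev_gen]
  ext i j
  simp

/-- `k[SL₂]` with the left regular action of `SL₂`. -/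
abbrev regular (k : Type u) [Field k] : ComodAlg k (O k) where
  A := O k
  ρ := leftRegular k
  coassoc := congrArg AlgHom.toLinearMap (leftRegular_coassoc (k := k))
  counit := congrArg AlgHom.toLinearMap (leftRegular_counit (k := k))

/-- Subgroup functors of `SL₂` over `k`. -/
structure SubgroupFunctor (k : Type u) [Field k] where
  pts : ∀ (R : Type u) [CommRing R] [Algebra k R], Subgroup (SpecialLinearGroup (Fin 2) R)
  map_mem : ∀ {R S : Type u} [CommRing R] [Algebra k R] [CommRing S] [Algebra k S] (f : R →ₐ[k] S)
    {g : SpecialLinearGroup (Fin 2) R}, g ∈ pts R → mapPt f g ∈ pts S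

/-- The algebra `k[G/H]` of regular functions on `G = SL₂` that are invariant under right
translation by `H`. -/
def rightInvariants (k : Type u) [Field k] (Γ : SubgroupFunctor k) : Subalgebra k (O k) where
  carrier := {f | ∀ (R : Type u) [CommRing R] [Algebra k R] (g h : SpecialLinearGroup (Fin 2) R),
    h ∈ Γ.pts R → ev (g * h) f = ev g f}
  mul_mem' {x y} hx hy R _ _ g h hh := by rw [map_mul, map_mul, hx R g h hh, hy R g h hh]
  add_mem' {x y} hx hy R _ _ g h hh := by rw [map_add, map_add, hx R g h hh, hy R g h hh]
  algebraMap_mem' c R _ _ g h _ := by rw [AlgHom.commutes, AlgHom.commutes]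

theorem mem_range_of_slices {V D : Type u} [AddCommGroup V] [Module k V] [AddCommGroup D]
    [Module k D] (W : Submodule k V) (t : V ⊗[k] D)
    (h : ∀ l : D →ₗ[k] k, TensorProduct.rid k V (LinearMap.lTensor V l t) ∈ W) :
    t ∈ LinearMap.range (LinearMap.rTensor D W.subtype) := by
  have hex : Function.Exact W.subtype W.mkQ := LinearMap.exact_subtype_mkQ W
  refine (Module.Flat.rTensor_exact D hex t).1 ?_
  classical
  let b := Module.Basis.ofVectorSpace k D
  apply (TensorProduct.equivFinsuppOfBasisRight (M := V ⧸ W) b).injective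
  rw [map_zero]
  ext i
  have h1 : ∀ s : V ⊗[k] D, TensorProduct.equivFinsuppOfBasisRight (M := V ⧸ W) b
      (LinearMap.rTensor D W.mkQ s) i =
      W.mkQ (TensorProduct.rid k V (LinearMap.lTensor V (b.coord i) s)) := by
    intro s
    induction s with
    | zero => simp
    | add x y hx hy => simp only [map_add, Finsupp.add_apply, hx, hy]
    | tmul x y => simp
  rw [h1]
  exact (Submodule.Quotient.mk_eq_zero _).2 (h _)

theorem ev_slice {R : Type u} [CommRing R] [Algebra k R] (g : SpecialLinearGroup (Fin 2) R)
    (l : O k →ₗ[k] k) (f : O k) :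
    ev g (TensorProduct.rid k (O k) (LinearMap.lTensor (O k) l (leftRegular k f))) =
      TensorProduct.rid k R (LinearMap.lTensor R l (ev
        ((mapPt (Algebra.TensorProduct.includeRight : O k →ₐ[k] R ⊗[k] O k) (gen k))⁻¹ *
          mapPt (Algebra.TensorProduct.includeLeft : R →ₐ[k] R ⊗[k] O k) g) f)) := by
  have h1 : (Algebra.TensorProduct.map (ev g) (AlgHom.id k (O k))).comp (leftRegular k) = ev
        ((mapPt (Algebra.TensorProduct.includeRight : O k →ₐ[k] R ⊗[k] O k) (gen k))⁻¹ *
          mapPt (Algebra.TensorProduct.includeLeft : R →ₐ[k] R ⊗[k] O k) g) := by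
    have h2 : mapPt (Algebra.TensorProduct.map (ev g) (AlgHom.id k (O k))) (x₂ k) =
        mapPt (Algebra.TensorProduct.includeRight : O k →ₐ[k] R ⊗[k] O k) (gen k) := by
      ext i j
      simp [x₂_apply]
    have h3 : mapPt (Algebra.TensorProduct.map (ev g) (AlgHom.id k (O k))) (x₁ k) =
        mapPt (Algebra.TensorProduct.includeLeft : R →ₐ[k] R ⊗[k] O k) g := by
      ext i j
      simp [x₁_apply, ev_gen_apply]
    rw [leftRegular, comp_ev, map_mul, map_inv, h2, h3]
  rw [← h1]
  simp only [AlgHom.comp_apply]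
  generalize leftRegular k f = t
  induction t with
  | zero => simp
  | add x y hx hy => simp only [map_add, hx, hy]
  | tmul x y => simp

theorem rightInvariants_stable (Γ : SubgroupFunctor k) :
    ∀ w ∈ Subalgebra.toSubmodule (rightInvariants k Γ), (regular k).toComod.ρ w ∈ LinearMap.range
      (LinearMap.rTensor (O k) (Subalgebra.toSubmodule (rightInvariants k Γ)).subtype) := by
  intro f hf
  apply mem_range_of_slices
  intro l R _ _ g h hh
  refine (ev_slice (g * h) l f).trans (Eq.trans ?_ (ev_slice g l f).symm)
  rw [map_mul, ← mul_assoc, hf _ _ _ (Γ.map_mem _ hh)]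

/-- The algebra `k[G/H]` with the action of `G = SL₂` by left translation,
`(x · f)(g) = f(x⁻¹ g)`. -/
abbrev homogeneous (Γ : SubgroupFunctor k) : ComodAlg k (O k) :=
  (regular k).sub (rightInvariants k Γ) (rightInvariants_stable Γ)

/-- The diagonal torus `T`. -/
def T (k : Type u) [Field k] : SubgroupFunctor k where
  pts R _ _ :=
    { carrier := {g | g 0 1 = 0 ∧ g 1 0 = 0}
      mul_mem' := by
        rintro a b ⟨h1, h2⟩ ⟨h3, h4⟩
        simp_all [Matrix.mul_apply, Fin.sum_univ_two]
      one_mem' := by simp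
      inv_mem' := by
        rintro a ⟨h1, h2⟩
        simp_all [Matrix.adjugate_fin_two] }
  map_mem f g h := ⟨(congrArg f h.1).trans (map_zero f), (congrArg f h.2).trans (map_zero f)⟩

/-- The normalizer `N` of `T` in `SL₂`: the points of `N` in `R` are the `g` whose image over every
`R`-algebra `S` normalizes `T(S)`. -/
def N (k : Type u) [Field k] : SubgroupFunctor k where
  pts R _ _ :=
    { carrier := {g | ∀ (S : Type u) [CommRing S] [Algebra k S] (f : R →ₐ[k] S),
        mapPt f g ∈ Subgroup.normalizer ((T k).pts S : Set (SpecialLinearGroup (Fin 2) S))}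
      mul_mem' := fun ha hb S _ _ f => by
        rw [map_mul]
        exact mul_mem (ha S f) (hb S f)
      one_mem' := fun S _ _ f => by
        rw [map_one]
        exact one_mem _
      inv_mem' := fun ha S _ _ f => by
        rw [map_inv]
        exact inv_mem (ha S f) }
  map_mem f g h := fun S _ _ f' => by
    rw [mapPt_mapPt]
    exact h S (f'.comp f)

theorem T_le_N (R : Type u) [CommRing R] [Algebra k R] : (T k).pts R ≤ (N k).pts R :=
  fun _ hg _ _ _ f => Subgroup.le_normalizer ((T k).map_mem f hg)

theorem rightInvariants_N_le_T : rightInvariants k (N k) ≤ rightInvariants k (T k) :=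
  fun _ hf R _ _ g h hh => hf R g h (T_le_N R hh)

/-- The inclusion `k[G/N] → k[G/T]` as a homomorphism of algebras. -/
def inclAlg (k : Type u) [Field k] : (homogeneous (N k)).A →ₐ[k] (homogeneous (T k)).A :=
  Subalgebra.inclusion rightInvariants_N_le_T

/-- The inclusion `k[G/N] → k[G/T]` as a morphism of `G`-modules. -/
def incl (k : Type u) [Field k] : (homogeneous (N k)).toComod ⟶ (homogeneous (T k)).toComod :=
  Comod.mkHom (X := (homogeneous (N k)).toComod) (Y := (homogeneous (T k)).toComod)
    (inclAlg k).toLinearMap (by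
      apply LinearMap.ext
      intro f
      have hN := ComodAlg.sub_aux (regular k) (rightInvariants k (N k)) (rightInvariants_stable _)
      have hT := ComodAlg.sub_aux (regular k) (rightInvariants k (T k)) (rightInvariants_stable _)
      apply Comod.rTensor_injective (O k)
        (Submodule.injective_subtype (Subalgebra.toSubmodule (rightInvariants k (T k))))
      refine (hT (inclAlg k f)).trans ?_
      refine (hN f).symm.trans ?_
      exact LinearMap.rTensor_comp_apply (O k)
        (Subalgebra.toSubmodule (rightInvariants k (T k))).subtype (inclAlg k).toLinearMap _)

section Frobenius

variable [CharP k 2]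

instance : Nontrivial (O k) := (ev (k := k) (1 : SpecialLinearGroup (Fin 2) k)).toRingHom.domain_nontrivial

instance : CharP (O k) 2 := charP_of_injective_algebraMap (algebraMap k (O k)).injective 2

variable (k) in
/-- The comorphism of the `r`-th Frobenius endomorphism `F^r` of `SL₂`, which raises the entries of
a matrix to the power `2 ^ r`. -/
def frob (r : ℕ) : O k →ₐ[k] O k :=
  ev (SpecialLinearGroup.map (iterateFrobenius (O k) 2 r) (gen k))

theorem frob_gen (r : ℕ) (i j : Fin 2) : frob k r (gen k i j) = gen k i j ^ 2 ^ r := by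
  rw [frob, ev_gen_apply]
  rfl

instance : CharP (O k ⊗[k] O k) 2 :=
  charP_of_injective_algebraMap (algebraMap k (O k ⊗[k] O k)).injective 2

theorem counit_frob (r : ℕ) :
    (Bialgebra.counitAlgHom k (O k)).comp (frob k r) = Bialgebra.counitAlgHom k (O k) := by
  apply algHom_ext
  ext i j
  rw [counitAlgHom_eq]
  fin_cases i <;> fin_cases j <;> simp [frob_gen, ev_gen_apply]

theorem comul_frob (r : ℕ) :
    (Algebra.TensorProduct.map (frob k r) (frob k r)).comp (Bialgebra.comulAlgHom k (O k)) =
      (Bialgebra.comulAlgHom k (O k)).comp (frob k r) := by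
  apply algHom_ext
  ext i j
  rw [comulAlgHom_eq]
  simp [ev_mul_gen, frob_gen, add_pow_expChar_pow, Algebra.TensorProduct.tmul_pow]

variable (k) in
/-- `F^r` is a homomorphism of groups. -/
def frobHom (r : ℕ) : O k →ₐc[k] O k := BialgHom.ofAlgHom (frob k r) (counit_frob r) (comul_frob r)

variable (k) in
/-- The ideal of `k[SL₂]` that defines the kernel of `F^r`. -/
def frobIdeal (r : ℕ) : Ideal (O k) :=
  Ideal.map (frob k r) (RingHom.ker (Bialgebra.counitAlgHom k (O k)))

instance (r : ℕ) : ((frobIdeal k r).restrictScalars k).IsCoideal where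
  counit_eq_zero := by
    have h : frobIdeal k r ≤ RingHom.ker (Bialgebra.counitAlgHom k (O k)) := by
      rw [frobIdeal, Ideal.map_le_iff_le_comap]
      intro x hx
      exact (AlgHom.congr_fun (counit_frob r) x).trans hx
    exact fun x hx => h hx
  map_mkQ_comul_eq_zero := by
    have h0 : (Ideal.Quotient.mkₐ k (frobIdeal k r)).comp (frob k r) =
        (Algebra.ofId k _).comp (Bialgebra.counitAlgHom k (O k)) := by
      apply AlgHom.ext
      intro x
      have hx : frob k r (x - algebraMap k (O k) (Bialgebra.counitAlgHom k (O k) x)) ∈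
          frobIdeal k r := by
        apply Ideal.mem_map_of_mem
        rw [RingHom.mem_ker, map_sub, AlgHom.commutes]
        exact sub_self _
      rw [map_sub, AlgHom.commutes] at hx
      exact Ideal.Quotient.eq.2 hx
    have h1 : ((Algebra.TensorProduct.map (Ideal.Quotient.mkₐ k (frobIdeal k r))
        (Ideal.Quotient.mkₐ k (frobIdeal k r))).comp (Bialgebra.comulAlgHom k (O k))).comp
        (frob k r) = (Algebra.ofId k _).comp (Bialgebra.counitAlgHom k (O k)) := by
      rw [AlgHom.comp_assoc, ← comul_frob, ← AlgHom.comp_assoc,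
        ← Algebra.TensorProduct.map_comp, h0]
      apply algHom_ext
      ext i j
      rw [comulAlgHom_eq, counitAlgHom_eq]
      fin_cases i <;> fin_cases j <;>
        simp [ev_mul_gen, Algebra.TensorProduct.one_def] <;> simp [ev_gen_apply]
    have h : frobIdeal k r ≤ RingHom.ker
        ((Algebra.TensorProduct.map (Ideal.Quotient.mkₐ k (frobIdeal k r))
        (Ideal.Quotient.mkₐ k (frobIdeal k r))).comp (Bialgebra.comulAlgHom k (O k))) := by
      rw [frobIdeal, Ideal.map_le_iff_le_comap]
      intro x hx
      refine (AlgHom.congr_fun h1 x).trans ?_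
      rw [AlgHom.comp_apply, (RingHom.mem_ker.1 hx : Bialgebra.counitAlgHom k (O k) x = 0), map_zero]
      rfl
    exact fun x hx => h hx

variable (k) in
/-- The coordinate ring of the Frobenius kernel `G_r = ker F^r`. -/
abbrev OFrob (r : ℕ) : Type u := O k ⧸ frobIdeal k r

variable (k) in
/-- The comorphism `k[G] → k[G_r]` of the inclusion of the Frobenius kernel. -/
def toFrobKer (r : ℕ) : O k →ₐc[k] OFrob k r := Bialgebra.Quotient.mkBialgHom _

instance (r : ℕ) : Nontrivial (OFrob k r) :=
  (Bialgebra.counitAlgHom k (OFrob k r)).toRingHom.domain_nontrivial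

instance (r : ℕ) : CharP (OFrob k r ⊗[k] O k) 2 :=
  charP_of_injective_algebraMap (algebraMap k (OFrob k r ⊗[k] O k)).injective 2

theorem ev_comp_frob {R : Type u} [CommRing R] [Algebra k R] [CharP R 2] (r : ℕ)
    (g : SpecialLinearGroup (Fin 2) R) :
    (ev g).comp (frob k r) = ev (SpecialLinearGroup.map (iterateFrobenius R 2 r) g) := by
  apply algHom_ext
  ext i j
  change ev g (frob k r (gen k i j)) = ev _ (gen k i j)
  rw [frob_gen, map_pow, ev_gen_apply, ev_gen_apply]
  rfl

theorem ev_frobIdeal {R : Type u} [CommRing R] [Algebra k R] [CharP R 2] (r : ℕ)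
    (g : SpecialLinearGroup (Fin 2) R) :
    (∀ x ∈ frobIdeal k r, ev g x = 0) ↔
      SpecialLinearGroup.map (iterateFrobenius R 2 r) g = 1 := by
  have h1 : (∀ x ∈ frobIdeal k r, ev g x = 0) ↔
      ∀ x, Bialgebra.counitAlgHom k (O k) x = 0 → ev g (frob k r x) = 0 := by
    change frobIdeal k r ≤ RingHom.ker (ev g) ↔ _
    rw [frobIdeal, Ideal.map_le_iff_le_comap]
    rfl
  rw [h1]
  constructor
  · intro h
    ext i j
    have h2 := h (gen k i j - algebraMap k (O k) ((1 : SpecialLinearGroup (Fin 2) k) i j)) (by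
      rw [map_sub, AlgHom.commutes, counitAlgHom_eq, ev_gen_apply]
      exact sub_self _)
    rw [map_sub, map_sub, AlgHom.commutes, AlgHom.commutes, sub_eq_zero, frob_gen, map_pow,
      ev_gen_apply] at h2
    refine h2.trans ?_
    fin_cases i <;> fin_cases j <;> simp
  · intro h x hx
    have h2 := AlgHom.congr_fun (ev_comp_frob r g) x
    have h3 : ev (1 : SpecialLinearGroup (Fin 2) R) =
        (Algebra.ofId k R).comp (Bialgebra.counitAlgHom k (O k)) := by
      rw [counitAlgHom_eq, comp_ev, map_one]
    rw [h, h3, AlgHom.comp_apply, AlgHom.comp_apply, hx, map_zero] at h2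
    exact h2

variable (k) in
/-- The restriction of a `G`-module to the Frobenius kernel `G_r`. -/
abbrev resFrobKer (r : ℕ) (X : Comod k (O k)) : Comod k (OFrob k r) :=
  X.res (toFrobKer k r).toCoalgHom

variable (k) in
/-- The Frobenius twist `X^{(r)}`: the pull-back of the `G`-module `X` along `F^r`. -/
abbrev twist (r : ℕ) (X : Comod k (O k)) : Comod k (O k) := X.res (frobHom k r).toCoalgHom

/-- Normality of `G_r`: for the generic points `g` of `G` and `h` of `G_r`, the point `g⁻¹ h g` is a
point of `G_r`. -/
theorem exists_conj (r : ℕ) : ∃ θ : OFrob k r →ₐ[k] OFrob k r ⊗[k] O k,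
    (Algebra.TensorProduct.map (Ideal.Quotient.mkₐ k (frobIdeal k r)) (AlgHom.id k (O k))).comp
      (Bialgebra.comulAlgHom k (O k)) =
    (Algebra.TensorProduct.lift
      (Algebra.TensorProduct.includeRight : O k →ₐ[k] OFrob k r ⊗[k] O k)
      (θ.comp (Ideal.Quotient.mkₐ k (frobIdeal k r))) (fun _ _ => Commute.all _ _)).comp
      (Bialgebra.comulAlgHom k (O k)) := by
  let π := Ideal.Quotient.mkₐ k (frobIdeal k r)
  let R := OFrob k r ⊗[k] O k
  let g : SpecialLinearGroup (Fin 2) R :=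
    mapPt (Algebra.TensorProduct.includeRight : O k →ₐ[k] R) (gen k)
  let h : SpecialLinearGroup (Fin 2) R :=
    mapPt ((Algebra.TensorProduct.includeLeft : OFrob k r →ₐ[k] R).comp π) (gen k)
  have hh : SpecialLinearGroup.map (iterateFrobenius R 2 r) h = 1 := by
    rw [← ev_frobIdeal (k := k)]
    intro x hx
    have : ev h = (Algebra.TensorProduct.includeLeft : OFrob k r →ₐ[k] R).comp π := by
      apply algHom_ext
      rw [mapPt_ev_gen]
    rw [this, AlgHom.comp_apply, show π x = 0 from Ideal.Quotient.eq_zero_iff_mem.2 hx, map_zero]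
  have hc : SpecialLinearGroup.map (iterateFrobenius R 2 r) (g⁻¹ * h * g) = 1 := by
    rw [map_mul, map_mul, hh, mul_one, map_inv, inv_mul_cancel]
  rw [← ev_frobIdeal (k := k)] at hc
  refine ⟨Ideal.Quotient.liftₐ (frobIdeal k r) (ev (g⁻¹ * h * g)) hc, ?_⟩
  have hθ : (Ideal.Quotient.liftₐ (frobIdeal k r) (ev (g⁻¹ * h * g)) hc).comp
      (Ideal.Quotient.mkₐ k (frobIdeal k r)) = ev (g⁻¹ * h * g) := by
    apply AlgHom.ext
    intro x
    rfl
  rw [hθ, comulAlgHom_eq, comp_ev, comp_ev]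
  congr 1
  set a : O k ⊗[k] O k →ₐ[k] OFrob k r ⊗[k] O k :=
    Algebra.TensorProduct.map (Ideal.Quotient.mkₐ k (frobIdeal k r)) (AlgHom.id k (O k))
    with ha
  set b : O k ⊗[k] O k →ₐ[k] OFrob k r ⊗[k] O k :=
    Algebra.TensorProduct.lift
      (Algebra.TensorProduct.includeRight : O k →ₐ[k] OFrob k r ⊗[k] O k)
      (ev (g⁻¹ * h * g)) (fun _ _ => Commute.all _ _) with hb
  have e1 : mapPt a (x₁ k) = h := by
    ext i j
    simp [x₁_apply, ha, h, π]
  have e2 : mapPt a (x₂ k) = g := by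
    ext i j
    simp [x₂_apply, ha, g]
  have e3 : mapPt b (x₁ k) = g := by
    ext i j
    simp [x₁_apply, hb, g]
  have e4 : mapPt b (x₂ k) = g⁻¹ * h * g := by
    ext i j
    change b (x₂ k i j) = _
    rw [x₂_apply, hb, Algebra.TensorProduct.lift_tmul, map_one, one_mul, ev_gen_apply]
  rw [map_mul, map_mul, e1, e2, e3, e4, mul_assoc g⁻¹, mul_inv_cancel_left]

theorem invariants_stable (r : ℕ) (X : Comod k (O k)) :
    ∀ v ∈ (resFrobKer k r X).invariants, X.ρ v ∈
      LinearMap.range (LinearMap.rTensor (O k) (resFrobKer k r X).invariants.subtype) := by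
  intro v hv
  apply mem_range_of_slices
  intro l
  obtain ⟨θ, hθ⟩ := exists_conj (k := k) r
  set π := Ideal.Quotient.mkₐ k (frobIdeal k r) with hπ
  have hv' : LinearMap.lTensor X.V π.toLinearMap (X.ρ v) = v ⊗ₜ 1 := hv
  have hco := LinearMap.congr_fun X.coassoc v
  simp only [LinearMap.comp_apply, LinearEquiv.coe_coe] at hco
  set B : O k ⊗[k] O k →ₐ[k] OFrob k r ⊗[k] O k := Algebra.TensorProduct.lift
      (Algebra.TensorProduct.includeRight : O k →ₐ[k] OFrob k r ⊗[k] O k)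
      (θ.comp π) (fun _ _ => Commute.all _ _) with hB
  -- both sides of the invariance identity before `l` is applied
  have key : LinearMap.lTensor X.V ((Algebra.TensorProduct.map π (AlgHom.id k (O k))).comp
      (Bialgebra.comulAlgHom k (O k))).toLinearMap (X.ρ v) =
      LinearMap.lTensor X.V
        (Algebra.TensorProduct.includeRight : O k →ₐ[k] OFrob k r ⊗[k] O k).toLinearMap
        (X.ρ v) := by
    rw [hθ]
    have h1 : LinearMap.lTensor X.V (B.comp (Bialgebra.comulAlgHom k (O k))).toLinearMap (X.ρ v) =
        LinearMap.lTensor X.V B.toLinearMap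
          (LinearMap.lTensor X.V (Coalgebra.comul (R := k)) (X.ρ v)) := by
      rw [← LinearMap.lTensor_comp_apply]
      rfl
    rw [h1, ← hco]
    have h2 : ∀ t : X.V ⊗[k] O k, LinearMap.lTensor X.V B.toLinearMap
        (TensorProduct.assoc k X.V (O k) (O k) (LinearMap.rTensor (O k) X.ρ t)) =
        LinearMap.lTensor X.V (Algebra.TensorProduct.lift
          (Algebra.TensorProduct.includeRight : O k →ₐ[k] OFrob k r ⊗[k] O k) θ
          (fun _ _ => Commute.all _ _)).toLinearMap
        (TensorProduct.assoc k X.V (O k) (OFrob k r) (LinearMap.rTensor (OFrob k r) X.ρ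
          (LinearMap.lTensor X.V π.toLinearMap t))) := by
      intro t
      induction t with
      | zero => simp
      | add a b ha hb => simp only [map_add, ha, hb]
      | tmul x c =>
        simp only [LinearMap.rTensor_tmul, LinearMap.lTensor_tmul]
        generalize X.ρ x = z
        induction z with
        | zero => simp
        | add a b ha hb => simp only [map_add, TensorProduct.add_tmul, ha, hb]
        | tmul a b => simp [hB]
    rw [h2, hv', LinearMap.rTensor_tmul]
    generalize X.ρ v = z
    induction z with
    | zero => simp
    | add a b ha hb => simp only [map_add, TensorProduct.add_tmul, ha, hb]
    | tmul a b => simp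
  -- apply `l` to the last factor
  let L : OFrob k r ⊗[k] O k →ₗ[k] OFrob k r :=
    (TensorProduct.rid k (OFrob k r)).toLinearMap ∘ₗ LinearMap.lTensor (OFrob k r) l
  have key2 := congrArg (LinearMap.lTensor X.V L) key
  change LinearMap.lTensor X.V π.toLinearMap (X.ρ (TensorProduct.rid k X.V
    (LinearMap.lTensor X.V l (X.ρ v)))) =
    (TensorProduct.rid k X.V (LinearMap.lTensor X.V l (X.ρ v))) ⊗ₜ (1 : OFrob k r)
  have hR : LinearMap.lTensor X.V L (LinearMap.lTensor X.V
        (Algebra.TensorProduct.includeRight : O k →ₐ[k] OFrob k r ⊗[k] O k).toLinearMap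
        (X.ρ v)) =
      (TensorProduct.rid k X.V (LinearMap.lTensor X.V l (X.ρ v))) ⊗ₜ (1 : OFrob k r) := by
    generalize X.ρ v = z
    induction z with
    | zero => simp
    | add a b ha hb => simp only [map_add, TensorProduct.add_tmul, ha, hb]
    | tmul a b => simp [L, TensorProduct.smul_tmul]
  have hL : LinearMap.lTensor X.V L (LinearMap.lTensor X.V
      ((Algebra.TensorProduct.map π (AlgHom.id k (O k))).comp
      (Bialgebra.comulAlgHom k (O k))).toLinearMap (X.ρ v)) =
      LinearMap.lTensor X.V π.toLinearMap (X.ρ (TensorProduct.rid k X.V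
        (LinearMap.lTensor X.V l (X.ρ v)))) := by
    have h1 : LinearMap.lTensor X.V ((Algebra.TensorProduct.map π (AlgHom.id k (O k))).comp
        (Bialgebra.comulAlgHom k (O k))).toLinearMap (X.ρ v) =
        LinearMap.lTensor X.V (Algebra.TensorProduct.map π (AlgHom.id k (O k))).toLinearMap
          (LinearMap.lTensor X.V (Coalgebra.comul (R := k)) (X.ρ v)) := by
      rw [← LinearMap.lTensor_comp_apply]
      rfl
    rw [h1, ← hco]
    generalize X.ρ v = t
    induction t with
    | zero => simp
    | add a b ha hb => simp only [map_add, ha, hb]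
    | tmul x c =>
      simp only [LinearMap.rTensor_tmul, LinearMap.lTensor_tmul, TensorProduct.rid_tmul, map_smul]
      generalize X.ρ x = z
      induction z with
      | zero => simp
      | add a b ha hb => simp only [map_add, TensorProduct.add_tmul, ha, hb, smul_add]
      | tmul a b => simp [L]
  rw [← hL, key2, hR]

variable (k) in
/-- The `G`-module `H⁰(G_r, X) = X^{G_r}`. -/
abbrev frobInvariants (r : ℕ) (X : Comod k (O k)) : Comod k (O k) :=
  X.sub (resFrobKer k r X).invariants (invariants_stable r X)

/-- `V` is the `r`-fold untwist `M^{(-r)}` of `M`, i.e. the `r`-th Frobenius twist of `V` is `M`. -/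
def IsUntwist (r : ℕ) (M V : Comod k (O k)) : Prop := Nonempty (twist k r V ≅ M)

end Frobenius

end SL2
end

/-! Write a, b, c, d for the matrix entries, u = ab, v = cd, w = ad, B = k[u, v]. In characteristic
2 the elements u and v are invariant under N, because ps + qr = ps - qr = 1 for a monomial matrix (p
q; r s) of determinant 1. The functions of weight zero for right translation by T form B + Bw, with
w² = w + uv (`A₀_eq`). The Weyl element fixes B and sends w to -bc = 1 - w, so adding to a function
its Weyl translate takes x + yw to y. Hence k[G/N] = B (`B₀_eq`), and y is the value of p; this
gives the extension `transfer_shortExact`.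

The inverse map g ↦ g⁻¹ makes k[G] a retract of a cofree comodule, so k[G] is injective, and so is
its direct summand k[G/T], cut out by the weight projection. The only invariants of k[G/T] are the
constants, which p kills. Dimension shifting then makes every connecting map Hⁱ(G, k[G/N]) → Hⁱ⁺¹(G,
k[G/N]) bijective (`span_yonedaPower`). Since p is k[G/N]-linear, multiplication is a morphism from
the extension tensored with k[G/N] to the extension itself; naturality of extension classes turns
cup products into Yoneda products (`cup_yonedaPower`), whence the polynomial ring.

Over G_r one needs that k[G] stays injective. An averaging argument gives this from an invariant
integral on G_r and a function whose integral along every coset is 1 (`regularRestrictRetract`). The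
integral is the value at 1 of the r-th power of the Cartier operator of SL₂ for its invariant volume
form; its equivariance is `comul_cartier`, and (bc)^(2^r - 1) has integral 1. Next, w^(2^r) is
G_r-invariant and p maps it to w^(2^r) + (1 - w)^(2^r) = 1. Multiplication by it followed by p
splits k[G/N] off k[G] over G_r (`retractN`), so the higher cohomology vanishes.

For the invariants, B is generated by 1, u, v, uv over its Frobenius image, and the two
infinitesimal unipotent translations act as ∂/∂u and ∂/∂v. Functions in B killed by both are
Frobenius pull-backs (`exists_eq_frob`). A function fixed by G_r allows this argument r times, so
B^{G_r} = F^r(B). -/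

namespace Comod

/-! ### Yoneda products and dimension shifting -/

section Yoneda

open Abelian

variable {k C : Type u} [Field k] [AddCommGroup C] [Module k C] [Coalgebra k C]
  {X Y Z : Comod k C} {j : X ⟶ Y} {p : Y ⟶ X} {w : j ≫ p = 0}

theorem yonedaPower_zero (hE : (ShortComplex.mk j p w).ShortExact) (f : Z ⟶ X) :
    yonedaPower hE f 0 = Ext.mk₀ f := rfl

theorem yonedaPower_succ (hE : (ShortComplex.mk j p w).ShortExact) (f : Z ⟶ X) (i : ℕ) :
    yonedaPower hE f (i + 1) = (yonedaPower hE f i).comp hE.extClass rfl := rfl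

/-- The class of `i + l` copies of an extension is the product of the classes of `i` and `l`
copies. -/
theorem yonedaPower_comp (hE : (ShortComplex.mk j p w).ShortExact) (f : Z ⟶ X) (i l n : ℕ)
    (h : i + l = n) :
    (yonedaPower hE f i).comp (yonedaPower hE (𝟙 X) l) h = yonedaPower hE f n := by
  subst h
  induction l with
  | zero => exact Ext.comp_mk₀_id _
  | succ l ih =>
    change _ = (yonedaPower hE f (i + l)).comp hE.extClass rfl
    rw [← ih, yonedaPower_succ, Ext.comp_assoc]
    rfl

/-- If `Y` is injective, `Hom(Z, X)` is a line spanned by `f ≠ 0` and `Hom(Z, Y) → Hom(Z, X)`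
vanishes, then the Yoneda products of `f` with the extension are bases of the `Extⁱ(Z, X)`. -/
theorem span_yonedaPower [Injective Y] (hE : (ShortComplex.mk j p w).ShortExact) (f : Z ⟶ X)
    (hf : f ≠ 0) (hX : ∀ g : Z ⟶ X, ∃ c : k, g = c • f) (hY : ∀ g : Z ⟶ Y, g ≫ p = 0) (i : ℕ) :
    yonedaPower hE f i ≠ 0 ∧ ∀ x, ∃ c : k, x = c • yonedaPower hE f i := by
  induction i with
  | zero =>
    refine ⟨fun h => hf ((Ext.mk₀_bijective Z X).1 (h.trans (Ext.mk₀_zero _ _).symm)), fun x => ?_⟩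
    obtain ⟨g, rfl⟩ := (Ext.mk₀_bijective Z X).2 x
    obtain ⟨c, rfl⟩ := hX g
    exact ⟨c, Ext.mk₀_smul _ _⟩
  | succ i ih =>
    constructor
    · intro h
      -- If the connecting map kills the i-th class, that class comes from Extⁱ(Z, Y), where it
      -- vanishes: by `hY` in degree 0, by injectivity of Y above.
      obtain ⟨y, hy⟩ := Ext.covariant_sequence_exact₃ Z hE (yonedaPower hE f i) rfl h
      apply ih.1
      rw [← hy]
      cases i with
      | zero =>
        obtain ⟨g, rfl⟩ := (Ext.mk₀_bijective Z Y).2 y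
        rw [Ext.mk₀_comp_mk₀]
        exact (congrArg Ext.mk₀ (hY g)).trans (Ext.mk₀_zero _ _)
      | succ i =>
        have : y = 0 := Ext.eq_zero_of_injective y
        rw [this, Ext.zero_comp]
    · intro x
      -- Extⁱ⁺¹(Z, Y) = 0 makes the connecting map onto Extⁱ⁺¹(Z, X) surjective.
      obtain ⟨y, rfl⟩ := Ext.covariant_sequence_exact₁ Z hE x
        (Ext.eq_zero_of_injective (I := Y) _) rfl
      obtain ⟨c, rfl⟩ := ih.2 y
      exact ⟨c, Ext.smul_comp _ _ _ _⟩

end Yoneda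

/-! ### Cup products with an algebra-linear extension -/

section Cup

open Abelian

variable {k C : Type u} [Field k] [CommRing C] [Bialgebra k C] (A : ComodAlg k C)
  {Y : Comod k C} {j : A.toComod ⟶ Y} {p : Y ⟶ A.toComod} {w : j ≫ p = 0}

/-- The hypotheses `hj` and `hp` are the A-linearity of j and p. They make (mul, m, mul) a morphism
from the extension tensored with A to the extension itself, and extension classes are natural. -/
theorem extClass_tensor_mul (hE : (ShortComplex.mk j p w).ShortExact)
    (m : tensor Y A.toComod ⟶ Y)
    (hj : (tensorRight A.toComod).map j ≫ m = A.mul ≫ j)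
    (hp : (tensorRight A.toComod).map p ≫ A.mul = m ≫ p) :
    (hE.extClass.mapExactFunctor (tensorRight A.toComod)).comp (Ext.mk₀ A.mul) (add_zero 1) =
      (Ext.mk₀ A.mul).comp hE.extClass (zero_add 1) := by
  rw [Ext.mapExactFunctor_extClass]
  let φ : (ShortComplex.mk j p w).map (tensorRight A.toComod) ⟶ ShortComplex.mk j p w :=
    { τ₁ := A.mul
      τ₂ := m
      τ₃ := A.mul
      comm₁₂ := hj.symm
      comm₂₃ := hp.symm }
  exact (hE.map_of_exact (tensorRight A.toComod)).extClass_naturality hE φ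

/-- Multiplication is moved past the copies of the extension one at a time by `extClass_tensor_mul`,
until it meets f ⊗ A. -/
theorem yonedaPower_tensor_mul (hE : (ShortComplex.mk j p w).ShortExact)
    (m : tensor Y A.toComod ⟶ Y)
    (hj : (tensorRight A.toComod).map j ≫ m = A.mul ≫ j)
    (hp : (tensorRight A.toComod).map p ≫ A.mul = m ≫ p) {Z : Comod k C} (f : Z ⟶ A.toComod)
    (i : ℕ) :
    ((yonedaPower hE f i).mapExactFunctor (tensorRight A.toComod)).comp
      (Ext.mk₀ A.mul) (add_zero i) =
    (Ext.mk₀ ((tensorRight A.toComod).map f ≫ A.mul)).comp (yonedaPower hE (𝟙 _) i)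
      (zero_add i) := by
  induction i with
  | zero =>
    rw [yonedaPower_zero, yonedaPower_zero, Ext.mapExactFunctor_mk₀, Ext.comp_mk₀_id]
    exact Ext.mk₀_comp_mk₀ _ _
  | succ i ih =>
    rw [yonedaPower_succ, yonedaPower_succ, Ext.mapExactFunctor_comp]
    refine (Ext.comp_assoc_of_third_deg_zero _ _ _ _).trans ?_
    refine (congrArg (fun z => Ext.comp _ z rfl) (extClass_tensor_mul A hE m hj hp)).trans ?_
    refine (Ext.comp_assoc_of_second_deg_zero _ _ _ _).symm.trans ?_
    refine (congrArg (fun z => Ext.comp z hE.extClass rfl) ih).trans ?_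
    exact Ext.comp_assoc _ _ _ _ _ (by lia)

theorem toTrivTensor_unit_mul :
    toTrivTensor A.toComod ≫ (tensorRight A.toComod).map A.unit ≫ A.mul = 𝟙 A.toComod := by
  apply hom_ext
  apply LinearMap.ext
  intro x
  change LinearMap.mul' k A.A (LinearMap.rTensor A.A (Algebra.linearMap k A.A)
    ((TensorProduct.lid k A.A).symm x)) = x
  rw [TensorProduct.lid_symm_apply, LinearMap.rTensor_tmul, LinearMap.mul'_apply]
  simp

/-- If `p` is `A`-linear, the cup product with the class of `i` copies of the extension is the
Yoneda product with it. -/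
theorem cup_yonedaPower (hE : (ShortComplex.mk j p w).ShortExact)
    (m : tensor Y A.toComod ⟶ Y)
    (hj : (tensorRight A.toComod).map j ≫ m = A.mul ≫ j)
    (hp : (tensorRight A.toComod).map p ≫ A.mul = m ≫ p) (i l : ℕ) :
    A.cup i l (yonedaPower hE A.unit i) (yonedaPower hE A.unit l) =
      yonedaPower hE A.unit (i + l) := by
  refine (A.cup_apply i l _ _).trans ?_
  refine (congrArg (fun z => Ext.comp _ z (add_comm l i))
    (yonedaPower_tensor_mul A hE m hj hp A.unit i)).trans ?_
  refine (Ext.comp_assoc _ _ _ (add_zero l) (zero_add i) (by lia)).trans ?_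
  -- The maps left over in degree 0 are A → k ⊗ A → A ⊗ A → A, which compose to the identity by the
  -- unit law.
  refine (congrArg (fun z => Ext.comp _ z (add_comm l i)) ((Ext.mk₀_comp_mk₀_assoc _ _ _).trans
    ((congrArg (fun g => (Ext.mk₀ g).comp _ (zero_add i)) (toTrivTensor_unit_mul A)).trans
      (Ext.mk₀_id_comp _)))).trans ?_
  exact yonedaPower_comp hE A.unit l i (i + l) (add_comm l i)

end Cup

/-! ### Recognition of a polynomial ring -/

section Ring

variable {k C : Type u} [Field k] [CommRing C] [Bialgebra k C] (A : ComodAlg k C)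

/-- If `x i` is a basis of `Hⁱ(G, A)` and `x i ∪ x l = x (i + l)`, then `H^*(G, A)` is a polynomial
ring. -/
theorem exists_polynomial_ringEquiv (x : ∀ i, A.H i) (hx : ∀ i, x i ≠ 0)
    (hs : ∀ i (y : A.H i), ∃ c : k, y = c • x i) (hm : ∀ i l, A.cup i l (x i) (x l) = x (i + l)) :
    ∃ e : Polynomial k ≃+* DirectSum ℕ A.H, (∀ (c : k) (q : Polynomial k), e (c • q) = c • e q) ∧
      ∀ i : ℕ, e (Polynomial.X ^ i) = DirectSum.of A.H i (x i) := by
  classical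
  let φ : Polynomial k →ₗ[k] DirectSum ℕ A.H :=
    Polynomial.lsum fun i => DirectSum.lof k ℕ A.H i ∘ₗ LinearMap.toSpanSingleton k _ (x i)
  have hφ : ∀ i c, φ (Polynomial.monomial i c) = DirectSum.of A.H i (c • x i) := by
    intro i c
    simp only [φ, Polynomial.lsum_apply]
    rw [Polynomial.sum_monomial_index _ _ (by simp)]
    rfl
  have hcoeff : ∀ q i, φ q i = q.coeff i • x i := by
    intro q i
    induction q using Polynomial.induction_on' with
    | add p q hp hq => rw [map_add, DirectSum.add_apply, hp, hq, Polynomial.coeff_add, add_smul]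
    | monomial n a =>
      rw [hφ, Polynomial.coeff_monomial]
      split_ifs with h
      · subst h
        rw [DirectSum.of_eq_same]
      · rw [DirectSum.of_eq_of_ne _ _ _ (Ne.symm h), zero_smul]
  have hinj : Function.Injective φ := by
    rw [injective_iff_map_eq_zero]
    intro q hq
    ext i
    have h := hcoeff q i
    rw [hq] at h
    exact (smul_eq_zero.1 h.symm).resolve_right (hx i)
  have hsurj : Function.Surjective φ := by
    intro y
    induction y using DirectSum.induction_on with
    | zero => exact ⟨0, map_zero _⟩
    | of i y =>
      obtain ⟨c, rfl⟩ := hs i y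
      exact ⟨_, hφ i c⟩
    | add a b ha hb =>
      obtain ⟨a, rfl⟩ := ha
      obtain ⟨b, rfl⟩ := hb
      exact ⟨a + b, map_add _ _ _⟩
  have hmul : ∀ a b, φ (a * b) = φ a * φ b := by
    intro a b
    induction a using Polynomial.induction_on' with
    | add p q hp hq => rw [add_mul, map_add, map_add, add_mul, hp, hq]
    | monomial n c =>
      induction b using Polynomial.induction_on' with
      | add p q hp hq => rw [mul_add, map_add, map_add, mul_add, hp, hq]
      | monomial m d =>
        rw [Polynomial.monomial_mul_monomial, hφ, hφ, hφ, DirectSum.of_mul_of]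
        congr 1
        change _ = A.cup n m (c • x n) (d • x m)
        rw [map_smul, map_smul, LinearMap.smul_apply, hm, smul_smul, mul_comm]
  -- The multiplication on the direct sum carries only distributive laws here, hence a non-unital
  -- homomorphism; being bijective, it transports the unit and associativity from the polynomial
  -- ring.
  refine ⟨RingEquiv.ofBijective (⟨⟨φ, hmul⟩, map_zero _, map_add _⟩ : Polynomial k →ₙ+* _)
    ⟨hinj, hsurj⟩, fun c q => map_smul φ c q, fun i => ?_⟩
  change φ _ = _
  rw [Polynomial.X_pow_eq_monomial, hφ, one_smul]

end Ring

end Comod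

theorem LinearMap.lTensor_rTensor_apply {k V W C D : Type*} [CommRing k] [AddCommGroup V] [Module k V]
    [AddCommGroup W] [Module k W] [AddCommGroup C] [Module k C] [AddCommGroup D] [Module k D]
    (f : V →ₗ[k] W) (φ : C →ₗ[k] D) (t : V ⊗[k] C) :
    LinearMap.lTensor W φ (LinearMap.rTensor C f t) =
      LinearMap.rTensor D f (LinearMap.lTensor V φ t) := by
  rw [← LinearMap.comp_apply, ← LinearMap.comp_apply, LinearMap.rTensor_comp_lTensor,
    LinearMap.lTensor_comp_rTensor]

namespace Comod

/-! ### Cofree comodules are injective -/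

section Cofree

variable {k C : Type u} [Field k] [AddCommGroup C] [Module k C] [Coalgebra k C]

/-- The cofree comodule `V ⊗ C`. -/
noncomputable abbrev cofree (C : Type u) [AddCommGroup C] [Module k C] [Coalgebra k C] (V : Type u)
    [AddCommGroup V] [Module k V] : Comod k C where
  V := V ⊗[k] C
  ρ := (TensorProduct.assoc k V C C).symm.toLinearMap ∘ₗ
    LinearMap.lTensor V (Coalgebra.comul (R := k))
  coassoc := by
    apply TensorProduct.ext'
    intro v c
    simp only [LinearMap.comp_apply, LinearEquiv.coe_coe, LinearMap.lTensor_tmul]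
    set R := (TensorProduct.assoc k V C C).symm.toLinearMap ∘ₗ
      LinearMap.lTensor V (Coalgebra.comul (R := k) (A := C))
    have h1 : ∀ z : C ⊗[k] C, TensorProduct.assoc k (V ⊗[k] C) C C
        (LinearMap.rTensor C R ((TensorProduct.assoc k V C C).symm (v ⊗ₜ z))) =
        (TensorProduct.assoc k V C (C ⊗[k] C)).symm (v ⊗ₜ TensorProduct.assoc k C C C
          (LinearMap.rTensor C (Coalgebra.comul (R := k)) z)) := by
      intro z
      induction z with
      | zero => simp
      | add a b ha hb => simp only [map_add, TensorProduct.tmul_add, ha, hb]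
      | tmul a b =>
        simp only [TensorProduct.assoc_symm_tmul, LinearMap.rTensor_tmul, R, LinearMap.comp_apply,
          LinearMap.lTensor_tmul, LinearEquiv.coe_coe]
        generalize Coalgebra.comul (R := k) a = y
        induction y with
        | zero => simp
        | add a b ha hb => simp only [map_add, TensorProduct.tmul_add, TensorProduct.add_tmul, ha, hb]
        | tmul a b => simp
    have h2 : ∀ z : C ⊗[k] C, LinearMap.lTensor (V ⊗[k] C) (Coalgebra.comul (R := k))
        ((TensorProduct.assoc k V C C).symm (v ⊗ₜ z)) =
        (TensorProduct.assoc k V C (C ⊗[k] C)).symm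
          (v ⊗ₜ LinearMap.lTensor C (Coalgebra.comul (R := k)) z) := by
      intro z
      induction z with
      | zero => simp
      | add a b ha hb => simp only [map_add, TensorProduct.tmul_add, ha, hb]
      | tmul a b => simp
    rw [h1, h2, Coalgebra.coassoc_apply]
  counit := by
    apply TensorProduct.ext'
    intro v c
    have h : ∀ z : C ⊗[k] C, TensorProduct.rid k (V ⊗[k] C)
        (LinearMap.lTensor (V ⊗[k] C) (Coalgebra.counit (R := k))
          ((TensorProduct.assoc k V C C).symm (v ⊗ₜ z))) =
        v ⊗ₜ TensorProduct.rid k C (LinearMap.lTensor C (Coalgebra.counit (R := k)) z) := by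
      intro z
      induction z with
      | zero => simp
      | add a b ha hb => simp only [map_add, TensorProduct.tmul_add, ha, hb]
      | tmul a b => simp
    simp only [LinearMap.comp_apply, LinearEquiv.coe_coe, LinearMap.lTensor_tmul]
    rw [h, Coalgebra.lTensor_counit_comul]
    simp

theorem cofree_ρ_tmul (V : Type u) [AddCommGroup V] [Module k V] (v : V) (c : C) :
    (cofree C V).ρ (v ⊗ₜ c) =
      (TensorProduct.assoc k V C C).symm (v ⊗ₜ Coalgebra.comul (R := k) c) := rfl

/-- The morphism `Y → V ⊗ C` that corresponds to a linear map `Y → V`. -/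
noncomputable def toCofree {V : Type u} [AddCommGroup V] [Module k V] (Y : Comod k C)
    (l : Y.V →ₗ[k] V) : Y ⟶ cofree C V :=
  mkHom (Y := cofree C V) (LinearMap.rTensor C l ∘ₗ Y.ρ) (by
    apply LinearMap.ext
    intro y
    have h1 := LinearMap.congr_fun Y.coassoc y
    simp only [LinearMap.comp_apply, LinearEquiv.coe_coe] at h1 ⊢
    rw [LinearEquiv.symm_apply_eq]
    rw [LinearMap.lTensor_rTensor_apply, ← h1]
    generalize Y.ρ y = t
    induction t with
    | zero => simp
    | add a b ha hb => simp only [map_add, ha, hb]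
    | tmul a c =>
      simp only [LinearMap.rTensor_tmul, LinearMap.comp_apply]
      generalize Y.ρ a = t
      induction t with
      | zero => simp
      | add a b ha hb => simp only [map_add, TensorProduct.add_tmul, ha, hb]
      | tmul a c => simp)

theorem lin_toCofree {V : Type u} [AddCommGroup V] [Module k V] (Y : Comod k C)
    (l : Y.V →ₗ[k] V) : lin (toCofree Y l) = LinearMap.rTensor C l ∘ₗ Y.ρ := rfl

/-- The linear map is the composite of g with id ⊗ ε; the counit axiom for C recovers g from it.
Together with `toCofree` this is the adjunction between comodules and vector spaces. -/
theorem eq_toCofree {V : Type u} [AddCommGroup V] [Module k V] {X : Comod k C}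
    (g : X ⟶ cofree C V) : ∃ l, g = toCofree X l := by
  let e : V ⊗[k] C →ₗ[k] V := (TensorProduct.rid k V).toLinearMap ∘ₗ
    LinearMap.lTensor V (Coalgebra.counit (R := k))
  have he : ∀ t : V ⊗[k] C, LinearMap.rTensor C e ((cofree C V).ρ t) = t := by
    intro t
    induction t with
    | zero => simp
    | add a b ha hb => simp only [map_add, ha, hb]
    | tmul v c =>
      rw [cofree_ρ_tmul]
      have h : ∀ z : C ⊗[k] C, LinearMap.rTensor C e
          ((TensorProduct.assoc k V C C).symm (v ⊗ₜ z)) =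
          v ⊗ₜ TensorProduct.lid k C (LinearMap.rTensor C (Coalgebra.counit (R := k)) z) := by
        intro z
        induction z with
        | zero => simp
        | add a b ha hb => simp only [map_add, TensorProduct.tmul_add, ha, hb]
        | tmul a b => simp [e, TensorProduct.smul_tmul]
      rw [h, Coalgebra.rTensor_counit_comul]
      simp
  refine ⟨e ∘ₗ lin g, hom_ext (LinearMap.ext fun x => ?_)⟩
  rw [lin_toCofree, LinearMap.comp_apply, LinearMap.rTensor_comp_apply, ← comm_apply, he]

/-- By the adjunction, extending a morphism along a monomorphism means extending a linear map along
an injective one, which a linear retraction s does. -/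
instance cofree_injective (V : Type u) [AddCommGroup V] [Module k V] :
    Injective (cofree (k := k) C V) where
  factors {X Y} g f _ := by
    obtain ⟨l, rfl⟩ := eq_toCofree g
    obtain ⟨s, hs⟩ := (lin f).exists_leftInverse_of_injective
      (LinearMap.ker_eq_bot.2 (injective_of_mono f))
    refine ⟨toCofree Y (l ∘ₗ s), hom_ext (LinearMap.ext fun x => ?_)⟩
    rw [lin_comp, lin_toCofree, lin_toCofree, LinearMap.comp_apply, LinearMap.comp_apply,
      comm_apply, ← LinearMap.rTensor_comp_apply, LinearMap.comp_assoc, hs, LinearMap.comp_id]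
    rfl

end Cofree

/-! ### Restriction along coalgebra maps -/

section Restriction

variable {k C D : Type u} [Field k] [AddCommGroup C] [Module k C] [Coalgebra k C]
  [AddCommGroup D] [Module k D] [Coalgebra k D]

/-- The restriction of a morphism along a coalgebra map. -/
noncomputable def resMap (φ : C →ₗc[k] D) {X Y : Comod k C} (f : X ⟶ Y) : res φ X ⟶ res φ Y :=
  mkHom (X := res φ X) (Y := res φ Y) (lin (X := X) (Y := Y) f) (by
    apply LinearMap.ext
    intro x
    change LinearMap.lTensor Y.V φ.toLinearMap (Y.ρ (lin f x)) =
      LinearMap.rTensor D (lin f) (LinearMap.lTensor X.V φ.toLinearMap (X.ρ x))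
    rw [comm_apply, LinearMap.lTensor_rTensor_apply])

theorem resMap_comp (φ : C →ₗc[k] D) {X Y Z : Comod k C} (f : X ⟶ Y) (g : Y ⟶ Z) :
    resMap φ (f ≫ g) = resMap φ f ≫ resMap φ g := rfl

theorem resMap_id (φ : C →ₗc[k] D) (X : Comod k C) : resMap φ (𝟙 X) = 𝟙 _ := rfl

/-- The restriction of an isomorphism along a coalgebra map. -/
noncomputable def resIso (φ : C →ₗc[k] D) {X Y : Comod k C} (f : X ≅ Y) : res φ X ≅ res φ Y where
  hom := resMap φ f.hom
  inv := resMap φ f.inv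
  hom_inv_id := by rw [← resMap_comp, f.hom_inv_id, resMap_id]
  inv_hom_id := by rw [← resMap_comp, f.inv_hom_id, resMap_id]

/-- A bijective morphism is an isomorphism. -/
noncomputable def isoOfBijective {X Y : Comod k C} (f : X ⟶ Y)
    (hf : Function.Bijective (lin f)) : X ≅ Y :=
  haveI := mono_of_injective f hf.1
  haveI := epi_of_surjective f hf.2
  haveI := isIso_of_mono_of_epi f
  asIso f

/-- Restriction along an injective coalgebra map is fully faithful on isomorphisms. -/
theorem nonempty_iso_of_res (φ : C →ₗc[k] D) (hφ : Function.Injective φ) {X Y : Comod k C}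
    (e : res φ X ≅ res φ Y) : Nonempty (X ≅ Y) := by
  have hl : ∀ V : Type u, ∀ [AddCommGroup V] [Module k V],
      Function.Injective (LinearMap.lTensor V φ.toLinearMap) := fun V _ _ =>
    Module.Flat.lTensor_preserves_injective_linearMap φ.toLinearMap hφ
  let f : X ⟶ Y := mkHom (X := X) (Y := Y) (lin (X := res φ X) (Y := res φ Y) e.hom) (by
    apply LinearMap.ext
    intro x
    -- Since V ⊗ C embeds in V ⊗ D, compatibility with the coactions of C can be tested after
    -- applying φ.
    apply hl
    refine (comm_apply e.hom x).trans ?_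
    change LinearMap.rTensor D (lin (X := res φ X) (Y := res φ Y) e.hom)
        (LinearMap.lTensor X.V φ.toLinearMap (X.ρ x)) = LinearMap.lTensor Y.V φ.toLinearMap
        (LinearMap.rTensor C (lin (X := res φ X) (Y := res φ Y) e.hom) (X.ρ x))
    rw [LinearMap.lTensor_rTensor_apply])
  exact ⟨isoOfBijective f ⟨injective_of_mono (X := res φ X) (Y := res φ Y) e.hom,
    surjective_of_epi (X := res φ X) (Y := res φ Y) e.hom⟩⟩

end Restriction

/-! ### Vanishing for injective comodules -/

section Vanishing

variable {k C : Type u} [Field k] [CommRing C] [Bialgebra k C]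

theorem subsingleton_H_of_injective (X : Comod k C) [Injective X] (i : ℕ) (hi : 0 < i) :
    Subsingleton (X.H i) := by
  obtain ⟨i, rfl⟩ := Nat.exists_eq_succ_of_ne_zero hi.ne'
  exact Abelian.Ext.subsingleton_of_injective _ _ i

end Vanishing

end Comod

/-- The algebra homomorphism `(x ⊗ y) ⊗ z ↦ (x ⊗ z) ⊗ y`. -/
noncomputable def swapRight (k X Y Z : Type*) [CommRing k] [CommRing X] [Algebra k X] [CommRing Y]
    [Algebra k Y] [CommRing Z] [Algebra k Z] : (X ⊗[k] Y) ⊗[k] Z →ₐ[k] (X ⊗[k] Z) ⊗[k] Y :=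
  Algebra.TensorProduct.lift
    (Algebra.TensorProduct.map Algebra.TensorProduct.includeLeft (AlgHom.id k Y))
    (Algebra.TensorProduct.includeLeft.comp Algebra.TensorProduct.includeRight)
    (fun _ _ => Commute.all _ _)

@[simp] theorem swapRight_tmul (k X Y Z : Type*) [CommRing k] [CommRing X] [Algebra k X] [CommRing Y]
    [Algebra k Y] [CommRing Z] [Algebra k Z] (x : X) (y : Y) (z : Z) :
    swapRight k X Y Z ((x ⊗ₜ y) ⊗ₜ z) = (x ⊗ₜ z) ⊗ₜ y := by
  simp [swapRight]

namespace SL2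

open Matrix Comod

theorem mul_apply_fin_two {R : Type*} [CommRing R] (g h : SpecialLinearGroup (Fin 2) R)
    (i j : Fin 2) : (g * h) i j = g i 0 * h 0 j + g i 1 * h 1 j := by
  change (g.1 * h.1) i j = _
  rw [Matrix.mul_apply, Fin.sum_univ_two]

variable {k : Type u} [Field k]

/-! ### Generators of `k[SL₂]` -/

theorem det_gen : gen k 0 0 * gen k 1 1 - gen k 0 1 * gen k 1 0 = 1 := by
  have h := (gen k).2
  rw [Matrix.det_fin_two] at h
  exact h

/-- `k[SL₂]` is spanned by the monomials in the matrix entries. -/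
theorem span_monomials (W : Submodule k (O k))
    (h : ∀ i j l n : ℕ, gen k 0 0 ^ i * gen k 0 1 ^ j * (gen k 1 0 ^ l * gen k 1 1 ^ n) ∈ W)
    (f : O k) : f ∈ W := by
  obtain ⟨P, rfl⟩ := Ideal.Quotient.mk_surjective f
  change O.mk k P ∈ W
  induction P using MvPolynomial.induction_on' with
  | add p q hp hq => rw [map_add]; exact W.add_mem hp hq
  | monomial e a =>
    rw [MvPolynomial.monomial_eq, ← MvPolynomial.smul_eq_C_mul, map_smul,
      Finsupp.prod_fintype _ _ (fun _ => pow_zero _), Fintype.prod_prod_type, Fin.prod_univ_two,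
      Fin.prod_univ_two, Fin.prod_univ_two, map_mul, map_mul, map_mul]
    simp only [map_pow]
    exact W.smul_mem a (h _ _ _ _)

/-- The morphism `f ↦ f(x⁻¹)`. -/
noncomputable def inv (k : Type u) [Field k] : O k →ₐ[k] O k := ev (gen k)⁻¹

theorem inv_inv_apply (f : O k) : inv k (inv k f) = f := by
  have h : (inv k).comp (inv k) = AlgHom.id k (O k) := by
    apply algHom_ext
    change mapPt ((inv k).comp (ev (gen k)⁻¹)) (gen k) = _
    rw [comp_ev, mapPt_ev_gen, map_inv, inv, mapPt_ev_gen, inv_inv]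
    ext i j
    rfl
  exact AlgHom.congr_fun h f

/-- For f'(g) = f(g⁻¹) the left translate f'(x⁻¹g) is f(g⁻¹x): inversion turns left translation into
right translation, whose coaction is the comultiplication of the cofree comodule. -/
theorem leftRegular_inv : (leftRegular k).comp (inv k) =
    (Algebra.TensorProduct.map (inv k) (AlgHom.id k (O k))).comp
      (Bialgebra.comulAlgHom k (O k)) := by
  rw [comulAlgHom_eq, comp_ev, inv, comp_ev]
  congr 1
  have h1 : mapPt (Algebra.TensorProduct.map (ev (gen k)⁻¹) (AlgHom.id k (O k))) (x₁ k) =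
      (x₁ k)⁻¹ := by
    rw [x₁, mapPt_mapPt, Algebra.TensorProduct.map_comp_includeLeft, ← mapPt_mapPt, mapPt_ev_gen,
      map_inv]
  have h2 : mapPt (Algebra.TensorProduct.map (ev (gen k)⁻¹) (AlgHom.id k (O k))) (x₂ k) =
      x₂ k := by
    rw [x₂, mapPt_mapPt, Algebra.TensorProduct.map_comp_includeRight]
    rfl
  rw [map_mul, h1, h2, map_inv, leftRegular, mapPt_ev_gen, _root_.mul_inv_rev, inv_inv]

/-- This is f(x⁻¹g) at g = 1. It identifies the section in `regularRetract` with inversion. -/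
theorem counit_leftRegular (f : O k) : TensorProduct.lid k (O k)
    (LinearMap.rTensor (O k) (Coalgebra.counit (R := k)) (leftRegular k f)) = inv k f := by
  have h : (Algebra.TensorProduct.lid k (O k)).toAlgHom.comp ((Algebra.TensorProduct.map
      (Bialgebra.counitAlgHom k (O k)) (AlgHom.id k (O k))).comp (leftRegular k)) = inv k := by
    rw [leftRegular, comp_ev, comp_ev, inv]
    congr 1
    rw [map_mul, map_mul, map_inv, map_inv, x₁, x₂, mapPt_mapPt, mapPt_mapPt, mapPt_mapPt,
      mapPt_mapPt]
    have h1 : mapPt ((Algebra.TensorProduct.lid k (O k)).toAlgHom.comp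
        ((Algebra.TensorProduct.map (Bialgebra.counitAlgHom k (O k)) (AlgHom.id k (O k))).comp
          Algebra.TensorProduct.includeLeft)) (gen k) = 1 := by
      ext i j
      fin_cases i <;> fin_cases j <;> simp [counitAlgHom_eq, ev_gen_apply]
    have h2 : mapPt ((Algebra.TensorProduct.lid k (O k)).toAlgHom.comp
        ((Algebra.TensorProduct.map (Bialgebra.counitAlgHom k (O k)) (AlgHom.id k (O k))).comp
          Algebra.TensorProduct.includeRight)) (gen k) = gen k := by
      ext i j
      simp
    simp only [← AlgHom.comp_assoc] at h1 h2
    rw [h1, h2, mul_one]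
  exact AlgHom.congr_fun h f

/-- `k[SL₂]` is a retract of a cofree module. -/
noncomputable def regularRetract (k : Type u) [Field k] :
    Retract (regular k).toComod (cofree (k := k) (O k) k) where
  i := toCofree (regular k).toComod (Coalgebra.counit (R := k) (A := O k))
  r := mkHom (X := cofree (k := k) (O k) k) (Y := (regular k).toComod)
    ((inv k).toLinearMap ∘ₗ (TensorProduct.lid k (O k)).toLinearMap) (by
      apply TensorProduct.ext'
      intro a f
      have h := AlgHom.congr_fun (leftRegular_inv (k := k)) f
      change leftRegular k (inv k (TensorProduct.lid k (O k) (a ⊗ₜ f))) =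
        LinearMap.rTensor (O k) ((inv k).toLinearMap ∘ₗ (TensorProduct.lid k (O k)).toLinearMap)
          ((TensorProduct.assoc k k (O k) (O k)).symm (a ⊗ₜ Bialgebra.comulAlgHom k (O k) f))
      simp only [AlgHom.comp_apply] at h
      rw [TensorProduct.lid_tmul, map_smul, map_smul, h]
      generalize Bialgebra.comulAlgHom k (O k) f = t
      induction t with
      | zero => simp
      | add a b ha hb => simp only [map_add, TensorProduct.tmul_add, smul_add, ha, hb]
      | tmul x y => simp [TensorProduct.smul_tmul'])
  retract := hom_ext (LinearMap.ext fun f => by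
    change inv k (TensorProduct.lid k (O k)
      (LinearMap.rTensor (O k) (Coalgebra.counit (R := k)) (leftRegular k f))) = f
    rw [counit_leftRegular, inv_inv_apply])

instance : Injective (regular k).toComod := (regularRetract k).injective

/-! ### Averages of right translates -/

section Average

variable {L : Type u} [CommRing L] [Algebra k L]

/-- The right translate `g ↦ f(g h)` of a regular function by a point `h ∈ SL₂(L)`. -/
noncomputable def rightTranslate (h : SpecialLinearGroup (Fin 2) L) : O k →ₐ[k] O k ⊗[k] L :=
  ev (mapPt (Algebra.TensorProduct.includeLeft : O k →ₐ[k] O k ⊗[k] L) (gen k) *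
    mapPt (Algebra.TensorProduct.includeRight : L →ₐ[k] O k ⊗[k] L) h)

/-- Left and right translations commute. -/
theorem leftRegular_rightTranslate (h : SpecialLinearGroup (Fin 2) L) :
    (Algebra.TensorProduct.map (leftRegular k) (AlgHom.id k L)).comp (rightTranslate h) =
      ((swapRight k (O k) L (O k)).comp
        (Algebra.TensorProduct.map (rightTranslate h) (AlgHom.id k (O k)))).comp
        (leftRegular k) := by
  have e : leftRegular k = ev ((x₂ k)⁻¹ * x₁ k) := rfl
  have e' : rightTranslate (k := k) h = ev (mapPt _ (gen k) * mapPt _ h) := rfl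
  set φ := Algebra.TensorProduct.map (leftRegular k) (AlgHom.id k L) with hφ
  set ψ := (swapRight k (O k) L (O k)).comp
        (Algebra.TensorProduct.map (rightTranslate h) (AlgHom.id k (O k))) with hψ
  let l : O k ⊗[k] O k →ₐ[k] (O k ⊗[k] O k) ⊗[k] L := Algebra.TensorProduct.includeLeft
  have h1 : φ.comp Algebra.TensorProduct.includeLeft = l.comp (leftRegular k) := by
    apply AlgHom.ext
    intro x
    simp [hφ, l]
  have h2 : φ.comp Algebra.TensorProduct.includeRight =
      (Algebra.TensorProduct.includeRight : L →ₐ[k] (O k ⊗[k] O k) ⊗[k] L) := by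
    apply AlgHom.ext
    intro x
    simp [hφ]
  have h3 : ψ.comp (Algebra.TensorProduct.includeRight : O k →ₐ[k] O k ⊗[k] O k) =
      l.comp Algebra.TensorProduct.includeRight := by
    apply AlgHom.ext
    intro x
    simp [hψ, l, Algebra.TensorProduct.one_def]
  -- m places the variables (g, h) in the outer slots, leaving the middle one to the translating
  -- element x. Both sides then evaluate f at x⁻¹ g h.
  let m : O k ⊗[k] L →ₐ[k] (O k ⊗[k] O k) ⊗[k] L :=
    (swapRight k (O k) L (O k)).comp
      Algebra.TensorProduct.includeLeft
  have h4 : ψ.comp (Algebra.TensorProduct.includeLeft : O k →ₐ[k] O k ⊗[k] O k) =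
      m.comp (rightTranslate h) := by
    apply AlgHom.ext
    intro x
    simp [hψ, m]
  have h5 : m.comp Algebra.TensorProduct.includeLeft =
      l.comp Algebra.TensorProduct.includeLeft := by
    apply AlgHom.ext
    intro x
    simp [m, l]
  have h6 : m.comp Algebra.TensorProduct.includeRight =
      (Algebra.TensorProduct.includeRight : L →ₐ[k] (O k ⊗[k] O k) ⊗[k] L) := by
    apply AlgHom.ext
    intro x
    simp [m, Algebra.TensorProduct.one_def]
  rw [e', e, comp_ev, comp_ev, map_mul, map_mul, map_inv, mapPt_mapPt, mapPt_mapPt, x₁, x₂,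
    mapPt_mapPt, mapPt_mapPt, h1, h2, h3, h4, ← mapPt_mapPt, e, mapPt_ev_gen, ← mapPt_mapPt _ m,
    e', mapPt_ev_gen, map_mul, map_mul, map_inv, x₁, x₂, mapPt_mapPt, mapPt_mapPt, mapPt_mapPt,
    mapPt_mapPt, h5, h6, mul_assoc]

/-- The average `g ↦ φ(f(g h))` of the right translates of a regular function, for a point
`h ∈ SL₂(L)` and a linear form `φ` on `L`. -/
noncomputable def average (h : SpecialLinearGroup (Fin 2) L) (φ : L →ₗ[k] k) :
    (regular k).toComod ⟶ (regular k).toComod :=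
  mkHom (X := (regular k).toComod) (Y := (regular k).toComod)
    ((TensorProduct.rid k (O k)).toLinearMap ∘ₗ LinearMap.lTensor (O k) φ ∘ₗ
      (rightTranslate h).toLinearMap) (by
    apply LinearMap.ext
    intro f
    have key := AlgHom.congr_fun (leftRegular_rightTranslate (k := k) h) f
    simp only [AlgHom.comp_apply] at key
    change leftRegular k (TensorProduct.rid k (O k) (LinearMap.lTensor (O k) φ
      (rightTranslate h f))) = LinearMap.rTensor (O k) ((TensorProduct.rid k (O k)).toLinearMap ∘ₗ
        LinearMap.lTensor (O k) φ ∘ₗ (rightTranslate h).toLinearMap) (leftRegular k f)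
    have h1 : ∀ t : O k ⊗[k] L, leftRegular k (TensorProduct.rid k (O k)
        (LinearMap.lTensor (O k) φ t)) = TensorProduct.rid k (O k ⊗[k] O k)
        (LinearMap.lTensor (O k ⊗[k] O k) φ
          (Algebra.TensorProduct.map (leftRegular k) (AlgHom.id k L) t)) := by
      intro t
      induction t with
      | zero => simp
      | add a b ha hb => simp only [map_add, ha, hb]
      | tmul a b => simp
    have h2 : ∀ t : O k ⊗[k] O k, LinearMap.rTensor (O k)
        ((TensorProduct.rid k (O k)).toLinearMap ∘ₗ
        LinearMap.lTensor (O k) φ ∘ₗ (rightTranslate h).toLinearMap) t =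
        TensorProduct.rid k (O k ⊗[k] O k) (LinearMap.lTensor (O k ⊗[k] O k) φ
          (swapRight k (O k) L (O k)
            (Algebra.TensorProduct.map (rightTranslate h) (AlgHom.id k (O k)) t))) := by
      intro t
      induction t with
      | zero => simp
      | add a b ha hb => simp only [map_add, ha, hb]
      | tmul a b =>
        simp only [LinearMap.rTensor_tmul, LinearMap.comp_apply, AlgHom.toLinearMap_apply,
          Algebra.TensorProduct.map_tmul, AlgHom.id_apply, LinearEquiv.coe_coe]
        generalize rightTranslate h a = t
        induction t with
        | zero => simp
        | add a b ha hb => simp only [map_add, TensorProduct.add_tmul, ha, hb]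
        | tmul a b => simp [TensorProduct.smul_tmul']
    rw [h1, h2, key])

theorem average_apply (h : SpecialLinearGroup (Fin 2) L) (φ : L →ₗ[k] k) (f : O k) :
    lin (average h φ) f =
      TensorProduct.rid k (O k) (LinearMap.lTensor (O k) φ (rightTranslate h f)) := rfl

theorem rightTranslate_gen (h : SpecialLinearGroup (Fin 2) L) (i j : Fin 2) :
    rightTranslate h (gen k i j) = gen k i 0 ⊗ₜ h 0 j + gen k i 1 ⊗ₜ h 1 j := by
  rw [rightTranslate, ev_gen_apply, mul_apply_fin_two]
  simp

/-- Functions invariant under a subgroup are fixed by right translation by its points. -/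
theorem rightTranslate_of_mem {Γ : SubgroupFunctor k} {f : O k} (hf : f ∈ rightInvariants k Γ)
    {h : SpecialLinearGroup (Fin 2) L} (hh : h ∈ Γ.pts L) : rightTranslate h f = f ⊗ₜ 1 := by
  refine (hf (O k ⊗[k] L) _ _ (Γ.map_mem _ hh)).trans ?_
  have : ev (mapPt (Algebra.TensorProduct.includeLeft : O k →ₐ[k] O k ⊗[k] L) (gen k)) =
      (Algebra.TensorProduct.includeLeft : O k →ₐ[k] O k ⊗[k] L) := by
    apply algHom_ext
    rw [mapPt_ev_gen]
  rw [this]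
  rfl

/-- With φ 1 = 1 the average fixes functions invariant under Γ. It is applied to a generic point of
T and to the Weyl element. -/
theorem average_of_mem {Γ : SubgroupFunctor k} {f : O k} (hf : f ∈ rightInvariants k Γ)
    {h : SpecialLinearGroup (Fin 2) L} (hh : h ∈ Γ.pts L) (φ : L →ₗ[k] k) :
    lin (average h φ) f = φ 1 • f := by
  rw [average_apply, rightTranslate_of_mem hf hh]
  simp

end Average

end SL2

namespace SL2

open Matrix Comod

variable {k : Type u} [Field k]

/-! ### The algebras `k[G/T]` and `k[G/N]` -/

theorem mem_T {R : Type u} [CommRing R] [Algebra k R] {h : SpecialLinearGroup (Fin 2) R} :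
    h ∈ (T k).pts R ↔ h 0 1 = 0 ∧ h 1 0 = 0 := Iff.rfl

/-- The point `diag(T, T⁻¹)` of the torus. -/
noncomputable def torusPt (R : Type u) [CommRing R] :
    SpecialLinearGroup (Fin 2) (LaurentPolynomial R) :=
  ⟨!![LaurentPolynomial.T 1, 0; 0, LaurentPolynomial.T (-1)], by
    rw [Matrix.det_fin_two_of, ← LaurentPolynomial.T_add]
    simp⟩

theorem torusPt_mem (R : Type u) [CommRing R] [Algebra k R] :
    torusPt R ∈ (T k).pts (LaurentPolynomial R) := ⟨rfl, rfl⟩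

/-- The constant coefficient of a Laurent polynomial. -/
noncomputable def constCoeff (k : Type u) [Field k] : LaurentPolynomial k →ₗ[k] k :=
  Finsupp.lapply 0 ∘ₗ (AddMonoidAlgebra.coeffLinearEquiv k).toLinearMap

theorem constCoeff_T (n : ℤ) : constCoeff k (LaurentPolynomial.T n) = if n = 0 then 1 else 0 :=
  LaurentPolynomial.T_apply 0 n

/-- The projection of `k[G]` onto the functions of weight zero for the right action of `T`. -/
noncomputable def weightZero (k : Type u) [Field k] : (regular k).toComod ⟶ (regular k).toComod :=
  average (torusPt k) (constCoeff k)

theorem weightZero_of_mem {f : O k} (hf : f ∈ rightInvariants k (T k)) :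
    lin (weightZero k) f = f := by
  rw [weightZero, average_of_mem hf (torusPt_mem k), ← LaurentPolynomial.T_zero, constCoeff_T]
  simp

/-- Under right translation by diag(T, T⁻¹), the first column (a, c) has weight 1 and the second
column (b, d) has weight -1; the constant coefficient keeps weight zero. -/
theorem weightZero_monomial (i j l n : ℕ) : lin (weightZero k)
    (gen k 0 0 ^ i * gen k 0 1 ^ j * (gen k 1 0 ^ l * gen k 1 1 ^ n) : O k) =
    if i + l = j + n then gen k 0 0 ^ i * gen k 0 1 ^ j * (gen k 1 0 ^ l * gen k 1 1 ^ n)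
      else 0 := by
  have h0 : ∀ i, rightTranslate (torusPt k) (gen k i 0) =
      gen k i 0 ⊗ₜ LaurentPolynomial.T 1 := by
    intro i
    rw [rightTranslate_gen]
    simp [torusPt]
  have h1 : ∀ i, rightTranslate (torusPt k) (gen k i 1) =
      gen k i 1 ⊗ₜ LaurentPolynomial.T (-1) := by
    intro i
    rw [rightTranslate_gen]
    simp [torusPt]
  rw [weightZero, average_apply]
  simp only [map_mul, map_pow, h0, h1, Algebra.TensorProduct.tmul_pow,
    Algebra.TensorProduct.tmul_mul_tmul, LaurentPolynomial.T_pow, ← LaurentPolynomial.T_add,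
    LinearMap.lTensor_tmul, TensorProduct.rid_tmul, constCoeff_T]
  have : ((i : ℤ) * 1 + j * (-1) + (l * 1 + n * (-1)) = 0) ↔ i + l = j + n := by omega
  simp only [this]
  split_ifs <;> simp

/-- The function `ab`. -/
noncomputable def u (k : Type u) [Field k] : O k := gen k 0 0 * gen k 0 1

/-- The function `cd`. -/
noncomputable def v (k : Type u) [Field k] : O k := gen k 1 0 * gen k 1 1

/-- The function `ad`. -/
noncomputable def w (k : Type u) [Field k] : O k := gen k 0 0 * gen k 1 1

theorem bc_eq : gen k 0 1 * gen k 1 0 = w k - 1 := by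
  rw [w]
  linear_combination -det_gen (k := k)

/-- ad(ad - 1) = ad · bc = ab · cd. This is what closes B + Bw under multiplication. -/
theorem w_mul_w : w k * w k = w k + u k * v k := by
  have h := det_gen (k := k)
  simp only [u, v, w]
  linear_combination gen k 0 0 * gen k 1 1 * h

/-- The algebra generated by `ab` and `cd`. -/
noncomputable def B₀ (k : Type u) [Field k] : Subalgebra k (O k) := Algebra.adjoin k {u k, v k}

theorem u_mem : u k ∈ B₀ k := Algebra.subset_adjoin (by simp)

theorem v_mem : v k ∈ B₀ k := Algebra.subset_adjoin (by simp)

/-- The algebra `k[ab, cd] + k[ab, cd] ad`. -/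
noncomputable def A₀ (k : Type u) [Field k] : Subalgebra k (O k) where
  carrier := {f | ∃ x ∈ B₀ k, ∃ y ∈ B₀ k, f = x + y * w k}
  mul_mem' := by
    rintro _ _ ⟨x, hx, y, hy, rfl⟩ ⟨x', hx', y', hy', rfl⟩
    refine ⟨x * x' + y * y' * (u k * v k), ?_, x * y' + y * x' + y * y', ?_, ?_⟩
    · exact add_mem (mul_mem hx hx') (mul_mem (mul_mem hy hy') (mul_mem u_mem v_mem))
    · exact add_mem (add_mem (mul_mem hx hy') (mul_mem hy hx')) (mul_mem hy hy')
    · linear_combination y * y' * w_mul_w (k := k)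
  add_mem' := by
    rintro _ _ ⟨x, hx, y, hy, rfl⟩ ⟨x', hx', y', hy', rfl⟩
    exact ⟨x + x', add_mem hx hx', y + y', add_mem hy hy', by ring⟩
  algebraMap_mem' c := ⟨_, (B₀ k).algebraMap_mem c, 0, zero_mem _, by simp⟩

theorem B₀_le_A₀ : B₀ k ≤ A₀ k := fun x hx => ⟨x, hx, 0, zero_mem _, by simp⟩

theorem w_mem : w k ∈ A₀ k := ⟨0, zero_mem _, 1, one_mem _, by simp⟩

/-- Weight zero lets each factor a be paired with some b or d, which splits off u or w. Once no a is
left, the monomial is a product of powers of bc = w - 1 and v. -/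
theorem monomial_mem (i : ℕ) : ∀ j l n : ℕ, i + l = j + n →
    gen k 0 0 ^ i * gen k 0 1 ^ j * (gen k 1 0 ^ l * gen k 1 1 ^ n) ∈ A₀ k := by
  have hbc : gen k 0 1 * gen k 1 0 ∈ A₀ k := by
    rw [bc_eq]
    exact sub_mem w_mem (one_mem _)
  induction i with
  | zero =>
    intro j l n h
    obtain rfl : l = j + n := by omega
    have : gen k 0 0 ^ 0 * gen k 0 1 ^ j * (gen k 1 0 ^ (j + n) * gen k 1 1 ^ n) =
      (gen k 0 1 * gen k 1 0) ^ j * v k ^ n := by rw [v]; ring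
    rw [this]
    exact mul_mem (pow_mem hbc _) (pow_mem (B₀_le_A₀ v_mem) _)
  | succ i ih =>
    intro j l n h
    cases j with
    | succ j =>
      have : gen k 0 0 ^ (i + 1) * gen k 0 1 ^ (j + 1) * (gen k 1 0 ^ l * gen k 1 1 ^ n) =
        u k * (gen k 0 0 ^ i * gen k 0 1 ^ j * (gen k 1 0 ^ l * gen k 1 1 ^ n)) := by rw [u]; ring
      rw [this]
      exact mul_mem (B₀_le_A₀ u_mem) (ih j l n (by omega))
    | zero =>
      obtain ⟨n, rfl⟩ : ∃ m, n = m + 1 := ⟨n - 1, by omega⟩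
      have : gen k 0 0 ^ (i + 1) * gen k 0 1 ^ 0 * (gen k 1 0 ^ l * gen k 1 1 ^ (n + 1)) =
        w k * (gen k 0 0 ^ i * gen k 0 1 ^ 0 * (gen k 1 0 ^ l * gen k 1 1 ^ n)) := by rw [w]; ring
      rw [this]
      exact mul_mem w_mem (ih 0 l n (by omega))

theorem weightZero_mem_A₀ (f : O k) : lin (weightZero k) f ∈ A₀ k := by
  refine span_monomials ((Subalgebra.toSubmodule (A₀ k)).comap (lin (weightZero k))) ?_ f
  intro i j l n
  rw [Submodule.mem_comap, weightZero_monomial]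
  split_ifs with h
  · exact monomial_mem i j l n h
  · exact zero_mem _

section Points

variable {R : Type u} [CommRing R] [Algebra k R]

theorem ev_u (g : SpecialLinearGroup (Fin 2) R) : ev g (u k) = g 0 0 * g 0 1 := by
  rw [u, map_mul, ev_gen_apply, ev_gen_apply]

theorem ev_v (g : SpecialLinearGroup (Fin 2) R) : ev g (v k) = g 1 0 * g 1 1 := by
  rw [v, map_mul, ev_gen_apply, ev_gen_apply]

theorem ev_w (g : SpecialLinearGroup (Fin 2) R) : ev g (w k) = g 0 0 * g 1 1 := by
  rw [w, map_mul, ev_gen_apply, ev_gen_apply]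

/-- A point of the normalizer of the torus is monomial. -/
theorem mul_eq_zero_of_mem_N {h : SpecialLinearGroup (Fin 2) R} (hh : h ∈ (N k).pts R) :
    h 0 0 * h 0 1 = 0 ∧ h 1 0 * h 1 1 = 0 := by
  let f : R →ₐ[k] LaurentPolynomial R := IsScalarTower.toAlgHom k R _
  have hf : ∀ x, f x = LaurentPolynomial.C x := fun x => rfl
  have h1 := ((Subgroup.mem_normalizer_iff.1 (hh (LaurentPolynomial R) f)) (torusPt R)).1
    (torusPt_mem (k := k) R)
  have h2 := mem_T.1 h1
  -- For h = (p q; r s), the off-diagonal entries of h diag(T, T⁻¹) h⁻¹ are pq(T⁻¹ - T) and, with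
  -- the opposite sign, rs(T - T⁻¹). The coefficient of T⁻¹ detects pq and rs.
  have hc : ∀ x : R, LaurentPolynomial.C x * LaurentPolynomial.T (-1) -
      LaurentPolynomial.C x * LaurentPolynomial.T 1 = 0 → x = 0 := by
    intro x hx
    have := congrArg (fun p => AddMonoidAlgebra.coeff p (-1)) hx
    simpa [← LaurentPolynomial.single_eq_C_mul_T] using this
  constructor
  · apply hc
    refine Eq.trans ?_ h2.1
    rw [mul_apply_fin_two, mul_apply_fin_two, mul_apply_fin_two, SpecialLinearGroup.SL2_inv_expl]
    simp [hf, torusPt]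
    ring
  · apply hc
    refine Eq.trans ?_ (neg_eq_zero.2 h2.2)
    rw [mul_apply_fin_two, mul_apply_fin_two, mul_apply_fin_two, SpecialLinearGroup.SL2_inv_expl]
    simp [hf, torusPt]
    ring

end Points

theorem charTwo [CharP k 2] (R : Type*) [CommRing R] [Algebra k R] : (2 : R) = 0 := by
  have h : (2 : k) = 0 := CharTwo.two_eq_zero
  rw [← map_ofNat (algebraMap k R), h, map_zero]

/-- For h = (p q; r s) the translate of ab is a²pq + b²rs + ab(ps + qr). The first two terms vanish
for h in N, and ps + qr = det h because 2 = 0. -/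
theorem u_mem_N [CharP k 2] : u k ∈ rightInvariants k (N k) := by
  intro R _ _ g h hh
  obtain ⟨h1, h2⟩ := mul_eq_zero_of_mem_N hh
  have h3 := h.2
  rw [Matrix.det_fin_two] at h3
  rw [ev_u, ev_u, mul_apply_fin_two, mul_apply_fin_two]
  linear_combination g 0 0 * g 0 0 * h1 + g 0 1 * g 0 1 * h2 + g 0 0 * g 0 1 * h3 +
    g 0 0 * g 0 1 * h 0 1 * h 1 0 * charTwo (k := k) R

theorem v_mem_N [CharP k 2] : v k ∈ rightInvariants k (N k) := by
  intro R _ _ g h hh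
  obtain ⟨h1, h2⟩ := mul_eq_zero_of_mem_N hh
  have h3 := h.2
  rw [Matrix.det_fin_two] at h3
  rw [ev_v, ev_v, mul_apply_fin_two, mul_apply_fin_two]
  linear_combination g 1 0 * g 1 0 * h1 + g 1 1 * g 1 1 * h2 + g 1 0 * g 1 1 * h3 +
    g 1 0 * g 1 1 * h 0 1 * h 1 0 * charTwo (k := k) R

theorem B₀_le_N [CharP k 2] : B₀ k ≤ rightInvariants k (N k) := by
  rw [B₀, Algebra.adjoin_le_iff]
  rintro _ (rfl | rfl)
  · exact u_mem_N
  · exact v_mem_N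

theorem w_mem_T : w k ∈ rightInvariants k (T k) := by
  intro R _ _ g h hh
  obtain ⟨h1, h2⟩ := mem_T.1 hh
  have h3 := h.2
  rw [Matrix.det_fin_two] at h3
  rw [ev_w, ev_w, mul_apply_fin_two, mul_apply_fin_two, h1, h2]
  linear_combination g 0 0 * g 1 1 * h3 + g 0 0 * g 1 1 * h 0 1 * h2

/-- A T-invariant function equals its weight-zero part, a combination of weight-zero monomials. -/
theorem A₀_eq [CharP k 2] : A₀ k = rightInvariants k (T k) := by
  apply le_antisymm
  · rintro _ ⟨x, hx, y, hy, rfl⟩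
    exact add_mem (rightInvariants_N_le_T (B₀_le_N hx))
      (mul_mem (rightInvariants_N_le_T (B₀_le_N hy)) w_mem_T)
  · intro f hf
    rw [← weightZero_of_mem hf]
    exact weightZero_mem_A₀ f

/-- The nontrivial element of the Weyl group. -/
def weyl (R : Type u) [CommRing R] : SpecialLinearGroup (Fin 2) R :=
  ⟨!![0, 1; -1, 0], by simp [Matrix.det_fin_two_of]⟩

theorem weyl_mem (R : Type u) [CommRing R] [Algebra k R] : weyl R ∈ (N k).pts R := by
  intro S _ _ f
  have hS : mapPt f (weyl R) = weyl S := by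
    ext i j
    change f (weyl R i j) = weyl S i j
    fin_cases i <;> fin_cases j <;> simp [weyl]
  rw [Subgroup.mem_normalizer_iff, hS]
  intro h
  rw [mem_T, mem_T]
  rw [mul_apply_fin_two, mul_apply_fin_two, mul_apply_fin_two, mul_apply_fin_two,
    mul_apply_fin_two, mul_apply_fin_two, SpecialLinearGroup.SL2_inv_expl]
  simp [weyl, and_comm]

/-- Right translation by the nontrivial element of the Weyl group. -/
noncomputable def flip (k : Type u) [Field k] : (regular k).toComod ⟶ (regular k).toComod :=
  average (weyl k) LinearMap.id

theorem flip_of_mem {f : O k} (hf : f ∈ rightInvariants k (N k)) : lin (flip k) f = f := by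
  rw [flip, average_of_mem hf (weyl_mem k)]
  simp

theorem flip_mul (f g : O k) : lin (flip k) (f * g : O k) =
    (lin (flip k) f * lin (flip k) g : O k) := by
  rw [flip, average_apply, average_apply, average_apply, map_mul, LinearMap.lTensor_id]
  exact map_mul (Algebra.TensorProduct.rid k k (O k)) _ _

/-- Right multiplication by (0 1; -1 0) sends a to -b and d to c, so ad goes to -bc. -/
theorem flip_w : lin (flip k) (w k) = (1 - w k : O k) := by
  have h := det_gen (k := k)
  have h0 : ∀ i, rightTranslate (weyl k) (gen k i 0) = gen k i 1 ⊗ₜ (-1) := by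
    intro i
    rw [rightTranslate_gen]
    simp [weyl]
  have h1 : ∀ i, rightTranslate (weyl k) (gen k i 1) = gen k i 0 ⊗ₜ 1 := by
    intro i
    rw [rightTranslate_gen]
    simp [weyl]
  rw [flip, average_apply, w, map_mul, h0, h1, LinearMap.lTensor_id]
  simp only [Algebra.TensorProduct.tmul_mul_tmul, LinearMap.id_apply, TensorProduct.rid_tmul]
  rw [mul_one, neg_smul, one_smul]
  linear_combination h

/-- The difference of the two right translations by the Weyl group. -/
noncomputable def diff (k : Type u) [Field k] : (regular k).toComod ⟶ (regular k).toComod :=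
  -- A sum can be taken because signs do not matter in characteristic 2; on x + yw it gives 2x + y.
  flip k + 𝟙 _

theorem diff_apply [CharP k 2] (x : O k) (hx : x ∈ B₀ k) (y : O k) (hy : y ∈ B₀ k) :
    lin (diff k) (x + y * w k : O k) = y := by
  change lin (flip k) (x + y * w k : O k) + (x + y * w k : O k) = y
  rw [map_add, flip_mul, flip_of_mem (B₀_le_N hx), flip_of_mem (B₀_le_N hy), flip_w]
  change x + y * (1 - w k) + (x + y * w k) = y
  linear_combination x * charTwo (k := k) (O k)

/-- Write an N-invariant function as x + yw. Its Weyl translate is itself, so `diff` gives 2(x + yw)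
= 0, while `diff_apply` gives y; hence y = 0. -/
theorem B₀_eq [CharP k 2] : B₀ k = rightInvariants k (N k) := by
  refine le_antisymm B₀_le_N ?_
  intro f hf
  obtain ⟨x, hx, y, hy, rfl⟩ := A₀_eq.ge (rightInvariants_N_le_T hf)
  have h := diff_apply x hx y hy
  have h1 : lin (diff k) (x + y * w k : O k) = (0 : O k) := by
    change lin (flip k) (x + y * w k : O k) + (x + y * w k : O k) = (0 : O k)
    rw [flip_of_mem hf]
    change (x + y * w k : O k) + (x + y * w k : O k) = 0
    linear_combination (x + y * w k) * charTwo (k := k) (O k)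
  rw [h1] at h
  rw [← h, zero_mul, add_zero]
  exact hx

end SL2

/-- A homomorphism `A → B` of comodule algebras makes `B` a module over `A`. -/
noncomputable def ComodAlg.action {k C : Type u} [Field k] [CommRing C] [Bialgebra k C]
    (A B : ComodAlg k C) (j : A.A →ₐ[k] B.A)
    (hj : B.ρ.toLinearMap ∘ₗ j.toLinearMap =
      LinearMap.rTensor C j.toLinearMap ∘ₗ A.ρ.toLinearMap) :
    Comod.tensor B.toComod A.toComod ⟶ B.toComod :=
  Comod.mkHom (X := Comod.tensor B.toComod A.toComod) (Y := B.toComod)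
    (LinearMap.mul' k B.A ∘ₗ LinearMap.lTensor B.A j.toLinearMap) (by
    apply TensorProduct.ext'
    intro f x
    have h1 := LinearMap.congr_fun hj x
    refine Eq.trans ?_ (congrArg (LinearMap.rTensor C (LinearMap.mul' k B.A ∘ₗ
      LinearMap.lTensor B.A j.toLinearMap)) (Comod.tensor_ρ_tmul B.toComod A.toComod f x).symm)
    change B.ρ (f * j x) = LinearMap.rTensor C _ (Comod.tensorMul B.A A.A C (B.ρ f) (A.ρ x))
    change B.ρ (j x) = LinearMap.rTensor C j.toLinearMap (A.ρ x) at h1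
    rw [map_mul, h1]
    generalize B.ρ f = s
    generalize A.ρ x = t
    induction s with
    | zero => simp
    | add a b ha hb => simp only [map_add, add_mul, LinearMap.add_apply, ha, hb]
    | tmul x c =>
      induction t with
      | zero => simp
      | add a b ha hb => simp only [map_add, mul_add, ha, hb]
      | tmul y d => simp)

namespace SL2

open Matrix Comod

variable {k : Type u} [Field k]

/-! ### The extension -/

/-- The inclusion `k[G/H] → k[G]`. -/
noncomputable def homogeneousι (Γ : SubgroupFunctor k) :
    (homogeneous Γ).toComod ⟶ (regular k).toComod :=
  mkHom (X := (homogeneous Γ).toComod) (Y := (regular k).toComod)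
    (Subalgebra.toSubmodule (rightInvariants k Γ)).subtype
    (LinearMap.ext fun f =>
      (ComodAlg.sub_aux (regular k) (rightInvariants k Γ) (rightInvariants_stable Γ) f).symm)

theorem homogeneousι_injective (Γ : SubgroupFunctor k) :
    Function.Injective (lin (homogeneousι Γ)) := Subtype.val_injective

theorem mem_range_homogeneousι (Γ : SubgroupFunctor k) {f : O k}
    (hf : f ∈ rightInvariants k Γ) : f ∈ LinearMap.range (lin (homogeneousι Γ)) := ⟨⟨f, hf⟩, rfl⟩

/-- The `G`-invariant functions on `G` are constant. -/
theorem eq_algebraMap_of_invariant {f : O k} (hf : leftRegular k f = f ⊗ₜ 1) :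
    f = algebraMap k (O k) (Coalgebra.counit (R := k) f) := by
  have h1 := counit_leftRegular f
  rw [hf] at h1
  have h2 : inv k f = algebraMap k (O k) (Coalgebra.counit (R := k) f) := by
    rw [← h1]
    simp [Algebra.algebraMap_eq_smul_one]
  rw [← inv_inv_apply f, h2, AlgHom.commutes]
  congr 1
  exact ((Bialgebra.counitAlgHom k (O k)).commutes _).symm

/-- Inside k[G] the image of 1 is fixed by all left translations, hence constant. -/
theorem exists_eq_algebraMap (Γ : SubgroupFunctor k)
    (g : triv k (O k) ⟶ (homogeneous Γ).toComod) : ∃ c : k, g = c • (homogeneous Γ).unit := by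
  have h1 := comm_apply (g ≫ homogeneousι Γ) (1 : k)
  obtain ⟨f, hf⟩ : ∃ f : O k, lin (g ≫ homogeneousι Γ) (1 : k) = f := ⟨_, rfl⟩
  have h2 : leftRegular k f = f ⊗ₜ 1 := by
    rw [← hf]
    refine h1.trans ?_
    exact LinearMap.rTensor_tmul _ _ _ _
  refine ⟨Coalgebra.counit (R := k) f, hom_ext (LinearMap.ext_ring (R := k) ?_)⟩
  apply homogeneousι_injective Γ
  refine hf.trans ((eq_algebraMap_of_invariant h2).trans ?_)
  rw [Algebra.algebraMap_eq_smul_one]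
  change _ = Coalgebra.counit (R := k) f • (algebraMap k (O k) 1)
  rw [map_one]

theorem exists_retraction [CharP k 2] : ∃ r : (regular k).toComod ⟶ (homogeneous (T k)).toComod,
    r ≫ homogeneousι (T k) = weightZero k := by
  apply exists_lift _ (homogeneousι_injective _)
  rintro _ ⟨f, rfl⟩
  exact mem_range_homogeneousι (T k) (A₀_eq.le (weightZero_mem_A₀ f))

/-- `k[G/T]` is a retract of `k[G]`. -/
noncomputable def retractT [CharP k 2] : Retract (homogeneous (T k)).toComod (regular k).toComod where
  i := homogeneousι (T k)
  r := exists_retraction.choose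
  retract := by
    have := mono_of_injective _ (homogeneousι_injective (T k))
    rw [← cancel_mono (homogeneousι (T k)), Category.assoc, exists_retraction.choose_spec,
      Category.id_comp]
    exact hom_ext (LinearMap.ext fun f => weightZero_of_mem f.2)

instance [CharP k 2] : Injective (homogeneous (T k)).toComod := (retractT (k := k)).injective

/-- On k[G/T] = B + Bw the map `diff` reads off the coefficient of w, so it lands in B = k[G/N]. -/
theorem exists_transfer [CharP k 2] :
    ∃ p : (homogeneous (T k)).toComod ⟶ (homogeneous (N k)).toComod,
      p ≫ homogeneousι (N k) = homogeneousι (T k) ≫ diff k := by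
  apply exists_lift _ (homogeneousι_injective _)
  rintro _ ⟨f, rfl⟩
  obtain ⟨x, hx, y, hy, hf⟩ := A₀_eq.ge f.2
  apply mem_range_homogeneousι
  have h : lin (homogeneousι (T k) ≫ diff k) f = y := by
    rw [← diff_apply x hx y hy, ← hf]
    rfl
  rw [h]
  exact B₀_eq.le hy

/-- The morphism `k[G/T] → k[G/N]` that maps `x + y ad` to `y` for `x, y ∈ k[G/N]`. -/
noncomputable def transfer (k : Type u) [Field k] [CharP k 2] :
    (homogeneous (T k)).toComod ⟶ (homogeneous (N k)).toComod := (exists_transfer (k := k)).choose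

theorem transfer_coe [CharP k 2] (f : (homogeneous (T k)).A) :
    ((lin (transfer k) f : (homogeneous (N k)).A) : O k) = lin (diff k) (f : O k) :=
  LinearMap.congr_fun (congrArg lin (exists_transfer (k := k)).choose_spec) f

/-- All properties of p are computed from this formula. It also shows that the coefficient y in x +
yw is unique. -/
theorem transfer_eq [CharP k 2] (f : (homogeneous (T k)).A) (x y : (homogeneous (N k)).A)
    (hf : (f : O k) = x + y * w k) : lin (transfer k) f = y := by
  apply Subtype.ext
  rw [transfer_coe, hf]
  exact diff_apply _ (B₀_eq.ge x.2) _ (B₀_eq.ge y.2)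

theorem exists_decomposition [CharP k 2] (f : (homogeneous (T k)).A) :
    ∃ x y : (homogeneous (N k)).A, (f : O k) = x + y * w k := by
  obtain ⟨x, hx, y, hy, hf⟩ := A₀_eq.ge f.2
  exact ⟨⟨x, B₀_eq.le hx⟩, ⟨y, B₀_eq.le hy⟩, hf⟩

theorem incl_transfer [CharP k 2] : incl k ≫ transfer k = 0 := by
  apply hom_ext
  apply LinearMap.ext
  intro x
  exact transfer_eq (inclAlg k x) x 0 (by
    change (x : O k) = x + 0 * w k
    rw [zero_mul, add_zero])

/-- The element `ad` of `k[G/T]`. -/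
noncomputable def wT (k : Type u) [Field k] : (homogeneous (T k)).A := ⟨w k, w_mem_T⟩

theorem transfer_incl_mul_wT [CharP k 2] (x : (homogeneous (N k)).A) :
    lin (transfer k) (inclAlg k x * wT k : (homogeneous (T k)).A) = x :=
  transfer_eq _ 0 x (by
    change (x : O k) * w k = 0 + x * w k
    rw [zero_add])

/-- Surjectivity: xw maps to x. Exactness in the middle: if p(x + yw) = y is zero, the function is
x. -/
theorem transfer_shortExact [CharP k 2] :
    (ShortComplex.mk (incl k) (transfer k) incl_transfer).ShortExact := by
  rw [shortExact_iff]
  refine ⟨fun x y h => homogeneousι_injective (N k) (congrArg (lin (homogeneousι (T k))) h),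
    fun x => ⟨_, transfer_incl_mul_wT x⟩, ?_⟩
  intro f hf
  obtain ⟨x, y, h⟩ := exists_decomposition f
  have hy : y = 0 := (transfer_eq f x y h).symm.trans hf
  refine ⟨x, Subtype.ext ?_⟩
  rw [h, hy]
  change (x : O k) = x + 0 * w k
  rw [zero_mul, add_zero]

theorem transfer_mul [CharP k 2] (x : (homogeneous (N k)).A) (f : (homogeneous (T k)).A) :
    lin (transfer k) (inclAlg k x * f : (homogeneous (T k)).A) =
      (x * lin (transfer k) f : (homogeneous (N k)).A) := by
  obtain ⟨y, z, h⟩ := exists_decomposition f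
  rw [transfer_eq f y z h]
  apply transfer_eq _ (x * y)
  change (x : O k) * (f : O k) = (x : O k) * y + x * z * w k
  rw [h]
  ring

theorem transfer_wT [CharP k 2] : lin (transfer k) (wT k) = (1 : (homogeneous (N k)).A) :=
  transfer_eq _ 0 1 (by
    change w k = 0 + 1 * w k
    rw [zero_add, one_mul])

/-! ### Cohomology of `G` -/

/-- Invariants of k[G/T] are constants, which already lie in k[G/N], the kernel of p. This makes the
connecting map injective in degree 0. -/
theorem unit_comp_transfer [CharP k 2] (g : triv k (O k) ⟶ (homogeneous (T k)).toComod) :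
    g ≫ transfer k = 0 := by
  obtain ⟨c, rfl⟩ := exists_eq_algebraMap (T k) g
  have h : (homogeneous (T k)).unit = (homogeneous (N k)).unit ≫ incl k := rfl
  rw [Linear.smul_comp, h, Category.assoc, incl_transfer, comp_zero, smul_zero]

theorem unit_ne_zero [CharP k 2] : (homogeneous (N k)).unit ≠ 0 := by
  intro h
  have h1 : (1 : O k) = 0 := by
    have h2 : ((lin (homogeneous (N k)).unit (1 : k) : (homogeneous (N k)).A) : O k) = 0 := by
      rw [h]
      rfl
    rw [← h2]
    exact (map_one (algebraMap k (O k))).symm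
  exact one_ne_zero h1

theorem span_H [CharP k 2] (i : ℕ) :
    yonedaPower transfer_shortExact (homogeneous (N k)).unit i ≠ 0 ∧
      ∀ x : (homogeneous (N k)).H i, ∃ c : k,
        x = c • (yonedaPower transfer_shortExact (homogeneous (N k)).unit i :
          (homogeneous (N k)).H i) :=
  span_yonedaPower transfer_shortExact (homogeneous (N k)).unit unit_ne_zero
    (exists_eq_algebraMap (N k)) unit_comp_transfer i

/-- The action of `k[G/N]` on `k[G/T]`. -/
noncomputable def action (k : Type u) [Field k] :
    tensor (homogeneous (T k)).toComod (homogeneous (N k)).toComod ⟶ (homogeneous (T k)).toComod :=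
  ComodAlg.action (homogeneous (N k)) (homogeneous (T k)) (inclAlg k) (comm (incl k))

/-- The two conditions of `cup_yonedaPower` hold because the inclusion is a homomorphism of algebras
and `transfer` is k[G/N]-linear. -/
theorem cup_H [CharP k 2] (i l : ℕ) :
    (homogeneous (N k)).cup i l (yonedaPower transfer_shortExact (homogeneous (N k)).unit i)
      (yonedaPower transfer_shortExact (homogeneous (N k)).unit l) =
      yonedaPower transfer_shortExact (homogeneous (N k)).unit (i + l) := by
  apply cup_yonedaPower (homogeneous (N k)) transfer_shortExact (action k)
  · apply hom_ext
    apply TensorProduct.ext'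
    intro x y
    rfl
  · apply hom_ext
    apply TensorProduct.ext'
    intro f x
    change (lin (transfer k) f * x : (homogeneous (N k)).A) =
      lin (transfer k) (f * inclAlg k x : (homogeneous (T k)).A)
    rw [mul_comm, mul_comm f, transfer_mul]

end SL2

/-- A linear map that vanishes on the kernel of a surjection factors through it. -/
theorem LinearMap.exists_factor {k V W U : Type*} [CommRing k] [AddCommGroup V] [Module k V]
    [AddCommGroup W] [Module k W] [AddCommGroup U] [Module k U] (f : V →ₗ[k] W)
    (hf : Function.Surjective f) (g : V →ₗ[k] U) (h : ∀ x, f x = 0 → g x = 0) :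
    ∃ l : W →ₗ[k] U, ∀ x, l (f x) = g x := by
  refine ⟨(LinearMap.ker f).liftQ g h ∘ₗ (f.quotKerEquivOfSurjective hf).symm.toLinearMap,
    fun x => ?_⟩
  have : (f.quotKerEquivOfSurjective hf).symm (f x) = Submodule.Quotient.mk x := by
    rw [LinearEquiv.symm_apply_eq]; rfl
  rw [LinearMap.comp_apply, LinearEquiv.coe_coe, this]
  rfl

namespace SL2

open Matrix Comod

variable {k : Type u} [Field k]

/-! ### The Cartier operator -/

section Polynomial

variable {ι : Type} [Fintype ι]

open MvPolynomial

variable (k ι) in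
/-- The Cartier operator on polynomials in characteristic two: it maps `∏ xᵢ ^ (2 mᵢ + 1)` to
`∏ xᵢ ^ mᵢ` and the other monomials to zero. -/
noncomputable def polyCartier : MvPolynomial ι k →ₗ[k] MvPolynomial ι k :=
  (basisMonomials ι k).constr k fun e =>
    if ∀ i, Odd (e i) then monomial (e.mapRange (· / 2) (Nat.zero_div 2)) 1 else 0

theorem polyCartier_monomial (e : ι →₀ ℕ) : polyCartier k ι (monomial e 1) =
    if ∀ i, Odd (e i) then monomial (e.mapRange (· / 2) (Nat.zero_div 2)) 1 else 0 :=
  (congrArg (polyCartier k ι) (congrFun (coe_basisMonomials ι k) e).symm).trans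
    (Module.Basis.constr_basis _ _ _ _)

theorem polyCartier_X_sq_mul (i : ι) (f : MvPolynomial ι k) :
    polyCartier k ι (X i ^ 2 * f) = X i * polyCartier k ι f := by
  classical
  induction f using MvPolynomial.induction_on' with
  | add p q hp hq => rw [mul_add, map_add, map_add, mul_add, hp, hq]
  | monomial e a =>
    have ha : monomial e a = a • monomial e (1 : k) := by simp [smul_monomial]
    rw [ha, mul_smul_comm, map_smul, map_smul, mul_smul_comm, X_pow_eq_monomial, monomial_mul,
      mul_one, polyCartier_monomial, polyCartier_monomial]
    -- Raising an exponent by 2 keeps its parity and raises its half by 1.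
    have h1 : (∀ j, Odd ((Finsupp.single i 2 + e : ι →₀ ℕ) j)) ↔ ∀ j, Odd (e j) := by
      refine forall_congr' fun j => ?_
      rw [Finsupp.add_apply, Finsupp.single_apply]
      split_ifs <;> simp only [Nat.odd_iff] <;> omega
    simp only [h1]
    split_ifs with h
    · have he : (Finsupp.single i 2 + e).mapRange (· / 2) (Nat.zero_div 2) =
          Finsupp.single i 1 + e.mapRange (· / 2) (Nat.zero_div 2) := by
        ext j
        rw [Finsupp.mapRange_apply, Finsupp.add_apply, Finsupp.add_apply, Finsupp.mapRange_apply,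
          Finsupp.single_apply, Finsupp.single_apply]
        split_ifs <;> omega
      rw [X, monomial_mul, mul_one, he]
    · rw [mul_zero]

/-- The substitution Xᵢ ↦ Xᵢ² is the k-linear Frobenius, so this operator is k-linear, unlike the
usual inverse-semilinear Cartier operator. -/
theorem polyCartier_expand_mul (x f : MvPolynomial ι k) :
    polyCartier k ι (expand 2 x * f) = x * polyCartier k ι f := by
  induction x using MvPolynomial.induction_on generalizing f with
  | C a => rw [expand_C, ← smul_eq_C_mul, ← smul_eq_C_mul, map_smul]
  | add p q hp hq => rw [map_add, add_mul, map_add, add_mul, hp, hq]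
  | mul_X p i hp => rw [map_mul (expand 2), expand_X, mul_assoc, hp, polyCartier_X_sq_mul, mul_assoc]

end Polynomial

open MvPolynomial in
theorem polyCartier_monomial_fin_two (i j l n : ℕ) :
    polyCartier k (Fin 2 × Fin 2)
      (X (0, 0) ^ i * X (0, 1) ^ j * (X (1, 0) ^ l * X (1, 1) ^ n)) =
    if Odd i ∧ Odd j ∧ Odd l ∧ Odd n then
      X (0, 0) ^ (i / 2) * X (0, 1) ^ (j / 2) * (X (1, 0) ^ (l / 2) * X (1, 1) ^ (n / 2))
    else 0 := by
  let e : Fin 2 × Fin 2 →₀ ℕ := Finsupp.equivFunOnFinite.symm fun p => ![![i, j], ![l, n]] p.1 p.2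
  have h : ∀ e : Fin 2 × Fin 2 →₀ ℕ, monomial e (1 : k) =
      X (0, 0) ^ e (0, 0) * X (0, 1) ^ e (0, 1) * (X (1, 0) ^ e (1, 0) * X (1, 1) ^ e (1, 1)) := by
    intro e
    rw [monomial_eq, Finsupp.prod_fintype _ _ (fun _ => pow_zero _), Fintype.prod_prod_type,
      Fin.prod_univ_two, Fin.prod_univ_two, Fin.prod_univ_two, C_1, one_mul]
  have h1 := polyCartier_monomial (k := k) e
  rw [h, h] at h1
  have h2 : (∀ p, Odd (e p)) ↔ Odd i ∧ Odd j ∧ Odd l ∧ Odd n := by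
    simp [Prod.forall, Fin.forall_fin_two, e, and_assoc]
  simp only [h2] at h1
  exact h1

variable (k) in
/-- The equation of `SL₂`. -/
noncomputable def equation : MvPolynomial (Fin 2 × Fin 2) k :=
  (Matrix.mvPolynomialX (Fin 2) (Fin 2) k).det - 1

open MvPolynomial in
theorem equation_eq :
    equation k = X (0, 0) * X (1, 1) - X (0, 1) * X (1, 0) - 1 := by
  rw [equation, Matrix.det_fin_two]
  rfl

theorem mk_eq_zero {f : MvPolynomial (Fin 2 × Fin 2) k} :
    O.mk k f = 0 ↔ ∃ g, f = equation k * g := by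
  constructor
  · intro h
    have h' : f ∈ Ideal.span {equation k} := Ideal.Quotient.eq_zero_iff_mem.1 h
    obtain ⟨g, hg⟩ := Ideal.mem_span_singleton'.1 h'
    exact ⟨g, by rw [mul_comm]; exact hg.symm⟩
  · rintro ⟨g, rfl⟩
    have h' : equation k * g ∈ Ideal.span {equation k} :=
      Ideal.mem_span_singleton'.2 ⟨g, mul_comm _ _⟩
    exact Ideal.Quotient.eq_zero_iff_mem.2 h'

/-- The equation has coefficients in the prime field, so squaring the variables squares it. -/
theorem expand_equation [CharP k 2] : MvPolynomial.expand 2 (equation k) = equation k * equation k := by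
  rw [equation_eq]
  simp only [map_sub, map_mul, MvPolynomial.expand_X, map_one, ← mul_pow]
  generalize (MvPolynomial.X (0, 0) : MvPolynomial (Fin 2 × Fin 2) k) * MvPolynomial.X (1, 1) = x
  generalize (MvPolynomial.X (0, 1) : MvPolynomial (Fin 2 × Fin 2) k) * MvPolynomial.X (1, 0) = y
  linear_combination (x + x * y - y - y ^ 2 - 1) *
    charTwo (k := k) (MvPolynomial (Fin 2 × Fin 2) k)

/-- Let E be the equation. Multiplying by E = E^(2-1) first makes the operator descend to the
hypersurface: a multiple Eg goes to the image of E²g, which is E times the image of g and so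
vanishes modulo E. -/
theorem exists_cartier [CharP k 2] : ∃ l : O k →ₗ[k] O k, ∀ f,
    l (O.mk k f) = O.mk k (polyCartier k _ (equation k * f)) := by
  refine (O.mk k).toLinearMap.exists_factor Ideal.Quotient.mk_surjective
    ((O.mk k).toLinearMap ∘ₗ polyCartier k _ ∘ₗ LinearMap.mulLeft k (equation k)) ?_
  intro f hf
  obtain ⟨g, rfl⟩ := mk_eq_zero.1 hf
  change O.mk k (polyCartier k _ (equation k * (equation k * g))) = 0
  rw [← mul_assoc, ← expand_equation, polyCartier_expand_mul]
  exact mk_eq_zero.2 ⟨_, rfl⟩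

/-- The Cartier operator on `k[SL₂]`, relative to the invariant volume form. -/
noncomputable def cartier (k : Type u) [Field k] [CharP k 2] : O k →ₗ[k] O k :=
  exists_cartier.choose

theorem cartier_mk [CharP k 2] (f : MvPolynomial (Fin 2 × Fin 2) k) :
    cartier k (O.mk k f) = O.mk k (polyCartier k _ (equation k * f)) :=
  exists_cartier.choose_spec f

theorem mk_X (i j : Fin 2) : O.mk k (MvPolynomial.X (i, j)) = gen k i j := rfl

theorem frob_mk [CharP k 2] (f : MvPolynomial (Fin 2 × Fin 2) k) :
    frob k 1 (O.mk k f) = O.mk k (MvPolynomial.expand 2 f) := by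
  have h : (frob k 1).comp (O.mk k) = (O.mk k).comp (MvPolynomial.expand 2) := by
    apply MvPolynomial.algHom_ext
    rintro ⟨i, j⟩
    rw [AlgHom.comp_apply, AlgHom.comp_apply, MvPolynomial.expand_X, map_pow, mk_X, frob_gen,
      pow_one]
  exact AlgHom.congr_fun h f

theorem cartier_frob_mul [CharP k 2] (x f : O k) :
    cartier k (frob k 1 x * f) = x * cartier k f := by
  obtain ⟨x, rfl⟩ := Ideal.Quotient.mk_surjective x
  obtain ⟨f, rfl⟩ := Ideal.Quotient.mk_surjective f
  change cartier k (frob k 1 (O.mk k x) * O.mk k f) = O.mk k x * cartier k (O.mk k f)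
  rw [frob_mk, ← map_mul, cartier_mk, cartier_mk, mul_left_comm, polyCartier_expand_mul, map_mul]

/-- The three terms come from multiplying the monomial by ad, -bc and -1; each survives only if all
four exponents are odd. -/
theorem cartier_monomial [CharP k 2] (i j l n : ℕ) : cartier k
    (gen k 0 0 ^ i * gen k 0 1 ^ j * (gen k 1 0 ^ l * gen k 1 1 ^ n)) =
    (if Odd (i + 1) ∧ Odd j ∧ Odd l ∧ Odd (n + 1) then
      gen k 0 0 ^ ((i + 1) / 2) * gen k 0 1 ^ (j / 2) *
        (gen k 1 0 ^ (l / 2) * gen k 1 1 ^ ((n + 1) / 2)) else 0) -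
    (if Odd i ∧ Odd (j + 1) ∧ Odd (l + 1) ∧ Odd n then
      gen k 0 0 ^ (i / 2) * gen k 0 1 ^ ((j + 1) / 2) *
        (gen k 1 0 ^ ((l + 1) / 2) * gen k 1 1 ^ (n / 2)) else 0) -
    (if Odd i ∧ Odd j ∧ Odd l ∧ Odd n then
      gen k 0 0 ^ (i / 2) * gen k 0 1 ^ (j / 2) *
        (gen k 1 0 ^ (l / 2) * gen k 1 1 ^ (n / 2)) else 0) := by
  have h : equation k * (MvPolynomial.X (0, 0) ^ i * MvPolynomial.X (0, 1) ^ j *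
      (MvPolynomial.X (1, 0) ^ l * MvPolynomial.X (1, 1) ^ n)) =
      MvPolynomial.X (0, 0) ^ (i + 1) * MvPolynomial.X (0, 1) ^ j *
        (MvPolynomial.X (1, 0) ^ l * MvPolynomial.X (1, 1) ^ (n + 1)) -
      MvPolynomial.X (0, 0) ^ i * MvPolynomial.X (0, 1) ^ (j + 1) *
        (MvPolynomial.X (1, 0) ^ (l + 1) * MvPolynomial.X (1, 1) ^ n) -
      MvPolynomial.X (0, 0) ^ i * MvPolynomial.X (0, 1) ^ j *
        (MvPolynomial.X (1, 0) ^ l * MvPolynomial.X (1, 1) ^ n) := by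
    rw [equation_eq]
    ring
  simp only [← mk_X, ← map_pow, ← map_mul]
  rw [cartier_mk, h]
  simp only [map_sub, polyCartier_monomial_fin_two, apply_ite (O.mk k), map_zero]

theorem cartier_one [CharP k 2] : cartier k 1 = 0 := by
  have h := cartier_monomial (k := k) 0 0 0 0
  simpa using h

theorem cartier_gen [CharP k 2] (i j : Fin 2) : cartier k (gen k i j) = 0 := by
  have h1 := cartier_monomial (k := k) 1 0 0 0
  have h2 := cartier_monomial (k := k) 0 1 0 0
  have h3 := cartier_monomial (k := k) 0 0 1 0
  have h4 := cartier_monomial (k := k) 0 0 0 1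
  fin_cases i <;> fin_cases j
  · simpa using h1
  · simpa using h2
  · simpa using h3
  · simpa using h4

theorem cartier_gen_sq [CharP k 2] (i j : Fin 2) : cartier k (gen k i j * gen k i j) = 0 := by
  have h := cartier_frob_mul (gen k i j) 1
  rwa [frob_gen, pow_one, pow_two, mul_one, cartier_one, mul_zero] at h

theorem cartier_ad [CharP k 2] : cartier k (gen k 0 0 * gen k 1 1) = 1 := by
  have h := cartier_monomial (k := k) 1 0 0 1
  norm_num [Nat.odd_iff] at h
  rw [h]
  -- In ad(ad - bc - 1) only -abcd has all exponents odd; it contributes -1, which is 1 here.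
  linear_combination (-1) * charTwo (k := k) (O k)

theorem cartier_bc [CharP k 2] : cartier k (gen k 0 1 * gen k 1 0) = 1 := by
  rw [bc_eq, map_sub, cartier_one, sub_zero, w, cartier_ad]

theorem cartier_row [CharP k 2] (i j j' : Fin 2) : cartier k (gen k i j * gen k i j') = 0 := by
  have h1 := cartier_monomial (k := k) 1 1 0 0
  have h2 := cartier_monomial (k := k) 0 0 1 1
  norm_num [Nat.odd_iff] at h1 h2
  fin_cases i <;> fin_cases j <;> fin_cases j'
  · exact cartier_gen_sq _ _
  · exact h1
  · rw [mul_comm]; exact h1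
  · exact cartier_gen_sq _ _
  · exact cartier_gen_sq _ _
  · exact h2
  · rw [mul_comm]; exact h2
  · exact cartier_gen_sq _ _

theorem cartier_col [CharP k 2] (i i' j : Fin 2) : cartier k (gen k i j * gen k i' j) = 0 := by
  have h1 := cartier_monomial (k := k) 1 0 1 0
  have h2 := cartier_monomial (k := k) 0 1 0 1
  norm_num [Nat.odd_iff] at h1 h2
  fin_cases j <;> fin_cases i <;> fin_cases i'
  · exact cartier_gen_sq _ _
  · exact h1
  · rw [mul_comm]; exact h1
  · exact cartier_gen_sq _ _
  · exact cartier_gen_sq _ _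
  · exact h2
  · rw [mul_comm]; exact h2
  · exact cartier_gen_sq _ _

/-- `k[SL₂]` is generated by the products of at most two matrix entries as a module over the image
of the Frobenius endomorphism. -/
theorem span_frob [CharP k 2] (W : Submodule k (O k))
    (hW : ∀ x, ∀ f ∈ W, frob k 1 x * f ∈ W) (h1 : 1 ∈ W) (h2 : ∀ i j, gen k i j ∈ W)
    (h3 : ∀ i j i' j', gen k i j * gen k i' j' ∈ W) (f : O k) : f ∈ W := by
  have hsq : ∀ i j, ∀ f ∈ W, gen k i j ^ 2 * f ∈ W := by
    intro i j f hf
    have := hW (gen k i j) f hf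
    rwa [frob_gen, pow_one] at this
  -- Squares of entries are Frobenius images, so only square-free monomials matter. Those of degree
  -- three or four reduce by ad - bc = 1, for instance abc = a²d - a and abcd = a²d² - ad.
  have hred : ∀ i j l n : ℕ, i < 2 → j < 2 → l < 2 → n < 2 →
      gen k 0 0 ^ i * gen k 0 1 ^ j * (gen k 1 0 ^ l * gen k 1 1 ^ n) ∈ W := by
    have hd := det_gen (k := k)
    have habc : gen k 0 0 * gen k 0 1 * gen k 1 0 ∈ W := by
      have : gen k 0 0 * gen k 0 1 * gen k 1 0 =
          gen k 0 0 ^ 2 * gen k 1 1 - gen k 0 0 := by linear_combination -gen k 0 0 * hd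
      rw [this]
      exact W.sub_mem (hsq _ _ _ (h2 _ _)) (h2 _ _)
    have habd : gen k 0 0 * gen k 0 1 * gen k 1 1 ∈ W := by
      have : gen k 0 0 * gen k 0 1 * gen k 1 1 =
          gen k 0 1 ^ 2 * gen k 1 0 + gen k 0 1 := by linear_combination gen k 0 1 * hd
      rw [this]
      exact W.add_mem (hsq _ _ _ (h2 _ _)) (h2 _ _)
    have hacd : gen k 0 0 * (gen k 1 0 * gen k 1 1) ∈ W := by
      have : gen k 0 0 * (gen k 1 0 * gen k 1 1) =
          gen k 1 0 ^ 2 * gen k 0 1 + gen k 1 0 := by linear_combination gen k 1 0 * hd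
      rw [this]
      exact W.add_mem (hsq _ _ _ (h2 _ _)) (h2 _ _)
    have hbcd : gen k 0 1 * (gen k 1 0 * gen k 1 1) ∈ W := by
      have : gen k 0 1 * (gen k 1 0 * gen k 1 1) =
          gen k 1 1 ^ 2 * gen k 0 0 - gen k 1 1 := by linear_combination -gen k 1 1 * hd
      rw [this]
      exact W.sub_mem (hsq _ _ _ (h2 _ _)) (h2 _ _)
    have habcd : gen k 0 0 * gen k 0 1 * (gen k 1 0 * gen k 1 1) ∈ W := by
      have : gen k 0 0 * gen k 0 1 * (gen k 1 0 * gen k 1 1) =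
          gen k 0 0 ^ 2 * (gen k 1 1 ^ 2 * 1) - gen k 0 0 * gen k 1 1 := by
        linear_combination -gen k 0 0 * gen k 1 1 * hd
      rw [this]
      exact W.sub_mem (hsq _ _ _ (hsq _ _ _ h1)) (h3 _ _ _ _)
    intro i j l n hi hj hl hn
    interval_cases i <;> interval_cases j <;> interval_cases l <;> interval_cases n <;>
      simp only [pow_zero, pow_one, mul_one, one_mul, h1, h2, h3, habc, habd, hacd, hbcd, habcd]
  apply span_monomials
  intro i j l n
  have h := hW (gen k 0 0 ^ (i / 2) * gen k 0 1 ^ (j / 2) *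
    (gen k 1 0 ^ (l / 2) * gen k 1 1 ^ (n / 2))) _
    (hred (i % 2) (j % 2) (l % 2) (n % 2) (Nat.mod_lt _ two_pos) (Nat.mod_lt _ two_pos)
      (Nat.mod_lt _ two_pos) (Nat.mod_lt _ two_pos))
  have e : ∀ (x : O k) (m : ℕ), x ^ m = (x ^ 2) ^ (m / 2) * x ^ (m % 2) := by
    intro x m
    rw [← pow_mul, ← pow_add, Nat.div_add_mod]
  rw [e _ i, e _ j, e _ l, e _ n]
  simp only [map_mul, map_pow, frob_gen, pow_one] at h
  convert h using 1
  ring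

end SL2

/-! ### Equivariance of the Cartier operator and the integral on Frobenius kernels -/

namespace SL2

open Matrix Comod

variable {k : Type u} [Field k]

theorem comul_gen (i j : Fin 2) : Bialgebra.comulAlgHom k (O k) (gen k i j) =
    gen k i 0 ⊗ₜ gen k 0 j + gen k i 1 ⊗ₜ gen k 1 j := by
  rw [comulAlgHom_eq, ev_mul_gen]

variable [CharP k 2]

theorem frob_comp (r s : ℕ) : (frob k r).comp (frob k s) = frob k (r + s) := by
  apply algHom_ext
  ext i j
  change frob k r (frob k s (gen k i j)) = frob k (r + s) (gen k i j)
  rw [frob_gen, frob_gen, map_pow, frob_gen, ← pow_mul, pow_add]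

theorem frob_frob (r s : ℕ) (f : O k) : frob k r (frob k s f) = frob k (r + s) f :=
  AlgHom.congr_fun (frob_comp r s) f

theorem frob_zero : frob k 0 = AlgHom.id k (O k) := by
  apply algHom_ext
  ext i j
  change frob k 0 (gen k i j) = gen k i j
  rw [frob_gen, pow_zero, pow_one]

/-- On quadratic products the operator is the product of the alternating forms in the row and the
column indices, modulo 2. Its translation invariance thus comes down to the determinant being 1. -/
theorem cartier_gen_mul (i i' p q : Fin 2) : cartier k (gen k i p * gen k i' q) =
    if i ≠ i' ∧ p ≠ q then 1 else 0 := by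
  split_ifs with h
  · obtain ⟨h1, h2⟩ := h
    fin_cases i <;> fin_cases i' <;> fin_cases p <;> fin_cases q <;>
      first | exact absurd rfl h1 | exact absurd rfl h2 | skip
    · exact cartier_ad
    · exact cartier_bc
    · rw [mul_comm]; exact cartier_bc
    · rw [mul_comm]; exact cartier_ad
  · by_cases h1 : i = i'
    · subst h1
      exact cartier_row _ _ _
    · have h2 : p = q := by
        by_contra h2
        exact h ⟨h1, h2⟩
      subst h2
      exact cartier_col _ _ _

/-- Both sides of the equivariance identity are therefore semilinear over Frobenius, so module
generators over its image suffice. -/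
theorem rTensor_cartier_mul (y z : O k ⊗[k] O k) : LinearMap.rTensor (O k) (cartier k)
    (Algebra.TensorProduct.map (frob k 1) (frob k 1) y * z) =
    LinearMap.lTensor (O k) (frob k 1).toLinearMap y *
      LinearMap.rTensor (O k) (cartier k) z := by
  induction y with
  | zero => simp
  | add a b ha hb => simp only [map_add, add_mul, ha, hb]
  | tmul a b =>
    induction z with
    | zero => simp
    | add c d hc hd => simp only [map_add, mul_add, hc, hd]
    | tmul c d => simp [cartier_frob_mul]

/-- The Cartier operator is equivariant for left and right translations. -/
theorem comul_cartier (f : O k) :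
    LinearMap.rTensor (O k) (cartier k) (Bialgebra.comulAlgHom k (O k) f) =
      LinearMap.lTensor (O k) (frob k 1).toLinearMap
        (Bialgebra.comulAlgHom k (O k) (cartier k f)) := by
  refine span_frob (LinearMap.eqLocus
    (LinearMap.rTensor (O k) (cartier k) ∘ₗ (Bialgebra.comulAlgHom k (O k)).toLinearMap)
    (LinearMap.lTensor (O k) (frob k 1).toLinearMap ∘ₗ
      (Bialgebra.comulAlgHom k (O k)).toLinearMap ∘ₗ cartier k)) ?_ ?_ ?_ ?_ f
  · intro x f hf
    rw [LinearMap.mem_eqLocus] at hf ⊢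
    simp only [LinearMap.comp_apply, AlgHom.toLinearMap_apply] at hf ⊢
    have h1 := AlgHom.congr_fun (comul_frob (k := k) 1) x
    simp only [AlgHom.comp_apply] at h1
    rw [map_mul, ← h1, rTensor_cartier_mul, hf, cartier_frob_mul, map_mul]
    exact (map_mul (Algebra.TensorProduct.map (AlgHom.id k (O k)) (frob k 1)) _ _).symm
  · rw [LinearMap.mem_eqLocus]
    simp only [LinearMap.comp_apply, AlgHom.toLinearMap_apply]
    rw [map_one, cartier_one, map_zero, map_zero, Algebra.TensorProduct.one_def,
      LinearMap.rTensor_tmul, cartier_one, TensorProduct.zero_tmul]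
  · intro i j
    rw [LinearMap.mem_eqLocus]
    simp only [LinearMap.comp_apply, AlgHom.toLinearMap_apply]
    rw [comul_gen, cartier_gen, map_zero, map_zero, map_add, LinearMap.rTensor_tmul,
      LinearMap.rTensor_tmul, cartier_gen, cartier_gen, TensorProduct.zero_tmul,
      TensorProduct.zero_tmul, add_zero]
  · intro i j i' j'
    rw [LinearMap.mem_eqLocus]
    simp only [LinearMap.comp_apply, AlgHom.toLinearMap_apply]
    have hd := det_gen (k := k)
    have h2 := charTwo (k := k) (O k)
    -- Of the four terms of the product of comultiplications only those with distinct inner indices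
    -- survive.
    have hL : LinearMap.rTensor (O k) (cartier k)
        (Bialgebra.comulAlgHom k (O k) (gen k i j * gen k i' j')) =
        (if i ≠ i' then 1 else 0) ⊗ₜ (gen k 0 j * gen k 1 j' + gen k 1 j * gen k 0 j') := by
      rw [map_mul, comul_gen, comul_gen]
      simp only [add_mul, mul_add, Algebra.TensorProduct.tmul_mul_tmul, map_add,
        LinearMap.rTensor_tmul, cartier_gen_mul]
      split_ifs <;> simp_all [TensorProduct.tmul_add, add_comm]
    -- In characteristic 2 this permanent is a determinant: that of the generic matrix, or of a
    -- matrix with equal columns.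
    have hR : gen k 0 j * gen k 1 j' + gen k 1 j * gen k 0 j' = if j ≠ j' then 1 else 0 := by
      fin_cases j <;> fin_cases j'
      · change gen k 0 0 * gen k 1 0 + gen k 1 0 * gen k 0 0 = 0
        linear_combination gen k 0 0 * gen k 1 0 * h2
      · change gen k 0 0 * gen k 1 1 + gen k 1 0 * gen k 0 1 = 1
        linear_combination hd + gen k 1 0 * gen k 0 1 * h2
      · change gen k 0 1 * gen k 1 0 + gen k 1 1 * gen k 0 0 = 1
        linear_combination hd + gen k 1 0 * gen k 0 1 * h2
      · change gen k 0 1 * gen k 1 1 + gen k 1 1 * gen k 0 1 = 0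
        linear_combination gen k 0 1 * gen k 1 1 * h2
    rw [hL, hR, cartier_gen_mul]
    by_cases h : i = i' <;> by_cases h' : j = j' <;>
      simp [h, h', Algebra.TensorProduct.one_def]

theorem cartier_pow_frob_mul (r : ℕ) (x f : O k) :
    (cartier k ^ r) (frob k r x * f) = x * (cartier k ^ r) f := by
  induction r generalizing f with
  | zero => rw [frob_zero]; rfl
  | succ r ih =>
    rw [pow_succ, Module.End.mul_apply, Module.End.mul_apply, add_comm r, ← frob_frob,
      cartier_frob_mul, ih]

theorem comul_cartier_pow (r : ℕ) (f : O k) :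
    LinearMap.rTensor (O k) (cartier k ^ r) (Bialgebra.comulAlgHom k (O k) f) =
      LinearMap.lTensor (O k) (frob k r).toLinearMap
        (Bialgebra.comulAlgHom k (O k) ((cartier k ^ r) f)) := by
  induction r with
  | zero =>
    rw [frob_zero]
    change LinearMap.rTensor (O k) LinearMap.id _ = LinearMap.lTensor (O k) LinearMap.id _
    rw [LinearMap.rTensor_id, LinearMap.lTensor_id]
    rfl
  | succ r ih =>
    rw [pow_succ', Module.End.mul_eq_comp, LinearMap.rTensor_comp_apply, ih,
      ← LinearMap.lTensor_rTensor_apply, comul_cartier, ← LinearMap.lTensor_comp_apply,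
      add_comm r 1, add_comm 1 r, ← frob_comp r 1]
    rfl

/-- The function `(bc) ^ (2 ^ r - 1)`, whose integral over `G_r` is one. -/
noncomputable def unitIntegral (k : Type u) [Field k] (r : ℕ) : O k :=
  (gen k 0 1 * gen k 1 0) ^ (2 ^ r - 1)

/-- Since 2^(r+1) - 1 = 2(2^r - 1) + 1, the function for r + 1 is the Frobenius image of the one for
r times bc, and `cartier` maps bc to 1. -/
theorem cartier_pow_unitIntegral (r : ℕ) : (cartier k ^ r) (unitIntegral k r) = 1 := by
  induction r with
  | zero => simp [unitIntegral]
  | succ r ih =>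
    rw [pow_succ, Module.End.mul_apply]
    have h : unitIntegral k (r + 1) =
        frob k 1 (unitIntegral k r) * (gen k 0 1 * gen k 1 0) := by
      have h1 : 2 ^ (r + 1) - 1 = 2 * (2 ^ r - 1) + 1 := by
        have := Nat.one_le_two_pow (n := r)
        rw [pow_succ]
        omega
      rw [unitIntegral, h1, unitIntegral, map_pow, map_mul, frob_gen, frob_gen, pow_one, pow_succ,
        pow_mul, mul_pow]
    rw [h, cartier_frob_mul, cartier_bc, mul_one, ih]

theorem counit_cartier_pow_of_mem (r : ℕ) {x : O k} (hx : x ∈ frobIdeal k r) :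
    Coalgebra.counit (R := k) ((cartier k ^ r) x) = 0 := by
  -- The extra factor y absorbs ring coefficients, so the induction over the ideal reduces to its
  -- generators F^r(z) with z(1) = 0.
  suffices h : ∀ y, Coalgebra.counit (R := k) ((cartier k ^ r) (x * y)) = 0 by
    simpa using h 1
  induction hx using Submodule.span_induction with
  | mem x hx =>
    obtain ⟨z, hz, rfl⟩ := hx
    intro y
    refine (congrArg (Coalgebra.counit (R := k)) (cartier_pow_frob_mul r z y)).trans ?_
    rw [Bialgebra.counit_mul, show Coalgebra.counit (R := k) z = 0 from hz, zero_mul]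
  | zero => intro y; rw [zero_mul, map_zero, map_zero]
  | add a b _ _ ha hb => intro y; rw [add_mul, map_add, map_add, ha, hb, add_zero]
  | smul c a _ ha =>
    intro y
    rw [smul_eq_mul, mul_comm c, mul_assoc]
    exact ha _

theorem exists_integral (r : ℕ) : ∃ l : OFrob k r →ₗ[k] k,
    ∀ x, l (Ideal.Quotient.mkₐ k (frobIdeal k r) x) =
      Coalgebra.counit (R := k) ((cartier k ^ r) x) :=
  (Ideal.Quotient.mkₐ k (frobIdeal k r)).toLinearMap.exists_factor Ideal.Quotient.mk_surjective
    (Coalgebra.counit ∘ₗ cartier k ^ r)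
    fun _ hx => counit_cartier_pow_of_mem r (Ideal.Quotient.eq_zero_iff_mem.1 hx)

/-- The invariant integral on the Frobenius kernel. -/
noncomputable def integral (k : Type u) [Field k] [CharP k 2] (r : ℕ) : OFrob k r →ₗ[k] k :=
  (exists_integral r).choose

theorem integral_mk (r : ℕ) (x : O k) : integral k r (Ideal.Quotient.mkₐ k (frobIdeal k r) x) =
    Coalgebra.counit (R := k) ((cartier k ^ r) x) :=
  (exists_integral r).choose_spec x

theorem mk_frob (r : ℕ) (x : O k) : Ideal.Quotient.mkₐ k (frobIdeal k r) (frob k r x) =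
    algebraMap k _ (Coalgebra.counit (R := k) x) := by
  have hx : frob k r (x - algebraMap k (O k) (Coalgebra.counit (R := k) x)) ∈
      frobIdeal k r := by
    apply Ideal.mem_map_of_mem
    rw [RingHom.mem_ker, map_sub, AlgHom.commutes]
    exact sub_self _
  rw [map_sub, AlgHom.commutes] at hx
  exact Ideal.Quotient.eq.2 hx

/-- Integrating x(hg) over h in G_r gives the function F^r(C^r x) of g, with C the Cartier operator:
equivariance of C^r, then the counit in the left variable. Both the invariance and the normalization
of the integral follow. -/
theorem integral_comul_mk (r : ℕ) (x : O k) :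
    LinearMap.rTensor (O k) (integral k r ∘ₗ (Ideal.Quotient.mkₐ k (frobIdeal k r)).toLinearMap)
      (Bialgebra.comulAlgHom k (O k) x) = 1 ⊗ₜ frob k r ((cartier k ^ r) x) := by
  have h : integral k r ∘ₗ (Ideal.Quotient.mkₐ k (frobIdeal k r)).toLinearMap =
      Coalgebra.counit ∘ₗ cartier k ^ r := LinearMap.ext fun x => integral_mk r x
  rw [h, LinearMap.rTensor_comp_apply, comul_cartier_pow, ← LinearMap.lTensor_rTensor_apply]
  rw [show LinearMap.rTensor (O k) (Coalgebra.counit (R := k))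
    (Bialgebra.comulAlgHom k (O k) ((cartier k ^ r) x)) = _ from
    Coalgebra.rTensor_counit_comul ((cartier k ^ r) x)]
  rfl

/-- The integral of `f(h g)` over `h ∈ G_r`, for `f = (bc) ^ (2 ^ r - 1)` and `g ∈ G`, is one. -/
theorem integral_comul_unitIntegral (r : ℕ) :
    LinearMap.rTensor (O k) (integral k r ∘ₗ (Ideal.Quotient.mkₐ k (frobIdeal k r)).toLinearMap)
      (Bialgebra.comulAlgHom k (O k) (unitIntegral k r)) = 1 ⊗ₜ 1 := by
  rw [integral_comul_mk, cartier_pow_unitIntegral, map_one]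

/-- The integral is invariant under right translations. -/
theorem integral_comul (r : ℕ) (d : OFrob k r) :
    LinearMap.rTensor (OFrob k r) (integral k r) (Coalgebra.comul (R := k) d) =
      integral k r d ⊗ₜ 1 := by
  obtain ⟨x, rfl⟩ := Ideal.Quotient.mkₐ_surjective k (frobIdeal k r) d
  have h := LinearMap.congr_fun (toFrobKer k r).toCoalgHom.map_comp_comul x
  have h1 := congrArg (LinearMap.lTensor k (Ideal.Quotient.mkₐ k (frobIdeal k r)).toLinearMap)
    (integral_comul_mk r x)
  rw [LinearMap.rTensor_comp_apply, LinearMap.lTensor_rTensor_apply] at h1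
  refine (congrArg (LinearMap.rTensor (OFrob k r) (integral k r)) h.symm).trans ?_
  have h2 : ∀ t : O k ⊗[k] O k, TensorProduct.map (toFrobKer k r).toCoalgHom.toLinearMap
      (toFrobKer k r).toCoalgHom.toLinearMap t = LinearMap.lTensor (OFrob k r)
      (Ideal.Quotient.mkₐ k (frobIdeal k r)).toLinearMap (LinearMap.rTensor (O k)
      (Ideal.Quotient.mkₐ k (frobIdeal k r)).toLinearMap t) := by
    intro t
    rw [← LinearMap.comp_apply, LinearMap.lTensor_comp_rTensor]
    rfl
  refine (congrArg (LinearMap.rTensor (OFrob k r) (integral k r)) (h2 _)).trans (h1.trans ?_)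
  -- On G_r itself the function F^r(C^r x) is the constant (C^r x)(1), which is the integral of x.
  rw [LinearMap.lTensor_tmul, AlgHom.toLinearMap_apply, mk_frob, integral_mk,
    Algebra.algebraMap_eq_smul_one, ← TensorProduct.smul_tmul, smul_eq_mul, mul_one]

end SL2

namespace SL2

open Matrix Comod

variable {k : Type u} [Field k]

/-! ### Injectivity of `k[SL₂]` over closed subgroups with an integral -/

section ClosedSubgroup

variable {D : Type u} [CommRing D] [Bialgebra k D] (π : O k →ₐc[k] D) (I : D →ₗ[k] k)

variable (k D) in
/-- The generic point of `G` in `k[G] ⊗ D`. -/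
noncomputable def y₁ : SpecialLinearGroup (Fin 2) (O k ⊗[k] D) :=
  mapPt (Algebra.TensorProduct.includeLeft : O k →ₐ[k] O k ⊗[k] D) (gen k)

/-- The generic point of a subgroup in `k[G] ⊗ D`. -/
noncomputable def y₂ : SpecialLinearGroup (Fin 2) (O k ⊗[k] D) :=
  mapPt ((Algebra.TensorProduct.includeRight : D →ₐ[k] O k ⊗[k] D).comp (π : O k →ₐ[k] D)) (gen k)

variable {π} in
theorem algHom_ext_prod (hπ : Function.Surjective π) {R : Type*} [CommRing R] [Algebra k R]
    {f g : O k ⊗[k] D →ₐ[k] R} (h₁ : mapPt f (y₁ k D) = mapPt g (y₁ k D))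
    (h₂ : mapPt f (y₂ π) = mapPt g (y₂ π)) : f = g := by
  apply Algebra.TensorProduct.ext
  · apply algHom_ext
    rw [← mapPt_mapPt, ← mapPt_mapPt]
    exact h₁
  · rw [y₂, mapPt_mapPt, mapPt_mapPt] at h₂
    apply AlgHom.ext
    intro d
    obtain ⟨x, rfl⟩ := hπ d
    exact AlgHom.congr_fun (algHom_ext h₂) x

/-- The coaction of a subgroup on `k[G]`. -/
noncomputable def subgroupCoaction : O k →ₐ[k] O k ⊗[k] D :=
  (Algebra.TensorProduct.map (AlgHom.id k (O k)) (π : O k →ₐ[k] D)).comp (leftRegular k)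

theorem subgroupCoaction_eq : subgroupCoaction π = ev ((y₂ π)⁻¹ * y₁ k D) := by
  rw [subgroupCoaction, leftRegular, comp_ev, map_mul, map_inv, x₁, x₂, mapPt_mapPt, mapPt_mapPt,
    Algebra.TensorProduct.map_comp_includeLeft, Algebra.TensorProduct.map_comp_includeRight]
  rfl

/-- The map `F(g, h) ↦ F(h g, h)`. -/
noncomputable def shear : O k ⊗[k] D →ₐ[k] O k ⊗[k] D :=
  Algebra.TensorProduct.lift (ev (y₂ π * y₁ k D)) Algebra.TensorProduct.includeRight
    (fun _ _ => Commute.all _ _)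

theorem shear_y₁ : mapPt (shear π) (y₁ k D) = y₂ π * y₁ k D := by
  have h : (shear π).comp Algebra.TensorProduct.includeLeft = ev (y₂ π * y₁ k D) := by
    apply AlgHom.ext
    intro x
    simp [shear]
  rw [y₁, mapPt_mapPt, h, mapPt_ev_gen]
  rfl

theorem shear_y₂ : mapPt (shear π) (y₂ π) = y₂ π := by
  have h : (shear π).comp Algebra.TensorProduct.includeRight =
      Algebra.TensorProduct.includeRight := by
    apply AlgHom.ext
    intro x
    simp [shear]
  rw [y₂, mapPt_mapPt, ← AlgHom.comp_assoc, h]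

theorem ev_y₁ (f : O k) : ev (y₁ k D) f = f ⊗ₜ 1 := by
  have h : ev (y₁ k D) = (Algebra.TensorProduct.includeLeft : O k →ₐ[k] O k ⊗[k] D) := by
    apply algHom_ext
    rw [mapPt_ev_gen]
    rfl
  rw [h]
  rfl

/-- Substituting hg for g in f(h⁻¹g) gives f(g): the shear untwists the coaction. -/
theorem shear_subgroupCoaction (f : O k) : shear π (subgroupCoaction π f) = f ⊗ₜ 1 := by
  have h : (shear π).comp (subgroupCoaction π) = ev (y₁ k D) := by
    rw [subgroupCoaction_eq, comp_ev, map_mul, map_inv, shear_y₁, shear_y₂, inv_mul_cancel_left]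
  rw [← ev_y₁, ← h]
  rfl

/-- Integration in the second variable. -/
noncomputable def integrate : O k ⊗[k] D →ₗ[k] O k :=
  (TensorProduct.rid k (O k)).toLinearMap ∘ₗ LinearMap.lTensor (O k) I

@[simp] theorem integrate_tmul (f : O k) (d : D) : integrate I (f ⊗ₜ d) = I d • f := by
  simp [integrate]

theorem integrate_mul (t : O k ⊗[k] D) (f : O k) :
    integrate I (t * f ⊗ₜ 1) = integrate I t * f := by
  induction t with
  | zero => simp
  | add a b ha hb => simp only [add_mul, map_add, ha, hb]
  | tmul x d => simp

/-- Both sides are the integral of f(hg) over h; the normalization of `f₀` is stated in the second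
form. -/
theorem integrate_shear (f : O k) : integrate I (shear π (f ⊗ₜ 1)) =
    TensorProduct.lid k (O k) (LinearMap.rTensor (O k) (I ∘ₗ (π : O k →ₐ[k] D).toLinearMap)
      (Bialgebra.comulAlgHom k (O k) f)) := by
  have h1 : ev (y₂ π * y₁ k D) = (Algebra.TensorProduct.comm k D (O k)).toAlgHom.comp
      ((Algebra.TensorProduct.map (π : O k →ₐ[k] D) (AlgHom.id k (O k))).comp
        (Bialgebra.comulAlgHom k (O k))) := by
    rw [comulAlgHom_eq, comp_ev, comp_ev, map_mul, map_mul]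
    congr 2
    ext i j
    simp [x₂_apply, y₁]
  have h2 : shear π (f ⊗ₜ 1) = ev (y₂ π * y₁ k D) f := by
    rw [shear, Algebra.TensorProduct.lift_tmul, map_one, mul_one]
  have h3 : ∀ t : O k ⊗[k] O k, integrate I (Algebra.TensorProduct.comm k D (O k)
      (Algebra.TensorProduct.map (π : O k →ₐ[k] D) (AlgHom.id k (O k)) t)) =
      TensorProduct.lid k (O k) (LinearMap.rTensor (O k)
        (I ∘ₗ (π : O k →ₐ[k] D).toLinearMap) t) := by
    intro t
    induction t with
    | zero => simp
    | add a b ha hb => simp only [map_add, ha, hb]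
    | tmul x y => simp
  rw [h2, h1]
  exact h3 _

variable (k D) in
/-- The coaction on the cofree module `k[G] ⊗ D`. -/
noncomputable def cofreeCoaction : O k ⊗[k] D →ₐ[k] (O k ⊗[k] D) ⊗[k] D :=
  (Algebra.TensorProduct.assoc k k k (O k) D D).symm.toAlgHom.comp
    (Algebra.TensorProduct.map (AlgHom.id k (O k)) (Bialgebra.comulAlgHom k D))

theorem cofreeCoaction_tmul (f : O k) (d : D) : cofreeCoaction k D (f ⊗ₜ d) =
    (TensorProduct.assoc k (O k) D D).symm (f ⊗ₜ Coalgebra.comul (R := k) d) := rfl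

variable (k D) in
/-- The map `F(g, h, x) ↦ F(g, h x, x)`. -/
noncomputable def translate : (O k ⊗[k] D) ⊗[k] D →ₐ[k] (O k ⊗[k] D) ⊗[k] D :=
  Algebra.TensorProduct.lift (cofreeCoaction k D) Algebra.TensorProduct.includeRight
    (fun _ _ => Commute.all _ _)

variable {I} in
theorem integrate_translate (hI : ∀ d : D, LinearMap.rTensor D I (Coalgebra.comul (R := k) d) =
    I d ⊗ₜ 1) (t : (O k ⊗[k] D) ⊗[k] D) :
    LinearMap.rTensor D (integrate I) (translate k D t) = LinearMap.rTensor D (integrate I) t := by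
  induction t with
  | zero => simp
  | add a b ha hb => simp only [map_add, ha, hb]
  | tmul a e =>
    induction a with
    | zero => simp
    | add a b ha hb => simp only [map_add, TensorProduct.add_tmul, ha, hb]
    | tmul f d =>
      -- The function of x alone factors out of the integral over h, leaving the invariance
      -- hypothesis on I.
      have h : ∀ z : D ⊗[k] D, LinearMap.rTensor D (integrate I)
          ((TensorProduct.assoc k (O k) D D).symm (f ⊗ₜ z) * 1 ⊗ₜ e) =
          f ⊗ₜ (TensorProduct.lid k D (LinearMap.rTensor D I z) * e) := by
        intro z
        induction z with
        | zero => simp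
        | add a b ha hb => simp only [map_add, TensorProduct.tmul_add, add_mul, ha, hb]
        | tmul a b => simp [TensorProduct.smul_tmul]
      rw [translate, Algebra.TensorProduct.lift_tmul, cofreeCoaction_tmul,
        Algebra.TensorProduct.includeRight_apply, h, hI]
      simp [TensorProduct.smul_tmul]

theorem subgroupCoaction_integrate (t : O k ⊗[k] D) :
    subgroupCoaction π (integrate I t) = LinearMap.rTensor D (integrate I)
      (swapRight k (O k) D D
        (Algebra.TensorProduct.map (subgroupCoaction π) (AlgHom.id k D) t)) := by
  induction t with
  | zero => simp
  | add a b ha hb => simp only [map_add, ha, hb]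
  | tmul f d =>
    rw [integrate_tmul, map_smul, Algebra.TensorProduct.map_tmul]
    generalize subgroupCoaction π f = z
    induction z with
    | zero => simp
    | add a b ha hb => simp only [map_add, TensorProduct.add_tmul, smul_add, ha, hb]
    | tmul a b => simp [TensorProduct.smul_tmul']

variable {π} in
-- Both sides send F(g, h) to F(hg, hx). On the left the shear gives F(hg, h), the coaction replaces
-- g by x⁻¹g, and h ↦ hx then cancels x. Surjectivity of π allows a check on generic points.
theorem translate_shear (hπ : Function.Surjective π) :
    (translate k D).comp (((swapRight k (O k) D D).comp
      (Algebra.TensorProduct.map (subgroupCoaction π) (AlgHom.id k D))).comp (shear π)) =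
    (Algebra.TensorProduct.map (shear π) (AlgHom.id k D)).comp (cofreeCoaction k D) := by
  set K := (swapRight k (O k) D D).comp
    (Algebra.TensorProduct.map (subgroupCoaction π) (AlgHom.id k D)) with hK
  set S := Algebra.TensorProduct.map (shear π) (AlgHom.id k D) with hS
  let l : O k ⊗[k] D →ₐ[k] (O k ⊗[k] D) ⊗[k] D := Algebra.TensorProduct.includeLeft
  let z : SpecialLinearGroup (Fin 2) ((O k ⊗[k] D) ⊗[k] D) :=
    mapPt ((Algebra.TensorProduct.includeRight : D →ₐ[k] (O k ⊗[k] D) ⊗[k] D).comp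
      (π : O k →ₐ[k] D)) (gen k)
  let m : O k ⊗[k] D →ₐ[k] (O k ⊗[k] D) ⊗[k] D :=
    (swapRight k (O k) D D).comp Algebra.TensorProduct.includeLeft
  have m1 : mapPt m (y₁ k D) = mapPt l (y₁ k D) := by
    ext i j
    simp [m, l, y₁]
  have m2 : mapPt m (y₂ π) = z := by
    ext i j
    simp [m, z, y₂, Algebra.TensorProduct.one_def]
  have K1 : mapPt K (y₁ k D) = z⁻¹ * mapPt l (y₁ k D) := by
    have h : K.comp Algebra.TensorProduct.includeLeft = m.comp (subgroupCoaction π) := by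
      apply AlgHom.ext
      intro x
      simp [hK, m]
    rw [y₁, mapPt_mapPt, h, ← mapPt_mapPt, subgroupCoaction_eq, mapPt_ev_gen, map_mul, map_inv,
      m1, m2]
    rfl
  have K2 : mapPt K (y₂ π) = mapPt l (y₂ π) := by
    ext i j
    simp [hK, l, y₂, Algebra.TensorProduct.one_def]
  have C1 : mapPt (cofreeCoaction k D) (y₁ k D) = mapPt l (y₁ k D) := by
    ext i j
    simp [cofreeCoaction, l, y₁, Algebra.TensorProduct.one_def]
  have C2 : mapPt (cofreeCoaction k D) (y₂ π) = mapPt l (y₂ π) * z := by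
    ext i j
    have h : Coalgebra.comul (R := k) (π (gen k i j)) =
        π (gen k i 0) ⊗ₜ[k] π (gen k 0 j) + π (gen k i 1) ⊗ₜ[k] π (gen k 1 j) := by
      refine (LinearMap.congr_fun π.toCoalgHom.map_comp_comul.symm (gen k i j)).trans ?_
      refine (congrArg (TensorProduct.map π.toCoalgHom.toLinearMap π.toCoalgHom.toLinearMap)
        (comul_gen i j)).trans ?_
      rw [map_add]
      rfl
    rw [mul_apply_fin_two]
    change cofreeCoaction k D (1 ⊗ₜ π (gen k i j)) = _
    rw [cofreeCoaction_tmul, h]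
    simp [l, z, y₂, TensorProduct.tmul_add]
  have T1 : ∀ g, mapPt (translate k D) (mapPt l g) = mapPt (cofreeCoaction k D) g := by
    intro g
    ext i j
    change translate k D (g i j ⊗ₜ 1) = cofreeCoaction k D (g i j)
    rw [translate, Algebra.TensorProduct.lift_tmul, map_one, mul_one]
  have T2 : mapPt (translate k D) z = z := by
    ext i j
    simp [translate, z]
  have S1 : ∀ g, mapPt S (mapPt l g) = mapPt l (mapPt (shear π) g) := by
    intro g
    ext i j
    simp [hS, l]
  have S2 : mapPt S z = z := by
    ext i j
    simp [hS, z]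
  apply algHom_ext_prod hπ
  · rw [← mapPt_mapPt (K.comp (shear π)) (translate k D), ← mapPt_mapPt (shear π) K,
      ← mapPt_mapPt (cofreeCoaction k D) S, shear_y₁, map_mul, K1, K2, map_mul, map_mul,
      map_inv, T1, T1, T2, C1, C2, S1, shear_y₁, map_mul, mul_assoc, mul_inv_cancel_left]
  · rw [← mapPt_mapPt (K.comp (shear π)) (translate k D), ← mapPt_mapPt (shear π) K,
      ← mapPt_mapPt (cofreeCoaction k D) S, shear_y₂, K2, T1, C2, map_mul, S1, S2,
      shear_y₂]

theorem cofreeCoaction_mul (f : O k) (t : O k ⊗[k] D) :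
    cofreeCoaction k D (f ⊗ₜ 1 * t) = ((f ⊗ₜ 1) ⊗ₜ 1) * cofreeCoaction k D t := by
  rw [map_mul]
  congr 1
  simp [cofreeCoaction, Algebra.TensorProduct.one_def]

/-- If a closed subgroup of `G` has an invariant integral, and a function on `G` has integral one
along all cosets, then `k[G]` is a retract of a cofree module. -/
noncomputable def regularRestrictRetract {π : O k →ₐc[k] D} {I : D →ₗ[k] k}
    (hπ : Function.Surjective π)
    (hI : ∀ d : D, LinearMap.rTensor D I (Coalgebra.comul (R := k) d) = I d ⊗ₜ 1) (f₀ : O k)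
    (h₀ : LinearMap.rTensor (O k) (I ∘ₗ (π : O k →ₐ[k] D).toLinearMap)
      (Bialgebra.comulAlgHom k (O k) f₀) = 1 ⊗ₜ 1) :
    Retract ((regular k).toComod.res π.toCoalgHom) (cofree (k := k) D (O k)) where
  i := toCofree ((regular k).toComod.res π.toCoalgHom) (LinearMap.id (R := k) (M := O k))
  -- The retraction sends F to the integral over h of f₀(hg) F(hg, h).
  r := mkHom (X := cofree (k := k) D (O k)) (Y := (regular k).toComod.res π.toCoalgHom)
    (integrate I ∘ₗ (shear π).toLinearMap ∘ₗ
      LinearMap.mulLeft k (f₀ ⊗ₜ[k] (1 : D))) (by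
    apply LinearMap.ext
    intro t
    change subgroupCoaction π (integrate I (shear π (f₀ ⊗ₜ 1 * t))) =
      LinearMap.rTensor D (integrate I ∘ₗ (shear π).toLinearMap ∘ₗ
      LinearMap.mulLeft k (f₀ ⊗ₜ[k] (1 : D))) (cofreeCoaction k D t)
    have h := AlgHom.congr_fun (translate_shear hπ) (f₀ ⊗ₜ 1 * t)
    simp only [AlgHom.comp_apply] at h
    -- Invariance of the integral permits the substitution h ↦ hx under it, which brings the
    -- expression into the form of `translate_shear`.
    rw [subgroupCoaction_integrate, ← integrate_translate hI, h, cofreeCoaction_mul]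
    generalize cofreeCoaction k D t = z
    induction z with
    | zero => simp
    | add a b ha hb => simp only [map_add, mul_add, ha, hb]
    | tmul a b => simp)
  retract := hom_ext (LinearMap.ext fun f => by
    -- For F(g, h) = f(h⁻¹g) the integrand becomes f₀(hg) f(g), and the integral of f₀(hg) is 1.
    change integrate I (shear π (f₀ ⊗ₜ 1 *
      LinearMap.rTensor D LinearMap.id (subgroupCoaction π f))) = f
    rw [LinearMap.rTensor_id, LinearMap.id_apply, map_mul, shear_subgroupCoaction, integrate_mul,
      integrate_shear, h₀]
    simp)

end ClosedSubgroup

instance [CharP k 2] (r : ℕ) : Injective (resFrobKer k r (regular k).toComod) :=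
  (regularRestrictRetract (π := toFrobKer k r) (I := integral k r) Ideal.Quotient.mk_surjective
    (integral_comul r) (unitIntegral k r) (integral_comul_unitIntegral r)).injective

end SL2

namespace SL2

open Matrix Comod

variable {k : Type u} [Field k]

/-! ### Frobenius and the regular representation -/

/-- A left inverse is: multiply by `unitIntegral k r`, then apply the r-th power of the Cartier
operator. -/
theorem frob_injective [CharP k 2] (r : ℕ) : Function.Injective (frob k r) := by
  intro x y h
  have h1 := cartier_pow_frob_mul r x (unitIntegral k r)
  rw [h, cartier_pow_frob_mul, cartier_pow_unitIntegral, mul_one, mul_one] at h1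
  exact h1.symm

theorem leftRegular_frob [CharP k 2] (r : ℕ) : (leftRegular k).comp (frob k r) =
    (Algebra.TensorProduct.map (frob k r) (frob k r)).comp (leftRegular k) := by
  have h1 : mapPt (Algebra.TensorProduct.map (frob k r) (frob k r)) (x₁ k) =
      SpecialLinearGroup.map (iterateFrobenius (O k ⊗[k] O k) 2 r) (x₁ k) := by
    ext i j
    simp [x₁_apply, frob_gen, iterateFrobenius_def, Algebra.TensorProduct.tmul_pow]
  have h2 : mapPt (Algebra.TensorProduct.map (frob k r) (frob k r)) (x₂ k) =
      SpecialLinearGroup.map (iterateFrobenius (O k ⊗[k] O k) 2 r) (x₂ k) := by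
    ext i j
    simp [x₂_apply, frob_gen, iterateFrobenius_def, Algebra.TensorProduct.tmul_pow]
  rw [leftRegular, ev_comp_frob, comp_ev, map_mul, map_mul, map_inv, map_inv, h1, h2]

/-- F^r is a homomorphism that is trivial on G_r, so f(F^r(h⁻¹g)) = f(F^r(g)) for h in G_r. -/
theorem subgroupCoaction_frob [CharP k 2] (r : ℕ) (f : O k) :
    subgroupCoaction (toFrobKer k r) (frob k r f) = frob k r f ⊗ₜ 1 := by
  have h1 := AlgHom.congr_fun (leftRegular_frob (k := k) r) f
  have h2 := AlgHom.congr_fun (leftRegular_counit (k := k)) f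
  simp only [AlgHom.comp_apply] at h1 h2
  rw [subgroupCoaction, AlgHom.comp_apply, h1]
  have h3 : ∀ t : O k ⊗[k] O k,
      Algebra.TensorProduct.map (AlgHom.id k (O k)) (toFrobKer k r : O k →ₐ[k] OFrob k r)
        (Algebra.TensorProduct.map (frob k r) (frob k r) t) =
      frob k r (Algebra.TensorProduct.rid k k (O k) (Algebra.TensorProduct.map (AlgHom.id k (O k))
        (Bialgebra.counitAlgHom k (O k)) t)) ⊗ₜ 1 := by
    intro t
    induction t with
    | zero => simp
    | add a b ha hb => simp only [map_add, TensorProduct.add_tmul, ha, hb]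
    | tmul x y =>
      have h : (toFrobKer k r : O k →ₐ[k] OFrob k r) (frob k r y) =
        algebraMap k _ (Coalgebra.counit (R := k) y) := mk_frob r y
      simp only [Algebra.TensorProduct.map_tmul, AlgHom.id_apply, h]
      simp [Algebra.algebraMap_eq_smul_one, TensorProduct.smul_tmul]
  exact (h3 _).trans (congrArg (fun x => frob k r x ⊗ₜ[k] (1 : OFrob k r)) h2)

/-- Multiplication by a `G_r`-invariant function is a morphism of `G_r`-modules. -/
noncomputable def mulInvariant [CharP k 2] (r : ℕ) (c : O k)
    (hc : subgroupCoaction (toFrobKer k r) c = c ⊗ₜ 1) :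
    resFrobKer k r (regular k).toComod ⟶ resFrobKer k r (regular k).toComod :=
  mkHom (X := resFrobKer k r (regular k).toComod) (Y := resFrobKer k r (regular k).toComod)
    (LinearMap.mulRight k c) (by
    apply LinearMap.ext
    intro f
    change subgroupCoaction (toFrobKer k r) (f * c) = LinearMap.rTensor (OFrob k r)
      (LinearMap.mulRight k c) (subgroupCoaction (toFrobKer k r) f)
    rw [map_mul, hc]
    generalize subgroupCoaction (toFrobKer k r) f = z
    induction z with
    | zero => simp
    | add a b ha hb => simp only [map_add, ← ha, ← hb]; exact add_mul a b _
    | tmul a b => simp)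

theorem flip_pow (f : O k) (n : ℕ) :
    lin (flip k) (f ^ n : O k) = ((lin (flip k) f : O k) ^ n : O k) := by
  induction n with
  | zero => rw [pow_zero, pow_zero]; exact flip_of_mem (one_mem (rightInvariants k (N k)))
  | succ n ih => rw [pow_succ, pow_succ, flip_mul, ih]

/-- With q = 2^r, (1 - w)^q + w^q = 1. So w^q serves as well as w for a section of p, and it is
G_r-invariant. -/
theorem diff_mul_frob_w [CharP k 2] (r : ℕ) {y : O k} (hy : y ∈ rightInvariants k (N k)) :
    lin (diff k) (y * frob k r (w k) : O k) = y := by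
  have h : frob k r (w k) = w k ^ 2 ^ r := by
    rw [w, map_mul, frob_gen, frob_gen, mul_pow]
  change lin (flip k) (y * frob k r (w k) : O k) + (y * frob k r (w k) : O k) = y
  rw [flip_mul, flip_of_mem hy, h, flip_pow, flip_w]
  change y * (1 - w k) ^ 2 ^ r + y * w k ^ 2 ^ r = y
  rw [sub_pow_expChar_pow, one_pow]
  ring

/-- `k[G/N]` is a retract of `k[G]` over the Frobenius kernels. -/
noncomputable def retractN [CharP k 2] (r : ℕ) : Retract (resFrobKer k r (homogeneous (N k)).toComod)
    (resFrobKer k r (regular k).toComod) where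
  -- The section is y ↦ y w^(2^r), a morphism over G_r because w^(2^r) is G_r-invariant; the
  -- retraction, weight projection followed by p, is even G-equivariant.
  i := resMap (toFrobKer k r).toCoalgHom (homogeneousι (N k)) ≫
    mulInvariant r (frob k r (w k)) (subgroupCoaction_frob r _)
  r := resMap (toFrobKer k r).toCoalgHom (retractT.r ≫ transfer k)
  retract := by
    apply hom_ext
    apply LinearMap.ext
    intro y
    apply homogeneousι_injective (N k)
    have hN : ((y : (homogeneous (N k)).A) : O k) ∈ rightInvariants k (N k) :=
      (y : (homogeneous (N k)).A).2
    have h1 : (retractT.r ≫ transfer k) ≫ homogeneousι (N k) = weightZero k ≫ diff k := by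
      rw [Category.assoc, transfer, (exists_transfer (k := k)).choose_spec, ← Category.assoc]
      congr 1
      exact exists_retraction.choose_spec
    refine (LinearMap.congr_fun (congrArg lin h1)
      (((y : (homogeneous (N k)).A) : O k) * frob k r (w k) : O k)).trans ?_
    change lin (diff k) (lin (weightZero k) _) = _
    have h2 : frob k r (w k) ∈ rightInvariants k (T k) := by
      rw [w, map_mul, frob_gen, frob_gen, ← mul_pow]
      exact pow_mem w_mem_T _
    rw [weightZero_of_mem (mul_mem (rightInvariants_N_le_T hN) h2)]
    exact diff_mul_frob_w r hN

instance [CharP k 2] (r : ℕ) : Injective (resFrobKer k r (homogeneous (N k)).toComod) :=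
  (retractN r).injective

/-! ### Unipotent translations -/

section Unipotent

open Polynomial

/-- The matrices `(1 X; 0 1)` and `(1 0; X 1)`. -/
noncomputable def unipotent (R : Type*) [CommRing R] (i : Fin 2) : SpecialLinearGroup (Fin 2) R[X] :=
  ⟨!![1, if i = 0 then X else 0; if i = 0 then 0 else X, 1], by
    rw [Matrix.det_fin_two_of]
    split_ifs <;> simp⟩

/-- This reconciles f(xg) in `unipotentTranslate` with f(x⁻¹g) in the coaction. -/
theorem unipotent_inv [CharP k 2] (i : Fin 2) : (unipotent (O k) i)⁻¹ = unipotent (O k) i := by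
  have h : ∀ x : (O k)[X], -x = x := fun x => by
    linear_combination -x * charTwo (k := k) (O k)[X]
  rw [SpecialLinearGroup.SL2_inv_expl]
  ext m n : 1
  fin_cases m <;> fin_cases n <;> fin_cases i <;> simp [unipotent, h]

/-- The translation `f ↦ f(x g)` by a unipotent matrix `x`. -/
noncomputable def unipotentTranslate (k : Type u) [Field k] (i : Fin 2) : O k →ₐ[k] (O k)[X] :=
  ev (unipotent (O k) i * mapPt (CAlgHom : O k →ₐ[k] (O k)[X]) (gen k))

theorem unipotentTranslate_gen (i m n : Fin 2) : unipotentTranslate k i (gen k m n) =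
    C (gen k m n) + if i = m then X * C (gen k (1 - m) n) else 0 := by
  rw [unipotentTranslate, ev_gen_apply, mul_apply_fin_two]
  fin_cases m <;> fin_cases i <;> simp [unipotent, add_comm]

theorem coeff_zero_unipotentTranslate (i : Fin 2) (f : O k) :
    (unipotentTranslate k i f).coeff 0 = f := by
  have h : ((aeval (0 : O k)).restrictScalars k).comp (unipotentTranslate k i) =
      AlgHom.id k (O k) := by
    apply algHom_ext
    ext m n
    change aeval (0 : O k) (unipotentTranslate k i (gen k m n)) = gen k m n
    rw [unipotentTranslate_gen]
    split_ifs <;> simp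
  rw [coeff_zero_eq_aeval_zero]
  exact AlgHom.congr_fun h f

/-- F^s carries the unipotent matrix with parameter X to the one with parameter X^(2^s). -/
theorem unipotentTranslate_frob [CharP k 2] (i : Fin 2) (s : ℕ) (f : O k) :
    unipotentTranslate k i (frob k s f) =
      expand (O k) (2 ^ s) (mapAlgHom (frob k s) (unipotentTranslate k i f)) := by
  have h : (unipotentTranslate k i).comp (frob k s) =
      ((expand (O k) (2 ^ s)).restrictScalars k).comp
        ((mapAlgHom (frob k s)).comp (unipotentTranslate k i)) := by
    apply algHom_ext
    ext m n : 1
    change unipotentTranslate k i (frob k s (gen k m n)) =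
      expand (O k) (2 ^ s) (mapAlgHom (frob k s) (unipotentTranslate k i (gen k m n)))
    rw [frob_gen, map_pow, unipotentTranslate_gen]
    split_ifs <;> simp [add_pow_expChar_pow, mul_pow, frob_gen]
  exact AlgHom.congr_fun h f

/-- The derivation of `k[G]` given by an infinitesimal unipotent translation. -/
noncomputable def unipotentDeriv (k : Type u) [Field k] (i : Fin 2) : O k →ₗ[k] O k :=
  (lcoeff (O k) 1).restrictScalars k ∘ₗ (unipotentTranslate k i).toLinearMap

theorem unipotentDeriv_apply (i : Fin 2) (f : O k) :
    unipotentDeriv k i f = (unipotentTranslate k i f).coeff 1 := rfl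

theorem unipotentDeriv_mul (i : Fin 2) (f g : O k) : unipotentDeriv k i (f * g) =
    f * unipotentDeriv k i g + unipotentDeriv k i f * g := by
  rw [unipotentDeriv_apply, map_mul, mul_coeff_one, coeff_zero_unipotentTranslate,
    coeff_zero_unipotentTranslate]
  rfl

theorem unipotentDeriv_gen (i m n : Fin 2) :
    unipotentDeriv k i (gen k m n) = if i = m then gen k (1 - m) n else 0 := by
  rw [unipotentDeriv_apply, unipotentTranslate_gen]
  split_ifs <;> simp

theorem unipotentDeriv_frob [CharP k 2] (i : Fin 2) (f : O k) : unipotentDeriv k i (frob k 1 f) = 0 := by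
  rw [unipotentDeriv_apply, unipotentTranslate_frob, coeff_expand (by norm_num)]
  norm_num

/-- The derivation for i = 0 sends a to c and b to d, so ab goes to ad + bc = 1. With
`unipotentDeriv_v`, the two derivations act on B as the partial derivatives in u and v. -/
theorem unipotentDeriv_u [CharP k 2] (i : Fin 2) : unipotentDeriv k i (u k) = if i = 0 then 1 else 0 := by
  rw [u, unipotentDeriv_mul, unipotentDeriv_gen, unipotentDeriv_gen]
  split_ifs
  · change gen k 0 0 * gen k 1 1 + gen k 1 0 * gen k 0 1 = 1
    linear_combination det_gen (k := k) + gen k 1 0 * gen k 0 1 * charTwo (k := k) (O k)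
  · simp

theorem unipotentDeriv_v [CharP k 2] (i : Fin 2) : unipotentDeriv k i (v k) = if i = 1 then 1 else 0 := by
  rw [v, unipotentDeriv_mul, unipotentDeriv_gen, unipotentDeriv_gen]
  split_ifs
  · change gen k 1 0 * gen k 0 1 + gen k 0 0 * gen k 1 1 = 1
    linear_combination det_gen (k := k) + gen k 1 0 * gen k 0 1 * charTwo (k := k) (O k)
  · simp

/-- Modulo X^(2^r) the unipotent matrix becomes a point of G_r, and translation by it fixes f. -/
theorem X_pow_dvd_of_invariant [CharP k 2] (i : Fin 2) (r : ℕ) {f : O k}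
    (hf : subgroupCoaction (toFrobKer k r) f = f ⊗ₜ 1) :
    X ^ 2 ^ r ∣ unipotentTranslate k i f - C f := by
  let R := (O k)[X] ⧸ Ideal.span {(X : (O k)[X]) ^ 2 ^ r}
  let q : (O k)[X] →ₐ[k] R := Ideal.Quotient.mkₐ k _
  have hX : q X ^ 2 ^ r = 0 := by
    rw [← map_pow]
    exact Ideal.Quotient.eq_zero_iff_mem.2 (Ideal.mem_span_singleton_self _)
  let h : SpecialLinearGroup (Fin 2) R := mapPt q (unipotent (O k) i)
  have h2 : (ev h).comp (frob k r) = (Algebra.ofId k R).comp (Bialgebra.counitAlgHom k (O k)) := by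
    rw [counitAlgHom_eq, comp_ev, map_one]
    apply algHom_ext
    rw [mapPt_ev_gen]
    ext m n
    change ev h (frob k r (gen k m n)) = _
    rw [frob_gen, map_pow, ev_gen_apply]
    change q (unipotent (O k) i m n) ^ 2 ^ r = _
    fin_cases m <;> fin_cases n <;> fin_cases i <;> simp [unipotent, hX]
  have h3 : ∀ x ∈ frobIdeal k r, ev h x = 0 := by
    change frobIdeal k r ≤ RingHom.ker (ev h)
    rw [frobIdeal, Ideal.map_le_iff_le_comap]
    intro x hx
    refine (AlgHom.congr_fun h2 x).trans ?_
    rw [AlgHom.comp_apply, (RingHom.mem_ker.1 hx : Bialgebra.counitAlgHom k (O k) x = 0), map_zero]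
  let Φ : O k ⊗[k] OFrob k r →ₐ[k] R := Algebra.TensorProduct.lift (q.comp CAlgHom)
    (Ideal.Quotient.liftₐ (frobIdeal k r) (ev h) h3) (fun _ _ => Commute.all _ _)
  have h4 : Φ.comp (subgroupCoaction (toFrobKer k r)) = q.comp (unipotentTranslate k i) := by
    have e1 : mapPt Φ (y₁ k (OFrob k r)) = mapPt q (mapPt (CAlgHom : O k →ₐ[k] (O k)[X]) (gen k)) := by
      ext m n
      change Φ (gen k m n ⊗ₜ 1) = _
      rw [Algebra.TensorProduct.lift_tmul, map_one, mul_one]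
      rfl
    have e2 : mapPt Φ (y₂ (toFrobKer k r)) = h := by
      ext m n
      change Φ (1 ⊗ₜ toFrobKer k r (gen k m n)) = _
      rw [Algebra.TensorProduct.lift_tmul, map_one, one_mul]
      exact ev_gen_apply h m n
    rw [subgroupCoaction_eq, comp_ev, unipotentTranslate, comp_ev, map_mul, map_mul, map_inv, e1,
      e2, ← map_inv, unipotent_inv]
  have h5 := AlgHom.congr_fun h4 f
  rw [AlgHom.comp_apply, AlgHom.comp_apply, hf, Algebra.TensorProduct.lift_tmul, map_one,
    mul_one] at h5
  exact Ideal.mem_span_singleton.1 (Ideal.Quotient.eq.1 h5.symm)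

/-- The coefficient of X^(2^s) in the translate of F^s(f) is F^s of the derivative of f. It vanishes
because 2^s < 2^r, and F^s is injective. -/
theorem unipotentDeriv_eq_zero [CharP k 2] (i : Fin 2) {r s : ℕ} (hs : s < r) {f : O k}
    (hf : subgroupCoaction (toFrobKer k r) (frob k s f) = frob k s f ⊗ₜ 1) :
    unipotentDeriv k i f = 0 := by
  have h1 := X_pow_dvd_iff.1 (X_pow_dvd_of_invariant i r hf) (2 ^ s)
    (Nat.pow_lt_pow_right (by norm_num) hs)
  have h2 := coeff_expand_mul (R := O k) (p := 2 ^ s) (by positivity)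
    (mapAlgHom (frob k s) (unipotentTranslate k i f)) 1
  rw [one_mul] at h2
  rw [coeff_sub, coeff_C_of_ne_zero (by positivity), sub_zero, unipotentTranslate_frob, h2] at h1
  apply frob_injective s
  rw [map_zero, ← h1, unipotentDeriv_apply]
  simp

end Unipotent

/-! ### Invariants of the Frobenius kernels -/

theorem frob_mem_B₀ [CharP k 2] (r : ℕ) {f : O k} (hf : f ∈ B₀ k) : frob k r f ∈ B₀ k := by
  suffices h : B₀ k ≤ (B₀ k).comap (frob k r) from h hf
  rw [B₀, Algebra.adjoin_le_iff]
  rintro _ (rfl | rfl)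
  · change frob k r (u k) ∈ B₀ k
    rw [u, map_mul, frob_gen, frob_gen, ← mul_pow]
    exact pow_mem u_mem _
  · change frob k r (v k) ∈ B₀ k
    rw [v, map_mul, frob_gen, frob_gen, ← mul_pow]
    exact pow_mem v_mem _

/-- `k[ab, cd]` is generated by `1, ab, cd, abcd` over the image of the Frobenius endomorphism. -/
theorem exists_frob_decomposition [CharP k 2] {f : O k} (hf : f ∈ B₀ k) :
    ∃ f₀ ∈ B₀ k, ∃ f₁ ∈ B₀ k, ∃ f₂ ∈ B₀ k, ∃ f₃ ∈ B₀ k,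
      f = frob k 1 f₀ + frob k 1 f₁ * u k + frob k 1 f₂ * v k + frob k 1 f₃ * (u k * v k) := by
  let P : O k → Prop := fun f => ∃ f₀ ∈ B₀ k, ∃ f₁ ∈ B₀ k, ∃ f₂ ∈ B₀ k, ∃ f₃ ∈ B₀ k,
    f = frob k 1 f₀ + frob k 1 f₁ * u k + frob k 1 f₂ * v k + frob k 1 f₃ * (u k * v k)
  have hu : frob k 1 (u k) = u k * u k := by
    rw [u, map_mul, frob_gen, frob_gen]
    ring
  have hv : frob k 1 (v k) = v k * v k := by
    rw [v, map_mul, frob_gen, frob_gen]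
    ring
  -- Stability of P under multiplication by B passes to products of elements at once, so two
  -- decompositions never need to be multiplied.
  suffices h : ∀ x ∈ B₀ k, ∀ y, P y → P (x * y) by
    rw [← mul_one f]
    exact h f hf 1 ⟨1, one_mem _, 0, zero_mem _, 0, zero_mem _, 0, zero_mem _, by simp⟩
  intro x hx
  induction hx using Algebra.adjoin_induction with
  | mem x hx =>
    rintro _ ⟨f₀, h₀, f₁, h₁, f₂, h₂, f₃, h₃, rfl⟩
    obtain rfl | rfl := hx
    · refine ⟨f₁ * u k, mul_mem h₁ u_mem, f₀, h₀, f₃ * u k, mul_mem h₃ u_mem, f₂, h₂, ?_⟩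
      rw [map_mul, map_mul, hu]
      ring
    · refine ⟨f₂ * v k, mul_mem h₂ v_mem, f₃ * v k, mul_mem h₃ v_mem, f₀, h₀, f₁, h₁, ?_⟩
      rw [map_mul, map_mul, hv]
      ring
  | algebraMap c =>
    rintro _ ⟨f₀, h₀, f₁, h₁, f₂, h₂, f₃, h₃, rfl⟩
    refine ⟨c • f₀, Subalgebra.smul_mem _ h₀ c, c • f₁, Subalgebra.smul_mem _ h₁ c, c • f₂,
      Subalgebra.smul_mem _ h₂ c, c • f₃, Subalgebra.smul_mem _ h₃ c, ?_⟩
    simp only [map_smul]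
    simp only [Algebra.smul_def]
    ring
  | add x x' _ _ h h' =>
    intro y hy
    obtain ⟨f₀, h₀, f₁, h₁, f₂, h₂, f₃, h₃, e⟩ := h y hy
    obtain ⟨g₀, i₀, g₁, i₁, g₂, i₂, g₃, i₃, e'⟩ := h' y hy
    refine ⟨f₀ + g₀, add_mem h₀ i₀, f₁ + g₁, add_mem h₁ i₁, f₂ + g₂, add_mem h₂ i₂, f₃ + g₃,
      add_mem h₃ i₃, ?_⟩
    rw [add_mul, e, e']
    simp only [map_add]
    ring
  | mul x x' _ _ h h' =>
    intro y hy
    rw [mul_assoc]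
    exact h _ (h' y hy)

/-- A function in `k[G/N]` that is killed by the unipotent derivations is in the image of the
Frobenius endomorphism. -/
theorem exists_eq_frob [CharP k 2] {f : O k} (hf : f ∈ B₀ k) (h : ∀ i, unipotentDeriv k i f = 0) :
    ∃ g ∈ B₀ k, f = frob k 1 g := by
  obtain ⟨f₀, h₀, f₁, -, f₂, -, f₃, -, rfl⟩ := exists_frob_decomposition hf
  have e0 := h 0
  have e1 := h 1
  simp only [map_add, unipotentDeriv_mul, unipotentDeriv_frob, unipotentDeriv_u,
    unipotentDeriv_v] at e0 e1
  norm_num at e0 e1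
  -- The first derivatives are F(f₁) + F(f₃)v and F(f₂) + F(f₃)u. Differentiating the former in v
  -- isolates F(f₃); then F(f₁) and F(f₂) vanish too.
  have e2 := congrArg (unipotentDeriv k 1) e0
  simp only [map_add, unipotentDeriv_mul, unipotentDeriv_frob, unipotentDeriv_v] at e2
  norm_num at e2
  rw [e2] at e0 e1
  refine ⟨f₀, h₀, ?_⟩
  rw [e2]
  norm_num at e0 e1
  rw [e0, e1]
  ring

/-- If f = F^s(g) with s < r, both derivations kill g, so g is itself a Frobenius image; r such
steps are available. -/
theorem exists_frob_of_invariant [CharP k 2] (r : ℕ) {f : O k} (hf : f ∈ B₀ k)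
    (h : subgroupCoaction (toFrobKer k r) f = f ⊗ₜ 1) : ∃ g ∈ B₀ k, f = frob k r g := by
  suffices hs : ∀ s ≤ r, ∃ g ∈ B₀ k, f = frob k s g from hs r le_rfl
  intro s
  induction s with
  | zero => exact fun _ => ⟨f, hf, by rw [frob_zero]; rfl⟩
  | succ s ih =>
    intro hs
    obtain ⟨g, hg, rfl⟩ := ih (by omega)
    obtain ⟨g', hg', rfl⟩ := exists_eq_frob hg fun i => unipotentDeriv_eq_zero i hs h
    exact ⟨g', hg', frob_frob s 1 g'⟩

end SL2

/-! ### The twist of k[G/N] as the invariants of a Frobenius kernel -/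

namespace SL2

open Matrix Comod

variable {k : Type u} [Field k] [CharP k 2]

/-- Frobenius as a morphism from the twist of `k[G]`. -/
noncomputable def frobRegular (k : Type u) [Field k] [CharP k 2] (r : ℕ) :
    twist k r (regular k).toComod ⟶ (regular k).toComod :=
  mkHom (X := twist k r (regular k).toComod) (Y := (regular k).toComod) (frob k r).toLinearMap (by
    apply LinearMap.ext
    intro f
    have h := AlgHom.congr_fun (leftRegular_frob (k := k) r) f
    refine h.trans ?_
    change _ = LinearMap.rTensor (O k) (frob k r).toLinearMap
      (LinearMap.lTensor (O k) (frob k r).toLinearMap (leftRegular k f))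
    rw [← LinearMap.comp_apply, LinearMap.rTensor_comp_lTensor]
    rfl)

theorem exists_frobHomogeneous (r : ℕ) :
    ∃ e : twist k r (homogeneous (N k)).toComod ⟶ (homogeneous (N k)).toComod,
      e ≫ homogeneousι (N k) =
        resMap (frobHom k r).toCoalgHom (homogeneousι (N k)) ≫ frobRegular k r := by
  apply exists_lift _ (homogeneousι_injective _)
  rintro _ ⟨f, rfl⟩
  exact mem_range_homogeneousι (N k) (B₀_eq.le (frob_mem_B₀ r (B₀_eq.ge
    (f : (homogeneous (N k)).A).2)))

/-- Frobenius as a morphism from the twist of `k[G/N]`. -/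
noncomputable def frobHomogeneous (k : Type u) [Field k] [CharP k 2] (r : ℕ) :
    twist k r (homogeneous (N k)).toComod ⟶ (homogeneous (N k)).toComod :=
  (exists_frobHomogeneous r).choose

theorem frobHomogeneous_coe (r : ℕ) (f : (homogeneous (N k)).A) :
    ((lin (X := twist k r (homogeneous (N k)).toComod) (frobHomogeneous k r) f :
      (homogeneous (N k)).A) : O k) = frob k r f :=
  LinearMap.congr_fun (congrArg lin (exists_frobHomogeneous r).choose_spec) f

/-- Tensoring the inclusion k[G/N] → k[G] with k[G_r] keeps it injective, so invariance can be
tested in k[G]. -/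
theorem mem_invariants_iff (r : ℕ) (f : (homogeneous (N k)).A) :
    f ∈ (resFrobKer k r (homogeneous (N k)).toComod).invariants ↔
      subgroupCoaction (toFrobKer k r) (f : O k) = (f : O k) ⊗ₜ 1 := by
  have h := comm_apply (resMap (toFrobKer k r).toCoalgHom (homogeneousι (N k))) f
  have h1 : subgroupCoaction (toFrobKer k r) (f : O k) =
      LinearMap.rTensor (OFrob k r) (lin (homogeneousι (N k)))
        ((resFrobKer k r (homogeneous (N k)).toComod).ρ f) := h
  have h2 : (f : O k) ⊗ₜ[k] (1 : OFrob k r) =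
      LinearMap.rTensor (OFrob k r) (lin (homogeneousι (N k))) (f ⊗ₜ[k] (1 : OFrob k r)) := rfl
  rw [h1, h2, (rTensor_injective (OFrob k r) (homogeneousι_injective (N k))).eq_iff]
  rfl

/-- The inclusion of the invariants of `G_r`. -/
noncomputable def invariantsι (r : ℕ) (X : Comod k (O k)) : frobInvariants k r X ⟶ X :=
  subι X (resFrobKer k r X).invariants (invariants_stable r X)

theorem exists_frobInvariants (r : ℕ) :
    ∃ e : twist k r (homogeneous (N k)).toComod ⟶ frobInvariants k r (homogeneous (N k)).toComod,
      e ≫ invariantsι r (homogeneous (N k)).toComod = frobHomogeneous k r := by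
  refine exists_lift (invariantsι r (homogeneous (N k)).toComod) Subtype.val_injective
    (frobHomogeneous k r) ?_
  rintro _ ⟨f, rfl⟩
  have h : (lin (frobHomogeneous k r) f : (homogeneous (N k)).A) ∈
      (resFrobKer k r (homogeneous (N k)).toComod).invariants := by
    rw [mem_invariants_iff]
    have h1 := frobHomogeneous_coe r (f : (homogeneous (N k)).A)
    exact (congrArg (subgroupCoaction (toFrobKer k r)) h1).trans
      ((subgroupCoaction_frob r _).trans (congrArg (fun x => x ⊗ₜ[k] (1 : OFrob k r)) h1.symm))
  exact ⟨⟨_, h⟩, rfl⟩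

/-- Frobenius as a morphism from the twist of `k[G/N]` to the invariants of `G_r`. -/
noncomputable def frobToInvariants (k : Type u) [Field k] [CharP k 2] (r : ℕ) :
    twist k r (homogeneous (N k)).toComod ⟶ frobInvariants k r (homogeneous (N k)).toComod :=
  (exists_frobInvariants r).choose

theorem frobToInvariants_coe (r : ℕ) (f : (homogeneous (N k)).A) :
    (((lin (X := twist k r (homogeneous (N k)).toComod) (frobToInvariants k r) f).1 :
      (homogeneous (N k)).A) : O k) = frob k r f :=
  (congrArg Subtype.val (LinearMap.congr_fun
    (congrArg lin (exists_frobInvariants r).choose_spec) f)).trans (frobHomogeneous_coe r f)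

theorem frobToInvariants_bijective (r : ℕ) :
    Function.Bijective (lin (frobToInvariants k r)) := by
  constructor
  · intro x y h
    apply Subtype.ext
    apply frob_injective r
    rw [← frobToInvariants_coe, ← frobToInvariants_coe]
    exact congrArg (fun z : (frobInvariants k r (homogeneous (N k)).toComod).V =>
      ((z.1 : (homogeneous (N k)).A) : O k)) h
  · rintro ⟨f, hf⟩
    obtain ⟨g, hg, h⟩ := exists_frob_of_invariant r (B₀_eq.ge (f : (homogeneous (N k)).A).2)
      ((mem_invariants_iff r f).1 hf)
    refine ⟨(⟨g, B₀_eq.le hg⟩ : (homogeneous (N k)).A), Subtype.ext (Subtype.ext ?_)⟩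
    exact (frobToInvariants_coe r _).trans h.symm

/-- The twist of `k[G/N]` is the module of invariants of `G_r` in `k[G/N]`. -/
noncomputable def frobInvariantsIso (k : Type u) [Field k] [CharP k 2] (r : ℕ) :
    twist k r (homogeneous (N k)).toComod ≅ frobInvariants k r (homogeneous (N k)).toComod :=
  isoOfBijective (frobToInvariants k r) (frobToInvariants_bijective r)

/-- The twist of k[G/N] is a model of the invariants, and an isomorphism of twists is one of the
original modules because the comorphism of F^r is injective. -/
theorem isUntwist_iff (r : ℕ) (V : Comod k (O k)) :
    IsUntwist r (frobInvariants k r (homogeneous (N k)).toComod) V ↔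
      Nonempty (V ≅ (homogeneous (N k)).toComod) := by
  constructor
  · rintro ⟨e⟩
    exact nonempty_iso_of_res (frobHom k r).toCoalgHom (frob_injective r)
      (e ≪≫ (frobInvariantsIso k r).symm)
  · rintro ⟨e⟩
    exact ⟨resIso _ e ≪≫ frobInvariantsIso k r⟩

end SL2

/-! ### The main theorem -/

theorem mainTheorem2 (k : Type u) [Field k] [CharP k 2] :
    -- the extension `0 → k[G/N] → k[G/T] → k[G/N] → 0`: `p` is `k[G/N]`-linear and maps `ad` to `1`
    ∃ (p : (SL2.homogeneous (SL2.T k)).toComod ⟶ (SL2.homogeneous (SL2.N k)).toComod)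
      (w : SL2.incl k ≫ p = 0)
      (hE : (ShortComplex.mk (SL2.incl k) p w).ShortExact),
      (∀ (x : (SL2.homogeneous (SL2.N k)).A) (y : (SL2.homogeneous (SL2.T k)).A),
        Comod.lin p (SL2.inclAlg k x * y : (SL2.homogeneous (SL2.T k)).A) =
          (x * Comod.lin p y : (SL2.homogeneous (SL2.N k)).A)) ∧
      (∃ y : (SL2.homogeneous (SL2.T k)).A, (y : SL2.O k) = SL2.gen k 0 0 * SL2.gen k 1 1 ∧
        Comod.lin p y = (1 : (SL2.homogeneous (SL2.N k)).A)) ∧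
      -- `Hⁱ(G, k[G/N]) = k`
      (∀ i : ℕ, Nonempty ((SL2.homogeneous (SL2.N k)).H i ≃ₗ[k] k)) ∧
      -- it is spanned by the Yoneda product of `k → k[G/N]` with `i` copies of the extension
      (∀ i : ℕ, Submodule.span k ({Comod.yonedaPower hE (SL2.homogeneous (SL2.N k)).unit i} :
        Set ((SL2.homogeneous (SL2.N k)).H i)) = ⊤) ∧
      -- the cohomology ring is a polynomial ring on the class of the extension, in degree one
      (∃ e : Polynomial k ≃+* DirectSum ℕ (SL2.homogeneous (SL2.N k)).H,
        (∀ (c : k) (q : Polynomial k), e (c • q) = c • e q) ∧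
        ∀ i : ℕ, e (Polynomial.X ^ i) = DirectSum.of (SL2.homogeneous (SL2.N k)).H i
          (Comod.yonedaPower hE (SL2.homogeneous (SL2.N k)).unit i)) ∧
      ∀ r : ℕ, 1 ≤ r →
        -- `Hⁱ(G_r, k[G/N]) = 0` for `i > 0`
        (∀ i : ℕ, 0 < i →
          Subsingleton ((SL2.resFrobKer k r (SL2.homogeneous (SL2.N k)).toComod).H i)) ∧
        -- `H⁰(G_r, k[G/N])^{(-r)} ≅ k[G/N]` as `G`-modules
        (∀ V : Comod k (SL2.O k),
          SL2.IsUntwist r (SL2.frobInvariants k r (SL2.homogeneous (SL2.N k)).toComod) V ↔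
            Nonempty (V ≅ (SL2.homogeneous (SL2.N k)).toComod)) ∧
        -- and the isomorphism can be chosen multiplicative
        (∃ e : SL2.twist k r (SL2.homogeneous (SL2.N k)).toComod ≅
            SL2.frobInvariants k r (SL2.homogeneous (SL2.N k)).toComod,
          ∀ x y : (SL2.homogeneous (SL2.N k)).A,
            ((Comod.lin e.hom (x * y : (SL2.homogeneous (SL2.N k)).A)).1 :
              (SL2.homogeneous (SL2.N k)).A) =
              (Comod.lin e.hom x).1 * (Comod.lin e.hom y).1) := by
  refine ⟨SL2.transfer k, SL2.incl_transfer, SL2.transfer_shortExact, SL2.transfer_mul,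
    ⟨SL2.wT k, rfl, SL2.transfer_wT⟩, fun i => ?_, fun i => ?_, ?_,
    fun r _ => ⟨fun i hi => Comod.subsingleton_H_of_injective _ i hi, SL2.isUntwist_iff r,
      SL2.frobInvariantsIso k r, fun x y => Subtype.ext ?_⟩⟩
  · obtain ⟨h0, h1⟩ := SL2.span_H (k := k) i
    exact ⟨(LinearEquiv.ofBijective (LinearMap.toSpanSingleton k _ _)
      ⟨smul_left_injective k h0, fun x => (h1 x).imp fun _ hc => hc.symm⟩).symm⟩
  · rw [eq_top_iff]
    intro x _
    obtain ⟨c, rfl⟩ := (SL2.span_H i).2 x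
    exact Submodule.smul_mem _ c (Submodule.mem_span_singleton_self _)
  · exact Comod.exists_polynomial_ringEquiv (SL2.homogeneous (SL2.N k)) _
      (fun i => (SL2.span_H i).1) (fun i => (SL2.span_H i).2) SL2.cup_H
  · refine (SL2.frobToInvariants_coe r (x * y : (SL2.homogeneous (SL2.N k)).A)).trans ?_
    refine (map_mul (SL2.frob k r) (x : SL2.O k) (y : SL2.O k)).trans ?_
    exact congrArg₂ (· * ·) (SL2.frobToInvariants_coe r x).symm (SL2.frobToInvariants_coe r y).symm
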